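/- Let $c_1>0$ and $\alpha_M>0$ be constants. All spaces $L^2$ are complex, with Lebesgue measure, $\mathbb R_+=(0,\infty)$, and points of $\mathbb R_+\times\mathbb R$ are written $(r,y)$; a dot denotes $\partial/\partial r$, a prime $\partial/\partial y$. For $\bar\mu,\bar\Lambda\in\mathbb R$ consider (for vanishing spatial curvature $\tilde\kappa=0$) $$H_2\psi=-c_1\psi''+2\alpha_M y^4\psi-\bar\mu y^2\psi,\qquad H_1\psi=-\ddot\psi-\bar\Lambda r^4\psi,\qquad \tilde H_1\psi=-\ddot\psi+r^4\psi .$$ These are regarded as operators in $L^2(\mathbb R)$ (for $H_2$), in $L^2(\mathbb R_+)$ (for $H_1,\tilde H_1$), and also, all of them, in $L^2(\mathbb R_+\times\mathbb R)$. In each case, with $\Omega$ the underlying open set, the domain consists of those elements of the energy space to which the differential expression, applied in the sense of distributions, assigns an element of $L^2(\Omega)$; the energy space is the completion in $L^2(\Omega)$ of $C_c^\infty(\Omega)$ with respect to the norm $\|\psi\|_{L^2}+\|\psi'\|_{L^2}+\|y^2\psi\|_{L^2}$ for $H_2$, and $\|\psi\|_{L^2}+\|\dot\psi\|_{L^2}+\|r^2\psi\|_{L^2}$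 for $H_1,\tilde H_1$. **Theorem.** There is exactly one $\bar\mu_0\in\mathbb R$ such that for $\bar\mu=\bar\mu_0$ the smallest eigenvalue of $H_2$ in $L^2(\mathbb R)$ is $0$, and $\bar\mu_0>0$. Let $\bar\mu<\bar\mu_0$ (in particular $\bar\mu=0$ is allowed). Then the eigenvalues of $\tilde H_1$ in $L^2(\mathbb R_+)$ and of $H_2$ in $L^2(\mathbb R)$ form strictly increasing sequences $0<\tilde\lambda_0<\tilde\lambda_1<\dots$ and $0<\mu_0<\mu_1<\dots$; $H_2$ maps its domain in $L^2(\mathbb R_+\times\mathbb R)$ bijectively onto $L^2(\mathbb R_+\times\mathbb R)$; and there is a self-adjoint operator $H$ in $L^2(\mathbb R_+\times\mathbb R)$, $$H=H_2^{-1}\tilde H_1=\tilde H_1H_2^{-1},$$ where the composition $\tilde H_1H_2^{-1}$ has its natural domain and $H$ is the closure of $H_2^{-1}\tilde H_1$ with its natural domain, with the following properties. 1. $H$ has pure point spectrum. Its set of eigenvalues is $\{\lambda_{ij}: i,j\in\mathbb N\}$, where $\lambda_{ij}=\tilde\lambda_i\mu_j^{-1}>0$. There are eigenfunctions $\tilde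 u_i$ of $\tilde H_1$ with eigenvalue $\tilde\lambda_i$ and $\eta_j$ of $H_2$ with eigenvalue $\mu_j$ such that the products $\tilde\psi_{ij}(r,y)=\tilde u_i(r)\eta_j(y)$ form an orthonormal basis of $L^2(\mathbb R_+\times\mathbb R)$ and are eigenfunctions of $H_2^{-1}\tilde H_1$ and of $H$ with eigenvalues $\lambda_{ij}$; $H$ is the closure of its restriction to the linear span of the $\tilde\psi_{ij}$. 2. $\lambda_{ij}$ is strictly increasing in $i$ and strictly decreasing in $j$, with $\lim_i\lambda_{ij}=\infty$ for every $j$ and $\lim_j\lambda_{ij}=0$ for every $i$. 3. The rescaled eigenfunctions $\psi_{ij}(r,y)=\tilde\psi_{ij}(\lambda_{ij}^{-1/2}r,y)$ solve the Wheeler–DeWitt equation $$H_2\psi_{ij}-H_1\psi_{ij}=0,\qquad H_1\psi_{ij}=-\ddot\psi_{ij}-\bar\Lambda_{ij}r^4\psi_{ij},\qquad \bar\Lambda_{ij}=-\lambda_{ij}^{-3},$$ where being a solution means: it is of class $C^2$ and the equation holds at every point of $\mathbb R_+\times\mathbb R$, and it belongs to the domains of $H_1$ and $H_2$ in $L^2(\mathbb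 R_+\times\mathbb R)$, the equation also holding there. 4. For every finite linear combination $\sum a_{ij}\tilde\psi_{ij}$ the Schrödinger equation $i\,\partial_t\Psi=H\Psi$, $t\in\mathbb R$, with initial value $\Psi(0)=\sum a_{ij}\tilde\psi_{ij}$ has exactly one solution, namely $\Psi(t)=\sum a_{ij}e^{-i\lambda_{ij}t}\tilde\psi_{ij}$; and for all $t,i,j$ the correspondingly rescaled component $a_{ij}e^{-i\lambda_{ij}t}\psi_{ij}$ solves the Wheeler–DeWitt equation with constant $\bar\Lambda_{ij}$. -/

import Mathlib

open MeasureTheory Set Filter Topology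
open scoped ContDiff

namespace WheelerDeWitt

noncomputable section

/-! ### Schroedinger operators on `L²(Ω, ℂ)` defined by completing test functions -/

/-- The complex Hilbert space `L²(Ω, ℂ)` with respect to Lebesgue measure. -/
abbrev L2 {X : Type} [MeasureSpace X] (Ω : Set X) : Type :=
  Lp ℂ 2 ((volume : Measure X).restrict Ω)

section Operator

variable {X : Type} [NormedAddCommGroup X] [NormedSpace ℝ X]

/-- `φ ∈ C_c^∞(Ω, ℂ)`. -/
structure IsTestFunction (Ω : Set X) (φ : X → ℂ) : Prop where
  smooth : ContDiff ℝ ∞ φ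
  compact : HasCompactSupport φ
  support : tsupport φ ⊆ Ω

/-- The derivative of `φ` in the direction `e`. -/
def dirDeriv (e : X) (φ : X → ℂ) (x : X) : ℂ := fderiv ℝ φ x e

/-- The differential expression `- c ∂ₑ² φ + q φ`. -/
def diffExpr (e : X) (c : ℝ) (q : C(X, ℝ)) (φ : X → ℂ) (x : X) : ℂ :=
  -(c : ℂ) * dirDeriv e (dirDeriv e φ) x + (q x : ℂ) * φ x

theorem IsTestFunction.zero (Ω : Set X) : IsTestFunction Ω (0 : X → ℂ) :=
  ⟨contDiff_const, HasCompactSupport.zero, by simp [tsupport]⟩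

theorem IsTestFunction.add {Ω : Set X} {φ χ : X → ℂ} (hφ : IsTestFunction Ω φ)
    (hχ : IsTestFunction Ω χ) : IsTestFunction Ω (φ + χ) :=
  ⟨hφ.smooth.add hχ.smooth, hφ.compact.add hχ.compact,
    (tsupport_add φ χ).trans (union_subset hφ.support hχ.support)⟩

theorem IsTestFunction.smul {Ω : Set X} {φ : X → ℂ} (z : ℂ) (hφ : IsTestFunction Ω φ) :
    IsTestFunction Ω (z • φ) :=
  ⟨hφ.smooth.const_smul z, hφ.compact.smul_left (f := fun _ => z),
    (tsupport_smul_subset_right (fun _ => z) φ).trans hφ.support⟩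

theorem dirDeriv_add {φ χ : X → ℂ} (hφ : ContDiff ℝ ∞ φ) (hχ : ContDiff ℝ ∞ χ) (e : X) :
    dirDeriv e (φ + χ) = dirDeriv e φ + dirDeriv e χ := by
  ext x
  simp [dirDeriv, fderiv_add (hφ.differentiable (by simp) x) (hχ.differentiable (by simp) x)]

theorem dirDeriv_smul {φ : X → ℂ} (hφ : ContDiff ℝ ∞ φ) (z : ℂ) (e : X) :
    dirDeriv e (z • φ) = z • dirDeriv e φ := by
  ext x
  simp [dirDeriv, fderiv_const_smul (hφ.differentiable (by simp) x) z]

theorem dirDeriv_zero (e : X) : dirDeriv e (0 : X → ℂ) = 0 := by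
  ext x
  simp [dirDeriv]

theorem contDiff_dirDeriv {φ : X → ℂ} (hφ : ContDiff ℝ ∞ φ) (e : X) :
    ContDiff ℝ ∞ (dirDeriv e φ) :=
  (hφ.fderiv_right (m := ∞) (by simp)).clm_apply contDiff_const

theorem hasCompactSupport_dirDeriv {φ : X → ℂ} (hφ : HasCompactSupport φ) (e : X) :
    HasCompactSupport (dirDeriv e φ) :=
  hφ.fderiv_apply (𝕜 := ℝ) e

variable [MeasureSpace X] [BorelSpace X] [FiniteDimensional ℝ X]
  [IsLocallyFiniteMeasure (volume : Measure X)]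

/-- The set of all triples `(φ, ∂ₑ φ, w φ)` in `L²(Ω)³` with `φ ∈ C_c^∞(Ω)`. -/
def testTriples (Ω : Set X) (e : X) (w : X → ℝ) : Submodule ℂ (L2 Ω × L2 Ω × L2 Ω) where
  carrier := {t | ∃ φ : X → ℂ, IsTestFunction Ω φ ∧
    t.1 =ᵐ[volume.restrict Ω] φ ∧
    t.2.1 =ᵐ[volume.restrict Ω] dirDeriv e φ ∧
    t.2.2 =ᵐ[volume.restrict Ω] fun x => (w x : ℂ) * φ x}
  add_mem' := by
    rintro s t ⟨φ, hφ, h1, h2, h3⟩ ⟨χ, hχ, k1, k2, k3⟩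
    refine ⟨φ + χ, hφ.add hχ, (Lp.coeFn_add _ _).trans (h1.add k1), ?_, ?_⟩
    · rw [dirDeriv_add hφ.smooth hχ.smooth]
      exact (Lp.coeFn_add _ _).trans (h2.add k2)
    · refine (Lp.coeFn_add _ _).trans ((h3.add k3).trans (Eventually.of_forall fun x => ?_))
      simp [mul_add]
  zero_mem' := by
    refine ⟨0, IsTestFunction.zero Ω, Lp.coeFn_zero _ _ _, ?_, ?_⟩
    · rw [dirDeriv_zero]
      exact Lp.coeFn_zero _ _ _
    · refine (Lp.coeFn_zero _ _ _).trans (Eventually.of_forall fun x => ?_)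
      simp
  smul_mem' := by
    rintro z t ⟨φ, hφ, h1, h2, h3⟩
    refine ⟨z • φ, hφ.smul z, (Lp.coeFn_smul _ _).trans (h1.const_smul z), ?_, ?_⟩
    · rw [dirDeriv_smul hφ.smooth]
      exact (Lp.coeFn_smul _ _).trans (h2.const_smul z)
    · refine (Lp.coeFn_smul _ _).trans ((h3.const_smul z).trans (Eventually.of_forall fun x => ?_))
      simp [mul_left_comm]

/-- The energy space: the completion of `C_c^∞(Ω)` for the norm
`∫ |ψ|² + ∫ |∂ₑ ψ|² + ∫ |w ψ|²`, realised as a subspace of `L²(Ω)`. -/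
def energySpace (Ω : Set X) (e : X) (w : X → ℝ) : Submodule ℂ (L2 Ω) :=
  (testTriples Ω e w).topologicalClosure.map (LinearMap.fst ℂ (L2 Ω) (L2 Ω × L2 Ω))

theorem IsTestFunction.memLp_diffExpr {Ω : Set X} {φ : X → ℂ} (hφ : IsTestFunction Ω φ)
    (e : X) (c : ℝ) (q : C(X, ℝ)) : MemLp (diffExpr e c q φ) 2 (volume.restrict Ω) := by
  refine Continuous.memLp_of_hasCompactSupport ?_ ?_
  · have h1 := (contDiff_dirDeriv (contDiff_dirDeriv hφ.smooth e) e).continuous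
    have h2 := hφ.smooth.continuous
    unfold diffExpr
    fun_prop
  · have h1 := hasCompactSupport_dirDeriv (hasCompactSupport_dirDeriv hφ.compact e) e
    exact (h1.mul_left (f := fun _ => -(c : ℂ))).add
      (hφ.compact.mul_left (f := fun x => (q x : ℂ)))

theorem IsTestFunction.memLp {Ω : Set X} {φ : X → ℂ} (hφ : IsTestFunction Ω φ) :
    MemLp φ 2 (volume.restrict Ω) :=
  hφ.smooth.continuous.memLp_of_hasCompactSupport hφ.compact

/-- All pairs `(ψ, f)` in `L²(Ω)²` such that `ψ` lies in the energy space and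
`- c ∂ₑ² ψ + q ψ = f` holds in the sense of distributions in `Ω`. -/
def operatorGraph (Ω : Set X) (e : X) (c : ℝ) (q : C(X, ℝ)) (w : X → ℝ) :
    Submodule ℂ (L2 Ω × L2 Ω) where
  carrier := {p | p.1 ∈ energySpace Ω e w ∧ ∀ φ : X → ℂ, IsTestFunction Ω φ →
    ∫ x in Ω, p.1 x * diffExpr e c q φ x = ∫ x in Ω, p.2 x * φ x}
  add_mem' := by
    rintro s t ⟨h1, h2⟩ ⟨k1, k2⟩
    refine ⟨add_mem h1 k1, fun φ hφ => ?_⟩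
    have hL := hφ.memLp_diffExpr e c q
    have e1 : ∫ x in Ω, (s + t).1 x * diffExpr e c q φ x =
        ∫ x in Ω, (s.1 x * diffExpr e c q φ x + t.1 x * diffExpr e c q φ x) := by
      refine integral_congr_ae ?_
      filter_upwards [Lp.coeFn_add s.1 t.1] with x hx
      rw [Prod.fst_add, hx, Pi.add_apply, add_mul]
    have e2 : ∫ x in Ω, (s + t).2 x * φ x = ∫ x in Ω, (s.2 x * φ x + t.2 x * φ x) := by
      refine integral_congr_ae ?_
      filter_upwards [Lp.coeFn_add s.2 t.2] with x hx
      rw [Prod.snd_add, hx, Pi.add_apply, add_mul]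
    have i1 : ∀ ξ : L2 Ω, Integrable (fun x => ξ x * diffExpr e c q φ x) (volume.restrict Ω) :=
      fun ξ => (Lp.memLp ξ).integrable_mul hL
    have i2 : ∀ ξ : L2 Ω, Integrable (fun x => ξ x * φ x) (volume.restrict Ω) :=
      fun ξ => (Lp.memLp ξ).integrable_mul hφ.memLp
    rw [e1, e2, integral_add (i1 _) (i1 _),
      integral_add (i2 _) (i2 _),
      h2 φ hφ, k2 φ hφ]
  zero_mem' := by
    refine ⟨zero_mem _, fun φ _ => ?_⟩
    have e1 : ∫ x in Ω, (0 : L2 Ω) x * diffExpr e c q φ x = 0 := by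
      refine integral_eq_zero_of_ae ?_
      filter_upwards [Lp.coeFn_zero ℂ 2 ((volume : Measure X).restrict Ω)] with x hx
      rw [hx, Pi.zero_apply, zero_mul]
    have e2 : ∫ x in Ω, (0 : L2 Ω) x * φ x = 0 := by
      refine integral_eq_zero_of_ae ?_
      filter_upwards [Lp.coeFn_zero ℂ 2 ((volume : Measure X).restrict Ω)] with x hx
      rw [hx, Pi.zero_apply, zero_mul]
    exact e1.trans e2.symm
  smul_mem' := by
    rintro z t ⟨h1, h2⟩
    refine ⟨Submodule.smul_mem _ z h1, fun φ hφ => ?_⟩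
    have e1 : ∫ x in Ω, (z • t).1 x * diffExpr e c q φ x =
        ∫ x in Ω, z * (t.1 x * diffExpr e c q φ x) := by
      refine integral_congr_ae ?_
      filter_upwards [Lp.coeFn_smul z t.1] with x hx
      rw [Prod.smul_fst, hx, Pi.smul_apply, smul_eq_mul, mul_assoc]
    have e2 : ∫ x in Ω, (z • t).2 x * φ x = ∫ x in Ω, z * (t.2 x * φ x) := by
      refine integral_congr_ae ?_
      filter_upwards [Lp.coeFn_smul z t.2] with x hx
      rw [Prod.smul_snd, hx, Pi.smul_apply, smul_eq_mul, mul_assoc]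
    rw [e1, e2, integral_const_mul, integral_const_mul, h2 φ hφ]

/-- The operator `- c ∂ₑ² + q` in `L²(Ω)` whose domain consists of those `ψ` in the energy space
for which `- c ∂ₑ² ψ + q ψ`, computed in the sense of distributions, belongs to `L²(Ω)`. -/
def diffOperator (Ω : Set X) (e : X) (c : ℝ) (q : C(X, ℝ)) (w : X → ℝ) : L2 Ω →ₗ.[ℂ] L2 Ω :=
  (operatorGraph Ω e c q w).toLinearPMap

/-- On an open set the distribution determines the value, so that the graph of the operator is
the set of pairs that it was defined from. -/
theorem graph_diffOperator {Ω : Set X} (hΩ : IsOpen Ω) (e : X) (c : ℝ) (q : C(X, ℝ)) (w : X → ℝ) :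
    (diffOperator Ω e c q w).graph = operatorGraph Ω e c q w := by
  refine Submodule.toLinearPMap_graph_eq _ ?_
  rintro ⟨ψ, f⟩ ⟨-, h⟩ (rfl : ψ = 0)
  have hloc : LocallyIntegrableOn (f : X → ℂ) Ω volume := by
    have h1 : LocallyIntegrable (f : X → ℂ) (volume.restrict Ω) :=
      (Lp.memLp f).locallyIntegrable (by norm_num)
    exact locallyIntegrableOn_of_locallyIntegrable_restrict h1
  have key := hΩ.ae_eq_zero_of_integral_contDiff_smul_eq_zero hloc ?_
  · refine Lp.ext ?_
    have := (ae_restrict_iff' hΩ.measurableSet).2 key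
    filter_upwards [this, Lp.coeFn_zero ℂ 2 ((volume : Measure X).restrict Ω)] with x hx h0
    exact hx.trans h0.symm
  · intro g hg hgc hgs
    have hsup : Function.support (fun x => (g x : ℂ)) = Function.support g := by
      ext x
      simp
    have ht : IsTestFunction Ω (fun x => (g x : ℂ)) := by
      refine ⟨Complex.ofRealCLM.contDiff.comp hg, hgc.comp_left (g := Complex.ofReal) rfl, ?_⟩
      rw [tsupport, hsup]
      exact hgs
    have h2 := h _ ht
    have e1 : ∫ x in Ω, (0 : L2 Ω) x * diffExpr e c q (fun x => (g x : ℂ)) x = 0 := by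
      refine integral_eq_zero_of_ae ?_
      filter_upwards [Lp.coeFn_zero ℂ 2 ((volume : Measure X).restrict Ω)] with x hx
      rw [hx, Pi.zero_apply, zero_mul]
    rw [e1] at h2
    have e3 : ∫ x, g x • f x = ∫ x in Ω, g x • f x := by
      refine (setIntegral_eq_integral_of_forall_compl_eq_zero fun x hx => ?_).symm
      have : g x = 0 := by
        by_contra hne
        exact hx (hgs (subset_tsupport g hne))
      simp [this]
    rw [e3, h2]
    refine integral_congr_ae (Eventually.of_forall fun x => ?_)
    simp [mul_comm]

end Operator

/-! ### Generalities on partially defined operators -/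

/-- The composition `S ∘ T` with its natural domain `{x ∈ D(T) | T x ∈ D(S)}`. -/
def natComp {E : Type} [AddCommGroup E] [Module ℂ E] (S T : E →ₗ.[ℂ] E) : E →ₗ.[ℂ] E :=
  S.comp (T.domRestrict ((S.domain.comap T.toFun).map T.domain.subtype)) (by
    rintro ⟨x, hx⟩
    obtain ⟨⟨y, hy, rfl⟩, h⟩ := hx
    exact hy)

/-- The set of eigenvalues of `T`. -/
def eigenvalueSet {E : Type} [AddCommGroup E] [Module ℂ E] (T : E →ₗ.[ℂ] E) : Set ℂ :=
  {z | ∃ x : T.domain, (x : E) ≠ 0 ∧ T x = z • (x : E)}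

/-- The function `f` represents an eigenvector of `T` with eigenvalue `z`. -/
def IsEigenfunction {X : Type} [MeasureSpace X] {Ω : Set X} (T : L2 Ω →ₗ.[ℂ] L2 Ω)
    (z : ℂ) (f : X → ℂ) : Prop :=
  ∃ x : T.domain, (x : L2 Ω) ≠ 0 ∧ (x : L2 Ω) =ᵐ[volume.restrict Ω] f ∧ T x = z • (x : L2 Ω)

/-- `Ψ` solves the Schroedinger equation `i dΨ/dt = T Ψ`. -/
def IsSchroedingerSolution {E : Type} [NormedAddCommGroup E] [NormedSpace ℂ E]
    (T : E →ₗ.[ℂ] E) (Ψ : ℝ → E) : Prop :=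
  ∀ t : ℝ, ∃ h : Ψ t ∈ T.domain, HasDerivAt Ψ (-Complex.I • T ⟨Ψ t, h⟩) t

/-! ### The Hamiltonians for vanishing spatial curvature -/

/-- The half-line `ℝ₊`. -/
abbrev halfLine : Set ℝ := Ioi 0

/-- The half-plane `ℝ₊ × ℝ` with coordinates `(r, y)`. -/
abbrev halfPlane : Set (ℝ × ℝ) := Ioi 0 ×ˢ univ

/-- The gravitational Hamiltonian `H₁ u = - u'' - Λ r⁴ u` in `L²(ℝ₊)`. -/
def gravityLine (Λ : ℝ) : L2 halfLine →ₗ.[ℂ] L2 halfLine :=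
  diffOperator halfLine 1 1 ⟨fun r => -Λ * r ^ 4, by fun_prop⟩ (fun r => r ^ 2)

/-- The Hamiltonian `H₂ η = - c₁ η'' + 2 α_M y⁴ η - μ y² η` of the Yang-Mills field in `L²(ℝ)`. -/
def yangMillsLine (c₁ αM μ : ℝ) : L2 (univ : Set ℝ) →ₗ.[ℂ] L2 (univ : Set ℝ) :=
  diffOperator univ 1 c₁ ⟨fun y => 2 * αM * y ^ 4 - μ * y ^ 2, by fun_prop⟩ (fun y => y ^ 2)

/-- The gravitational Hamiltonian `H₁ ψ = - ∂²ψ/∂r² - Λ r⁴ ψ` in `L²(ℝ₊ × ℝ)`. -/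
def gravityPlane (Λ : ℝ) : L2 halfPlane →ₗ.[ℂ] L2 halfPlane :=
  diffOperator halfPlane (1, 0) 1 ⟨fun p => -Λ * p.1 ^ 4, by fun_prop⟩ (fun p => p.1 ^ 2)

/-- The Hamiltonian `H₂ ψ = - c₁ ∂²ψ/∂y² + 2 α_M y⁴ ψ - μ y² ψ` in `L²(ℝ₊ × ℝ)`. -/
def yangMillsPlane (c₁ αM μ : ℝ) : L2 halfPlane →ₗ.[ℂ] L2 halfPlane :=
  diffOperator halfPlane (0, 1) c₁ ⟨fun p => 2 * αM * p.2 ^ 4 - μ * p.2 ^ 2, by fun_prop⟩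
    (fun p => p.2 ^ 2)

/-- `- u'' + r⁴ u` in `L²(ℝ₊)`. -/
def tildeLine : L2 halfLine →ₗ.[ℂ] L2 halfLine := gravityLine (-1)

/-- `- ∂²ψ/∂r² + r⁴ ψ` in `L²(ℝ₊ × ℝ)`. -/
def tildePlane : L2 halfPlane →ₗ.[ℂ] L2 halfPlane := gravityPlane (-1)

/-- `ψ` solves the Wheeler-DeWitt equation `H₂ ψ - H₁ ψ = 0` with constant `Λ`: classically in
`ℝ₊ × ℝ`, and as an element of `L²(ℝ₊ × ℝ)` which belongs to the domains of both Hamiltonians. -/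
structure SolvesWheelerDeWitt (c₁ αM μ Λ : ℝ) (ψ : ℝ × ℝ → ℂ) : Prop where
  contDiffOn : ContDiffOn ℝ 2 ψ halfPlane
  equation : ∀ r y : ℝ, 0 < r →
    (-(c₁ : ℂ) * iteratedDeriv 2 (fun z : ℝ => ψ (r, z)) y
        + (2 * αM * y ^ 4 : ℝ) * ψ (r, y) - (μ * y ^ 2 : ℝ) * ψ (r, y))
      - (-iteratedDeriv 2 (fun s : ℝ => ψ (s, y)) r - (Λ * r ^ 4 : ℝ) * ψ (r, y)) = 0
  operators : ∃ Ψ f : L2 halfPlane, Ψ =ᵐ[volume.restrict halfPlane] ψ ∧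
    (Ψ, f) ∈ (gravityPlane Λ).graph ∧ (Ψ, f) ∈ (yangMillsPlane c₁ αM μ).graph

end

end WheelerDeWitt

open WheelerDeWitt

/-!
The operators in `L²(ℝ₊)` and `L²(ℝ)` have compact resolvents and simple eigenvalues, and the
operators in the half-plane are separated by the products of the eigenfunctions. Everything is
therefore reduced to one diagonal calculation.

Throughout, the potential is written as `q = β w² - 2 β κ w`, where `w` is the weight of the energy
space. Completing the square, `-c ∂² + q + (1 + β κ²)` is the operator of the positive definite form
`energyInner`, the energy space is a Hilbert space for this form, and its embedding `J` into `L²`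
gives the resolvent `J J*`; see `mem_graph_iff_resolvent`. As the resolvent is bounded and
symmetric, an operator of this kind with a Hilbert basis of eigenvectors is diagonal in that basis
with its maximal domain (`isDiagonal_diffOperator`). For diagonal operators, self-adjointness, the
eigenvalues, the compositions with inverses, the closures, the cores and the Schroedinger equation
are read off from the coefficients.

On the line there is a basis of eigenvectors by the following two facts. The resolvent is compact
(`isCompactOperator_resolvent`), because a function of bounded energy is small outside a bounded
interval and close to its averages over a fine grid inside. The eigenvalues are simple
(`eigenvector_unique`), because weak eigenfunctions are classical solutions of a second order
equation, and the Wronskian of two square integrable solutions with square integrable derivatives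
is constant and integrable on an interval of infinite length, hence zero.

The lowest eigenvalue of `-c₁ ∂² + 2 α_M y⁴ - m y²` is the minimum of functions that are affine and
strictly decreasing in `m`. So it is concave and strictly decreasing in `m`; it is positive at
`m = 0`, nonpositive for some `m`, and continuous, which yields the critical parameter
(`exists_critical_mass`).

In the half-plane, products of eigenvectors are eigenvectors of both operators
(`tensor_mem_operatorGraph_fst` and `tensor_mem_operatorGraph_snd`), and they form a Hilbert basis
by Fubini's theorem (`exists_hilbertBasis_tensor`). Finally, if `u` is an eigenfunction of
`-∂² + r⁴` with eigenvalue `l`, then `u(s r)` is one of `-∂² + s⁶ r⁴` with eigenvalue `s² l`. For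
`s² = m / l` this is the eigenvalue `m` of the other factor, so that the two sides of the
Wheeler-DeWitt equation agree (`solvesWheelerDeWitt_of_eigenvectors`).
-/

set_option linter.unusedSectionVars false

/-! ### Operators that are diagonal in a Hilbert basis -/

section Diagonal

variable {ι E : Type} [NormedAddCommGroup E] [InnerProductSpace ℂ E]

/-- The partially defined operator `T` is diagonal in the Hilbert basis `b`, with the real
numbers `d k` as diagonal entries and with the largest possible domain. -/
def IsDiagonal (b : HilbertBasis ι ℂ E) (d : ι → ℝ) (T : E →ₗ.[ℂ] E) : Prop :=
  ∀ x f : E, (x, f) ∈ T.graph ↔ ∀ k, b.repr f k = (d k : ℂ) * b.repr x k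

theorem HilbertBasis.ext_repr (b : HilbertBasis ι ℂ E) {x y : E}
    (h : ∀ k, b.repr x k = b.repr y k) : x = y :=
  b.repr.injective (lp.ext (funext h))

theorem HilbertBasis.repr_self_apply [DecidableEq ι] (b : HilbertBasis ι ℂ E) (k l : ι) :
    b.repr (b k) l = if l = k then 1 else 0 := by
  rw [b.repr_self, lp.single_apply]
  by_cases h : l = k
  · subst h; simp
  · simp [h]

theorem HilbertBasis.ne_zero (b : HilbertBasis ι ℂ E) (k : ι) : b k ≠ 0 :=
  b.orthonormal.ne_zero k

theorem HilbertBasis.exists_repr_eq (b : HilbertBasis ι ℂ E) (f : E) (m : ι → ℂ) (C : ℝ)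
    (hm : ∀ k, ‖m k‖ ≤ C) : ∃ x, ∀ k, b.repr x k = m k * b.repr f k := by
  have hmem : Memℓp (fun k => m k * b.repr f k) 2 := by
    have h := ((lp.memℓp (b.repr f)).norm).const_mul C
    refine memℓp_gen ?_
    have h2 := h.summable (by norm_num)
    refine h2.of_nonneg_of_le (fun k => by positivity) (fun k => ?_)
    refine Real.rpow_le_rpow (by positivity) ?_ (by norm_num)
    rw [norm_mul, norm_mul, norm_norm]
    exact mul_le_mul_of_nonneg_right ((hm k).trans (le_abs_self C)) (norm_nonneg _)
  exact ⟨b.repr.symm ⟨_, hmem⟩, fun k => by simp⟩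

variable {b : HilbertBasis ι ℂ E} {d : ι → ℝ} {T : E →ₗ.[ℂ] E}

theorem IsDiagonal.basis_mem (hT : IsDiagonal b d T) (k : ι) :
    (b k, (d k : ℂ) • b k) ∈ T.graph := by
  classical
  rw [hT]
  intro l
  rw [map_smul, lp.coeFn_smul, Pi.smul_apply, b.repr_self_apply]
  by_cases h : l = k
  · subst h; simp
  · simp [h]

theorem HilbertBasis.dense_of_mem (b : HilbertBasis ι ℂ E) (S : Submodule ℂ E)
    (h : ∀ k, b k ∈ S) : Dense (S : Set E) := by
  have h1 : Submodule.span ℂ (Set.range b) ≤ S := by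
    rw [Submodule.span_le]
    rintro _ ⟨k, rfl⟩
    exact h k
  have h2 := b.dense_span
  rw [← Submodule.dense_iff_topologicalClosure_eq_top] at h2
  exact h2.mono h1

theorem IsDiagonal.isSelfAdjoint [CompleteSpace E] (hT : IsDiagonal b d T) : IsSelfAdjoint T := by
  classical
  have hdense : Dense (T.domain : Set E) :=
    b.dense_of_mem _ fun k => LinearPMap.mem_domain_of_mem_graph (hT.basis_mem k)
  rw [LinearPMap.isSelfAdjoint_def]
  refine LinearPMap.eq_of_eq_graph ?_
  rw [LinearPMap.adjoint_graph_eq_graph_adjoint hdense]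
  ext ⟨y, z⟩
  rw [Submodule.mem_adjoint_iff, hT]
  constructor
  · intro h k
    have := h _ _ (hT.basis_mem k)
    rw [inner_smul_left, sub_eq_zero, ← b.repr_apply_apply, ← b.repr_apply_apply] at this
    simpa using this.symm
  · intro h a f haf
    rw [hT] at haf
    rw [sub_eq_zero, ← b.repr.inner_map_map, ← b.repr.inner_map_map a, lp.inner_eq_tsum,
      lp.inner_eq_tsum]
    refine tsum_congr fun k => ?_
    simp only [haf k, h k, RCLike.inner_apply, map_mul, Complex.conj_ofReal]
    ring

theorem IsDiagonal.isClosed [CompleteSpace E] (hT : IsDiagonal b d T) : T.IsClosed :=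
  hT.isSelfAdjoint.isClosed

/-- A diagonal operator is the closure of every restriction of it that is still defined on the
basis vectors. -/
theorem IsDiagonal.closure_eq [CompleteSpace E] (hT : IsDiagonal b d T) {S : E →ₗ.[ℂ] E}
    (hST : S ≤ T) (hS : ∀ k, b k ∈ S.domain) : S.IsClosable ∧ S.closure = T := by
  have hc : S.IsClosable := hT.isClosed.isClosable.leIsClosable hST
  refine ⟨hc, LinearPMap.eq_of_eq_graph ?_⟩
  rw [← hc.graph_closure_eq_closure_graph]
  refine le_antisymm ?_ ?_
  · exact Submodule.topologicalClosure_minimal _ (LinearPMap.le_graph_of_le hST) hT.isClosed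
  · rintro ⟨x, f⟩ hxf
    rw [hT] at hxf
    have hmem : ∀ k, (b k, (d k : ℂ) • b k) ∈ S.graph := by
      intro k
      have h1 := S.mem_graph ⟨b k, hS k⟩
      have h2 := T.mem_graph_snd_inj (LinearPMap.le_graph_of_le hST h1) (hT.basis_mem k) rfl
      rwa [h2] at h1
    have hs : HasSum (fun k => b.repr x k • (b k, (d k : ℂ) • b k)) (x, f) := by
      have h1 := b.hasSum_repr x
      have h2 := b.hasSum_repr f
      refine (h1.prodMk h2).congr_fun ?_
      intro k
      rw [Prod.smul_mk, hxf k, smul_smul, mul_comm]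
    exact mem_closure_of_tendsto hs (Eventually.of_forall fun s =>
      Submodule.sum_mem _ fun k _ => Submodule.smul_mem _ _ (hmem k))

theorem IsDiagonal.hasCore_span [CompleteSpace E] (hT : IsDiagonal b d T) :
    T.HasCore (Submodule.span ℂ (Set.range b)) := by
  have hle : Submodule.span ℂ (Set.range b) ≤ T.domain := by
    rw [Submodule.span_le]
    rintro _ ⟨k, rfl⟩
    exact LinearPMap.mem_domain_of_mem_graph (hT.basis_mem k)
  refine ⟨hle, (hT.closure_eq LinearPMap.domRestrict_le fun k => ?_).2⟩
  exact ⟨Submodule.subset_span ⟨k, rfl⟩, hle (Submodule.subset_span ⟨k, rfl⟩)⟩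

theorem mem_eigenvalueSet_iff {z : ℂ} :
    z ∈ eigenvalueSet T ↔ ∃ x, x ≠ 0 ∧ (x, z • x) ∈ T.graph := by
  constructor
  · rintro ⟨x, hx, h⟩
    exact ⟨x, hx, h ▸ T.mem_graph x⟩
  · rintro ⟨x, hx, h⟩
    obtain ⟨y, rfl, hy⟩ := (LinearPMap.mem_graph_iff T).1 h
    exact ⟨y, hx, hy⟩

theorem IsDiagonal.eigenvalueSet_eq (hT : IsDiagonal b d T) :
    eigenvalueSet T = Set.range fun k => (d k : ℂ) := by
  ext z
  rw [mem_eigenvalueSet_iff]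
  constructor
  · rintro ⟨x, hx, h⟩
    rw [hT] at h
    by_contra hz
    refine hx (b.ext_repr fun k => ?_)
    have h1 := h k
    have h2 : z - d k ≠ 0 := fun h0 => hz ⟨k, (sub_eq_zero.1 h0).symm⟩
    rw [map_smul, lp.coeFn_smul, Pi.smul_apply, smul_eq_mul] at h1
    have h3 : (z - d k) * b.repr x k = 0 := by rw [sub_mul, h1, sub_self]
    simpa using (mul_eq_zero.1 h3).resolve_left h2
  · rintro ⟨k, rfl⟩
    exact ⟨b k, b.ne_zero k, hT.basis_mem k⟩

theorem mem_graph_inverse (hT : T.toFun.ker = ⊥) (x f : E) :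
    (x, f) ∈ T.inverse.graph ↔ (f, x) ∈ T.graph := by
  rw [LinearPMap.inverse_graph hT]
  constructor
  · rintro ⟨⟨a, c⟩, h, hac⟩
    obtain ⟨rfl, rfl⟩ := Prod.mk.inj (show (c, a) = (x, f) from hac)
    exact h
  · exact fun h => ⟨(f, x), h, rfl⟩

theorem mem_graph_natComp (S T : E →ₗ.[ℂ] E) (x f : E) :
    (x, f) ∈ (natComp S T).graph ↔ ∃ y, (x, y) ∈ T.graph ∧ (y, f) ∈ S.graph := by
  constructor
  · intro h
    obtain ⟨⟨z, hz⟩, rfl, hf⟩ := (LinearPMap.mem_graph_iff _).1 h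
    obtain ⟨⟨w, hw, hwz⟩, hz2⟩ := hz
    refine ⟨T ⟨z, hz2⟩, T.mem_graph ⟨z, hz2⟩, ?_⟩
    rw [← show _ = f from hf]
    exact S.mem_graph ⟨T ⟨z, hz2⟩, _⟩
  · rintro ⟨y, h1, h2⟩
    obtain ⟨⟨x, hx⟩, rfl, rfl⟩ := (LinearPMap.mem_graph_iff _).1 h1
    obtain ⟨⟨y', hy'⟩, hy, rfl⟩ := (LinearPMap.mem_graph_iff _).1 h2
    dsimp only at hy
    subst hy
    rw [LinearPMap.mem_graph_iff]
    exact ⟨⟨x, ⟨⟨⟨x, hx⟩, hy', rfl⟩, hx⟩⟩, rfl, rfl⟩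

theorem IsDiagonal.ker_eq_bot (hT : IsDiagonal b d T) (hd : ∀ k, d k ≠ 0) : T.toFun.ker = ⊥ := by
  rw [eq_bot_iff]
  intro x hx
  have h1 := T.mem_graph x
  rw [show T x = 0 from hx, hT] at h1
  have h2 : (x : E) = 0 := b.ext_repr fun k => by
    have := h1 k
    simp [hd k] at this
    simpa using this
  simpa using h2

theorem IsDiagonal.exists_mem_graph (hT : IsDiagonal b d T) {δ : ℝ} (hδ : 0 < δ)
    (hd : ∀ k, δ ≤ d k) (f : E) : ∃ x, (x, f) ∈ T.graph := by
  obtain ⟨x, hx⟩ := b.exists_repr_eq f (fun k => ((d k : ℂ))⁻¹) δ⁻¹ fun k => by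
    rw [norm_inv, Complex.norm_real, Real.norm_of_nonneg (hδ.le.trans (hd k))]
    exact inv_anti₀ hδ (hd k)
  refine ⟨x, (hT _ _).2 fun k => ?_⟩
  have : (d k : ℂ) ≠ 0 := by exact_mod_cast (hδ.trans_le (hd k)).ne'
  rw [hx k, mul_inv_cancel_left₀ this]

theorem IsDiagonal.range_eq_top (hT : IsDiagonal b d T) {δ : ℝ} (hδ : 0 < δ)
    (hd : ∀ k, δ ≤ d k) : T.toFun.range = ⊤ := by
  rw [eq_top_iff]
  intro f _
  obtain ⟨x, hx⟩ := hT.exists_mem_graph hδ hd f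
  obtain ⟨y, -, hy⟩ := (LinearPMap.mem_graph_iff _).1 hx
  exact ⟨y, hy⟩

theorem IsDiagonal.natComp_inverse {S : E →ₗ.[ℂ] E} {m : ι → ℝ} (hS : IsDiagonal b m S)
    (hT : IsDiagonal b d T) {δ : ℝ} (hδ : 0 < δ) (hd : ∀ k, δ ≤ d k) :
    IsDiagonal b (fun k => m k * (d k)⁻¹) (natComp S T.inverse) := by
  have hd0 : ∀ k, d k ≠ 0 := fun k => (hδ.trans_le (hd k)).ne'
  have hd1 : ∀ k, (d k : ℂ) ≠ 0 := fun k => by exact_mod_cast hd0 k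
  intro x f
  simp only [mem_graph_natComp, mem_graph_inverse (hT.ker_eq_bot hd0)]
  constructor
  · rintro ⟨y, h1, h2⟩ k
    rw [hT] at h1
    rw [hS] at h2
    rw [h2 k, h1 k]
    push_cast
    field_simp [hd1 k]
  · intro h
    obtain ⟨y, hy⟩ := hT.exists_mem_graph hδ hd x
    refine ⟨y, hy, (hS _ _).2 fun k => ?_⟩
    rw [hT] at hy
    rw [h k, hy k]
    push_cast
    field_simp [hd1 k]

theorem IsDiagonal.inverse_natComp {S : E →ₗ.[ℂ] E} {m : ι → ℝ} (hS : IsDiagonal b m S)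
    (hT : IsDiagonal b d T) {δ : ℝ} (hδ : 0 < δ) (hd : ∀ k, δ ≤ d k) :
    natComp T.inverse S ≤ natComp S T.inverse ∧
      ∀ k, (b k, ((m k * (d k)⁻¹ : ℝ) : ℂ) • b k) ∈ (natComp T.inverse S).graph := by
  have hd0 : ∀ k, d k ≠ 0 := fun k => (hδ.trans_le (hd k)).ne'
  have hd1 : ∀ k, (d k : ℂ) ≠ 0 := fun k => by exact_mod_cast hd0 k
  constructor
  · refine LinearPMap.le_of_le_graph ?_
    rintro ⟨x, f⟩ h
    rw [mem_graph_natComp] at h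
    obtain ⟨y, h1, h2⟩ := h
    rw [mem_graph_inverse (hT.ker_eq_bot hd0), hT] at h2
    rw [hS] at h1
    rw [hS.natComp_inverse hT hδ hd]
    intro k
    have := h1 k
    rw [h2 k] at this
    push_cast
    rw [mul_right_comm, ← this, mul_comm, inv_mul_cancel_left₀ (hd1 k)]
  · intro k
    rw [mem_graph_natComp]
    refine ⟨_, hS.basis_mem k, ?_⟩
    rw [mem_graph_inverse (hT.ker_eq_bot hd0)]
    have := T.graph.smul_mem ((m k * (d k)⁻¹ : ℝ) : ℂ) (hT.basis_mem k)
    rw [Prod.smul_mk, smul_smul] at this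
    convert this using 3
    push_cast
    rw [inv_mul_cancel_right₀ (hd1 k)]

theorem HilbertBasis.repr_sum_smul (b : HilbertBasis ι ℂ E) (a : ι →₀ ℂ) (z : ι → ℂ) (k : ι) :
    b.repr (∑ p ∈ a.support, (a p * z p) • b p) k = a k * z k := by
  classical
  rw [map_sum, lp.coeFn_sum, Finset.sum_apply]
  simp only [map_smul, lp.coeFn_smul, Pi.smul_apply, b.repr_self_apply, smul_eq_mul, mul_ite,
    mul_one, mul_zero, Finset.sum_ite_eq]
  split_ifs with h
  · rfl
  · rw [Finsupp.notMem_support_iff.1 h, zero_mul]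

/-- The Schroedinger equation decouples into scalar equations for the coefficients. -/
theorem IsDiagonal.isSchroedingerSolution_iff (hT : IsDiagonal b d T) (a : ι →₀ ℂ) (Ψ : ℝ → E) :
    (Ψ 0 = ∑ p ∈ a.support, a p • b p ∧ IsSchroedingerSolution T Ψ) ↔
      ∀ t : ℝ, Ψ t = ∑ p ∈ a.support,
        (a p * Complex.exp (-Complex.I * (d p : ℂ) * (t : ℂ))) • b p := by
  have hexp : ∀ (z : ℂ) (t : ℝ), HasDerivAt (fun t : ℝ => Complex.exp (z * (t : ℂ)))
      (z * Complex.exp (z * (t : ℂ))) t := by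
    intro z t
    have h1 : HasDerivAt (fun t : ℝ => z * (t : ℂ)) (z * 1) t :=
      (Complex.ofRealCLM.hasDerivAt (x := t)).const_mul z
    simpa [mul_comm] using h1.cexp
  constructor
  · rintro ⟨h0, h⟩ t
    refine b.ext_repr fun k => ?_
    rw [b.repr_sum_smul a (fun p => Complex.exp (-Complex.I * (d p : ℂ) * (t : ℂ))) k]
    have hderiv : ∀ s : ℝ, HasDerivAt (fun s => b.repr (Ψ s) k)
        (-Complex.I * d k * b.repr (Ψ s) k) s := by
      intro s
      obtain ⟨hs, hd⟩ := h s
      have h1 := (hT _ _).1 (T.mem_graph ⟨Ψ s, hs⟩) k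
      have h2 := ((innerSL ℂ (b k)).restrictScalars ℝ).hasFDerivAt.comp_hasDerivAt s hd
      simp only [ContinuousLinearMap.coe_restrictScalars', innerSL_apply_apply, inner_smul_right] at h2
      rw [← b.repr_apply_apply, h1, ← mul_assoc] at h2
      refine h2.congr_of_eventuallyEq (Eventually.of_forall fun s => ?_)
      exact b.repr_apply_apply _ _
    have hconst : ∀ s : ℝ, HasDerivAt (fun s : ℝ => b.repr (Ψ s) k *
        Complex.exp (Complex.I * d k * (s : ℂ))) 0 s := by
      intro s
      refine ((hderiv s).mul (hexp (Complex.I * d k) s)).congr_deriv ?_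
      ring
    have hc := is_const_of_deriv_eq_zero (fun s => (hconst s).differentiableAt)
      (fun s => (hconst s).deriv) t 0
    have h00 : b.repr (Ψ 0) k = a k := by
      have := b.repr_sum_smul a (fun _ => 1) k
      simp only [mul_one] at this
      rw [h0, this]
    simp only [Complex.ofReal_zero, mul_zero, Complex.exp_zero, mul_one, h00] at hc
    rw [← hc, mul_assoc, ← Complex.exp_add]
    simp
  · intro h
    refine ⟨by simpa using h 0, fun t => ?_⟩
    have hg : (Ψ t, ∑ p ∈ a.support, (a p * Complex.exp (-Complex.I * (d p : ℂ) * (t : ℂ))) •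
        ((d p : ℂ) • b p)) ∈ T.graph := by
      rw [h t]
      have := Submodule.sum_mem T.graph (t := a.support) (f := fun p =>
        (a p * Complex.exp (-Complex.I * (d p : ℂ) * (t : ℂ))) • (b p, (d p : ℂ) • b p))
        fun p _ => Submodule.smul_mem _ _ (hT.basis_mem p)
      simpa [Prod.ext_iff, Prod.fst_sum, Prod.snd_sum] using this
    obtain ⟨⟨x, hx⟩, rfl, hx2⟩ := (LinearPMap.mem_graph_iff _).1 hg
    refine ⟨hx, ?_⟩
    dsimp only at hx2
    rw [hx2, Finset.smul_sum]
    have hΨ : Ψ = fun t : ℝ => ∑ p ∈ a.support,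
        (a p * Complex.exp (-Complex.I * (d p : ℂ) * (t : ℂ))) • b p := funext h
    rw [hΨ]
    refine HasDerivAt.fun_sum fun p _ => ?_
    refine (((hexp (-Complex.I * d p) t).const_mul (a p)).smul_const (b p)).congr_deriv ?_
    rw [smul_smul, smul_smul]
    congr 1
    ring

end Diagonal

namespace WheelerDeWitt

/-! ### The energy form and the resolvent -/

theorem integral_mul_eq_inner {X : Type} [MeasurableSpace X] {μ : Measure X} {g : X → ℂ}
    (hg : MemLp g 2 μ) (a : Lp ℂ 2 μ) :
    ∫ x, a x * g x ∂μ = inner ℂ (hg.star.toLp) a := by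
  rw [L2.inner_def]
  refine integral_congr_ae ?_
  filter_upwards [hg.star.coeFn_toLp] with x hx
  simp [hx]

theorem continuous_integral_mul {X : Type} [MeasurableSpace X] {μ : Measure X} {g : X → ℂ}
    (hg : MemLp g 2 μ) : Continuous fun a : Lp ℂ 2 μ => ∫ x, a x * g x ∂μ := by
  simp_rw [integral_mul_eq_inner hg]
  fun_prop

section Energy

variable {X : Type} [NormedAddCommGroup X] [NormedSpace ℝ X]

theorem IsTestFunction.conj {Ω : Set X} {φ : X → ℂ} (hφ : IsTestFunction Ω φ) :
    IsTestFunction Ω (star φ) := by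
  have hsup : Function.support (star φ) = Function.support φ := by
    ext x
    simp
  refine ⟨Complex.conjCLE.contDiff.comp hφ.smooth, ?_, ?_⟩
  · rw [HasCompactSupport, tsupport, hsup]
    exact hφ.compact
  · rw [tsupport, hsup]
    exact hφ.support

theorem dirDeriv_conj {φ : X → ℂ} (hφ : ContDiff ℝ ∞ φ) (e : X) :
    dirDeriv e (star φ) = star (dirDeriv e φ) := by
  ext x
  have h1 := (hφ.differentiable (by simp) x).hasFDerivAt
  have h2 := (Complex.conjCLE : ℂ →L[ℝ] ℂ).hasFDerivAt.comp x h1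
  have h3 : fderiv ℝ (star φ) x = _ := h2.fderiv
  rw [dirDeriv, h3]
  simp [dirDeriv]

theorem tsupport_dirDeriv_subset (φ : X → ℂ) (e : X) : tsupport (dirDeriv e φ) ⊆ tsupport φ :=
  tsupport_fderiv_apply_subset ℝ e

theorem IsTestFunction.derivative {Ω : Set X} {φ : X → ℂ} (hφ : IsTestFunction Ω φ) (e : X) :
    IsTestFunction Ω (dirDeriv e φ) :=
  ⟨contDiff_dirDeriv hφ.smooth e, hasCompactSupport_dirDeriv hφ.compact e,
    (tsupport_dirDeriv_subset φ e).trans hφ.support⟩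

theorem IsTestFunction.eq_zero {Ω : Set X} {φ : X → ℂ} (hφ : IsTestFunction Ω φ) {x : X}
    (hx : x ∉ Ω) : φ x = 0 := by
  by_contra h
  exact hx (hφ.support (subset_tsupport φ h))

variable [MeasureSpace X] [BorelSpace X] [FiniteDimensional ℝ X]
  [(volume : Measure X).IsAddHaarMeasure]

theorem IsTestFunction.memLp_mul {Ω : Set X} {φ : X → ℂ} (hφ : IsTestFunction Ω φ) {w : X → ℝ}
    (hw : Continuous w) : MemLp (fun x => (w x : ℂ) * φ x) 2 (volume.restrict Ω) := by
  refine Continuous.memLp_of_hasCompactSupport ?_ (hφ.compact.mul_left (f := fun x => (w x : ℂ)))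
  have := hφ.smooth.continuous
  fun_prop

theorem IsTestFunction.setIntegral_dirDeriv_mul {Ω : Set X} {φ χ : X → ℂ}
    (hφ : IsTestFunction Ω φ) (hχ : IsTestFunction Ω χ) (e : X) :
    ∫ x in Ω, φ x * dirDeriv e χ x = -∫ x in Ω, dirDeriv e φ x * χ x := by
  have c1 := hφ.smooth.continuous
  have c2 := hχ.smooth.continuous
  have c3 := (hφ.derivative e).smooth.continuous
  have c4 := (hχ.derivative e).smooth.continuous
  rw [setIntegral_eq_integral_of_forall_compl_eq_zero, setIntegral_eq_integral_of_forall_compl_eq_zero]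
  · refine integral_mul_fderiv_eq_neg_fderiv_mul_of_integrable ?_ ?_ ?_ ?_ ?_
    · exact (c3.mul c2).integrable_of_hasCompactSupport hχ.compact.mul_left
    · exact (c1.mul c4).integrable_of_hasCompactSupport hφ.compact.mul_right
    · exact (c1.mul c2).integrable_of_hasCompactSupport hφ.compact.mul_right
    · exact fun x _ => hφ.smooth.differentiable (by simp) x
    · exact fun x _ => hχ.smooth.differentiable (by simp) x
  · intro x hx
    rw [hχ.eq_zero hx, mul_zero]
  · intro x hx
    rw [hφ.eq_zero hx, zero_mul]

/-- The triple `(φ, ∂ₑ φ, w φ)` of a test function. -/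
noncomputable def testTriple {Ω : Set X} {φ : X → ℂ} (hφ : IsTestFunction Ω φ) (e : X) {w : X → ℝ}
    (hw : Continuous w) : L2 Ω × L2 Ω × L2 Ω :=
  (hφ.memLp.toLp, (hφ.derivative e).memLp.toLp, (hφ.memLp_mul hw).toLp)

theorem testTriple_mem {Ω : Set X} {φ : X → ℂ} (hφ : IsTestFunction Ω φ) (e : X) {w : X → ℝ}
    (hw : Continuous w) : testTriple hφ e hw ∈ testTriples Ω e w :=
  ⟨φ, hφ, hφ.memLp.coeFn_toLp, (hφ.derivative e).memLp.coeFn_toLp,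
    (hφ.memLp_mul hw).coeFn_toLp⟩

/-- The closure of the triples `(φ, ∂ₑ φ, w φ)`: the energy space together with the weak
derivative and the weighted function. -/
noncomputable def energyTriples (Ω : Set X) (e : X) (w : X → ℝ) :
    Submodule ℂ (L2 Ω × L2 Ω × L2 Ω) :=
  (testTriples Ω e w).topologicalClosure

/-- A closed condition on triples only has to be checked for test functions. -/
theorem energyTriples_induction {Ω : Set X} {e : X} {w : X → ℝ}
    {P : L2 Ω × L2 Ω × L2 Ω → Prop} (hP : IsClosed {t | P t})
    (h : ∀ t ∈ testTriples Ω e w, P t) {t : L2 Ω × L2 Ω × L2 Ω} (ht : t ∈ energyTriples Ω e w) :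
    P t :=
  closure_minimal (t := {t | P t}) h hP ht

theorem integral_fst_mul_dirDeriv {Ω : Set X} {e : X} {w : X → ℝ} {t : L2 Ω × L2 Ω × L2 Ω}
    (ht : t ∈ energyTriples Ω e w) {φ : X → ℂ} (hφ : IsTestFunction Ω φ) :
    ∫ x in Ω, t.1 x * dirDeriv e φ x = -∫ x in Ω, t.2.1 x * φ x := by
  refine energyTriples_induction (P := fun t => ∫ x in Ω, t.1 x * dirDeriv e φ x =
    -∫ x in Ω, t.2.1 x * φ x) ?_ ?_ ht
  · have h1 := continuous_integral_mul (hφ.derivative e).memLp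
    have h2 := continuous_integral_mul hφ.memLp
    exact isClosed_eq (h1.comp continuous_fst) (h2.comp continuous_snd.fst).neg
  · rintro t ⟨χ, hχ, h1, h2, -⟩
    rw [integral_congr_ae (g := fun x => χ x * dirDeriv e φ x),
      integral_congr_ae (f := fun x => t.2.1 x * φ x) (g := fun x => dirDeriv e χ x * φ x)]
    · exact hχ.setIntegral_dirDeriv_mul hφ e
    · filter_upwards [h2] with x hx
      rw [hx]
    · filter_upwards [h1] with x hx
      rw [hx]

theorem snd_snd_ae_eq {Ω : Set X} (hΩ : IsOpen Ω) {e : X} {w : X → ℝ} (hw : Continuous w)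
    {t : L2 Ω × L2 Ω × L2 Ω} (ht : t ∈ energyTriples Ω e w) :
    t.2.2 =ᵐ[volume.restrict Ω] fun x => (w x : ℂ) * t.1 x := by
  have key : ∀ φ : X → ℂ, IsTestFunction Ω φ →
      ∫ x in Ω, t.2.2 x * φ x = ∫ x in Ω, t.1 x * ((w x : ℂ) * φ x) := by
    intro φ hφ
    refine energyTriples_induction (P := fun t => ∫ x in Ω, t.2.2 x * φ x =
      ∫ x in Ω, t.1 x * ((w x : ℂ) * φ x)) ?_ ?_ ht
    · have h1 := continuous_integral_mul (hφ.memLp_mul hw)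
      have h2 := continuous_integral_mul hφ.memLp
      exact isClosed_eq (h2.comp continuous_snd.snd) (h1.comp continuous_fst)
    · rintro t ⟨χ, hχ, h1, -, h3⟩
      refine integral_congr_ae ?_
      filter_upwards [h1, h3] with x hx hx3
      rw [hx, hx3]
      ring
  have hloc : ∀ f : L2 Ω, LocallyIntegrableOn (f : X → ℂ) Ω volume := fun f =>
    locallyIntegrableOn_of_locallyIntegrable_restrict
      ((Lp.memLp f).locallyIntegrable (by norm_num))
  have hlw : LocallyIntegrableOn (fun x => (w x : ℂ) * t.1 x) Ω volume := by
    refine (hloc t.1).continuousOn_mul (g := fun x => (w x : ℂ)) ?_ hΩ.isLocallyClosed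
    fun_prop
  have h := hΩ.ae_eq_zero_of_integral_contDiff_smul_eq_zero ((hloc t.2.2).sub hlw) ?_
  · have := (ae_restrict_iff' hΩ.measurableSet).2 h
    filter_upwards [this] with x hx
    exact sub_eq_zero.1 hx
  · intro g hg hgc hgs
    have hsup : Function.support (fun x => (g x : ℂ)) = Function.support g := by
      ext x
      simp
    have hφ : IsTestFunction Ω (fun x => (g x : ℂ)) := by
      refine ⟨Complex.ofRealCLM.contDiff.comp hg, hgc.comp_left (g := Complex.ofReal) rfl, ?_⟩
      rw [tsupport, hsup]
      exact hgs
    rw [← setIntegral_eq_integral_of_forall_compl_eq_zero (s := Ω)]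
    · have e1 : ∀ x, g x • ((t.2.2 : X → ℂ) - fun x => (w x : ℂ) * t.1 x) x =
          t.2.2 x * (g x : ℂ) - t.1 x * ((w x : ℂ) * (g x : ℂ)) := fun x => by
        simp only [Pi.sub_apply, Complex.real_smul]
        ring
      simp_rw [e1]
      rw [integral_sub, key _ hφ, sub_self]
      · exact (Lp.memLp t.2.2).integrable_mul hφ.memLp
      · exact (Lp.memLp t.1).integrable_mul (hφ.memLp_mul hw)
    · intro x hx
      have : g x = 0 := by
        by_contra hne
        exact hx (hgs (subset_tsupport g hne))
      simp [this]

/-- The sesquilinear form `⟨s, t⟩ + c ⟨∂ₑ s, ∂ₑ t⟩ + β ⟨(w - κ) s, (w - κ) t⟩`. -/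
noncomputable def energyInner {Ω : Set X} (c β κ : ℝ) (s t : L2 Ω × L2 Ω × L2 Ω) : ℂ :=
  inner ℂ s.1 t.1 + c * inner ℂ s.2.1 t.2.1 +
    β * inner ℂ (s.2.2 - (κ : ℂ) • s.1) (t.2.2 - (κ : ℂ) • t.1)

/-- Completing the square: for `q = β w² - 2 β κ w` the energy form paired with a test function is
the operator `- c ∂ₑ² + q + (1 + β κ²)` acting on that test function. -/
theorem energyInner_testTriple {Ω : Set X} (hΩ : IsOpen Ω) {e : X} {w : X → ℝ} (hw : Continuous w)
    {c β κ : ℝ} {q : C(X, ℝ)} (hq : ∀ x, q x = β * w x ^ 2 - 2 * β * κ * w x)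
    {t : L2 Ω × L2 Ω × L2 Ω} (ht : t ∈ energyTriples Ω e w) {φ : X → ℂ}
    (hφ : IsTestFunction Ω φ) :
    energyInner c β κ (testTriple hφ.conj e hw) t =
      (∫ x in Ω, t.1 x * diffExpr e c q φ x) + ((1 + β * κ ^ 2 : ℝ) : ℂ) * ∫ x in Ω, t.1 x * φ x := by
  have hd := snd_snd_ae_eq hΩ hw ht
  have e1 : inner ℂ (testTriple hφ.conj e hw).1 t.1 = ∫ x in Ω, t.1 x * φ x := by
    rw [L2.inner_def]
    refine integral_congr_ae ?_
    filter_upwards [hφ.conj.memLp.coeFn_toLp] with x hx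
    simp [testTriple, hx]
  have e2 : inner ℂ (testTriple hφ.conj e hw).2.1 t.2.1 =
      -∫ x in Ω, t.1 x * dirDeriv e (dirDeriv e φ) x := by
    rw [integral_fst_mul_dirDeriv ht (hφ.derivative e), neg_neg, L2.inner_def]
    refine integral_congr_ae ?_
    filter_upwards [(hφ.conj.derivative e).memLp.coeFn_toLp] with x hx
    rw [testTriple, hx, dirDeriv_conj hφ.smooth]
    simp
  have e3 : inner ℂ ((testTriple hφ.conj e hw).2.2 - (κ : ℂ) • (testTriple hφ.conj e hw).1)
      (t.2.2 - (κ : ℂ) • t.1) = ∫ x in Ω, t.1 x * (((w x - κ) ^ 2 : ℝ) * φ x) := by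
    rw [L2.inner_def]
    refine integral_congr_ae ?_
    filter_upwards [hφ.conj.memLp.coeFn_toLp, (hφ.conj.memLp_mul hw).coeFn_toLp, hd,
      Lp.coeFn_sub (testTriple hφ.conj e hw).2.2 ((κ : ℂ) • (testTriple hφ.conj e hw).1),
      Lp.coeFn_sub t.2.2 ((κ : ℂ) • t.1), Lp.coeFn_smul (κ : ℂ) t.1,
      Lp.coeFn_smul (κ : ℂ) (testTriple hφ.conj e hw).1] with x h1 h2 h3 h4 h5 h6 h7
    rw [h4, h5, Pi.sub_apply, Pi.sub_apply, h6, h7, Pi.smul_apply, Pi.smul_apply, h3]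
    simp only [testTriple, h1, h2]
    simp
    ring
  have i0 := (Lp.memLp t.1).integrable_mul hφ.memLp
  have i1 := (Lp.memLp t.1).integrable_mul ((hφ.derivative e).derivative e).memLp
  have i2 : Integrable (fun x => t.1 x * (((w x - κ) ^ 2 : ℝ) * φ x)) (volume.restrict Ω) :=
    (Lp.memLp t.1).integrable_mul (hφ.memLp_mul (w := fun x => (w x - κ) ^ 2) (by fun_prop))
  have e4 : ∀ x, t.1 x * diffExpr e c q φ x = -(c : ℂ) * (t.1 x * dirDeriv e (dirDeriv e φ) x) +
      ((β : ℂ) * (t.1 x * (((w x - κ) ^ 2 : ℝ) * φ x)) - (β * κ ^ 2 : ℝ) * (t.1 x * φ x)) := by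
    intro x
    rw [diffExpr, hq]
    push_cast
    ring
  simp_rw [e4]
  rw [integral_add, integral_sub, integral_const_mul, integral_const_mul, integral_const_mul,
    energyInner, e1, e2, e3]
  · push_cast
    ring
  · exact i2.const_mul _
  · exact i0.const_mul _
  · exact i1.const_mul _
  · exact (i2.const_mul _).sub (i0.const_mul _)

theorem continuous_energyInner_left {Ω : Set X} (c β κ : ℝ) (t : L2 Ω × L2 Ω × L2 Ω) :
    Continuous fun s : L2 Ω × L2 Ω × L2 Ω => energyInner c β κ s t := by
  unfold energyInner
  fun_prop

theorem inner_toLp_conj {Ω : Set X} {φ : X → ℂ} (hφ : IsTestFunction Ω φ) (e : X) {w : X → ℝ}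
    (hw : Continuous w) (f : L2 Ω) :
    inner ℂ (testTriple hφ.conj e hw).1 f = ∫ x in Ω, f x * φ x := by
  rw [L2.inner_def]
  refine integral_congr_ae ?_
  filter_upwards [hφ.conj.memLp.coeFn_toLp] with x hx
  simp [testTriple, hx]

theorem testTriples_eq {Ω : Set X} {e : X} {w : X → ℝ} (hw : Continuous w)
    {t : L2 Ω × L2 Ω × L2 Ω} (ht : t ∈ testTriples Ω e w) :
    ∃ (φ : X → ℂ) (hφ : IsTestFunction Ω φ), t = testTriple hφ.conj e hw := by
  obtain ⟨φ, hφ, h1, h2, h3⟩ := ht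
  refine ⟨star φ, hφ.conj, Prod.ext ?_ (Prod.ext ?_ ?_)⟩
  · refine Lp.ext (h1.trans ?_)
    filter_upwards [hφ.conj.conj.memLp.coeFn_toLp] with x hx
    rw [testTriple, hx, star_star]
  · refine Lp.ext (h2.trans ?_)
    filter_upwards [(hφ.conj.conj.derivative e).memLp.coeFn_toLp] with x hx
    rw [testTriple, hx, star_star]
  · refine Lp.ext (h3.trans ?_)
    filter_upwards [(hφ.conj.conj.memLp_mul hw).coeFn_toLp] with x hx
    rw [testTriple, hx, star_star]

/-- The weak form of the operator: `(ψ, f)` is in the graph if and only if `ψ` comes from an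
energy triple that represents `f + (1 + β κ²) ψ` with respect to the energy form. -/
theorem mem_operatorGraph_iff {Ω : Set X} (hΩ : IsOpen Ω) {e : X} {w : X → ℝ} (hw : Continuous w)
    {c β κ : ℝ} {q : C(X, ℝ)} (hq : ∀ x, q x = β * w x ^ 2 - 2 * β * κ * w x) (ψ f : L2 Ω) :
    (ψ, f) ∈ operatorGraph Ω e c q w ↔ ∃ t ∈ energyTriples Ω e w, t.1 = ψ ∧
      ∀ s ∈ energyTriples Ω e w, energyInner c β κ s t =
        inner ℂ s.1 (f + ((1 + β * κ ^ 2 : ℝ) : ℂ) • ψ) := by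
  have hinner : ∀ {φ : X → ℂ} (hφ : IsTestFunction Ω φ),
      inner ℂ (testTriple hφ.conj e hw).1 (f + ((1 + β * κ ^ 2 : ℝ) : ℂ) • ψ) =
        (∫ x in Ω, f x * φ x) + ((1 + β * κ ^ 2 : ℝ) : ℂ) * ∫ x in Ω, ψ x * φ x := by
    intro φ hφ
    rw [inner_add_right, inner_smul_right, inner_toLp_conj hφ, inner_toLp_conj hφ]
  constructor
  · rintro ⟨⟨t, ht, htψ⟩, h⟩
    refine ⟨t, ht, htψ, fun s hs => ?_⟩
    replace htψ : t.1 = ψ := htψ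
    refine energyTriples_induction (P := fun s => energyInner c β κ s t =
        inner ℂ s.1 (f + ((1 + β * κ ^ 2 : ℝ) : ℂ) • ψ)) ?_ ?_ hs
    · exact isClosed_eq (continuous_energyInner_left c β κ t) (by fun_prop)
    · intro s hs
      obtain ⟨φ, hφ, rfl⟩ := testTriples_eq hw hs
      rw [hinner hφ, energyInner_testTriple hΩ hw hq ht hφ, htψ]
      exact congrArg (· + _) (h φ hφ)
  · rintro ⟨t, ht, rfl, h⟩
    refine ⟨⟨t, ht, rfl⟩, fun φ hφ => ?_⟩
    have h1 := h _ (subset_closure (testTriple_mem hφ.conj e hw))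
    rw [hinner hφ, energyInner_testTriple hΩ hw hq ht hφ] at h1
    exact add_right_cancel h1

theorem energyInner_self {Ω : Set X} (c β κ : ℝ) (t : L2 Ω × L2 Ω × L2 Ω) :
    energyInner c β κ t t =
      ((‖t.1‖ ^ 2 + c * ‖t.2.1‖ ^ 2 + β * ‖t.2.2 - (κ : ℂ) • t.1‖ ^ 2 : ℝ) : ℂ) := by
  simp only [energyInner, inner_self_eq_norm_sq_to_K]
  push_cast
  rfl

/-! ### The energy space as a Hilbert space -/

/-- Recovers the triple `(a, b, d)` from `(a, √c b, √β (d - κ a))`. -/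
noncomputable def unscale (Ω : Set X) (c β κ : ℝ) :
    PiLp 2 (fun _ : Fin 3 => L2 Ω) →L[ℂ] L2 Ω × L2 Ω × L2 Ω :=
  (PiLp.proj 2 (𝕜 := ℂ) (fun _ : Fin 3 => L2 Ω) 0).prod
    ((((√c)⁻¹ : ℝ) : ℂ) • (PiLp.proj 2 (𝕜 := ℂ) (fun _ : Fin 3 => L2 Ω) 1) |>.prod
      ((((√β)⁻¹ : ℝ) : ℂ) • (PiLp.proj 2 (𝕜 := ℂ) (fun _ : Fin 3 => L2 Ω) 2) +
        (κ : ℂ) • (PiLp.proj 2 (𝕜 := ℂ) (fun _ : Fin 3 => L2 Ω) 0)))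

/-- The energy space as a closed subspace of `L²(Ω)³`, scaled in such a way that the inner
product of `L²(Ω)³` is the energy form. -/
noncomputable def energyHilbert (Ω : Set X) (e : X) (w : X → ℝ) (c β κ : ℝ) :
    Submodule ℂ (PiLp 2 (fun _ : Fin 3 => L2 Ω)) :=
  (energyTriples Ω e w).comap (unscale Ω c β κ : PiLp 2 (fun _ : Fin 3 => L2 Ω) →ₗ[ℂ] _)

instance (Ω : Set X) (e : X) (w : X → ℝ) (c β κ : ℝ) :
    CompleteSpace (energyHilbert Ω e w c β κ) := by
  have h : IsClosed (energyHilbert Ω e w c β κ : Set (PiLp 2 (fun _ : Fin 3 => L2 Ω))) :=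
    (Submodule.isClosed_topologicalClosure _).preimage (unscale Ω c β κ).continuous
  exact h.completeSpace_coe

/-- The embedding of the energy space into `L²(Ω)`. -/
noncomputable def energyEmbedding (Ω : Set X) (e : X) (w : X → ℝ) (c β κ : ℝ) :
    energyHilbert Ω e w c β κ →L[ℂ] L2 Ω :=
  (PiLp.proj 2 (𝕜 := ℂ) (fun _ : Fin 3 => L2 Ω) 0).comp (energyHilbert Ω e w c β κ).subtypeL

/-- The inverse of `- c ∂ₑ² + q + (1 + β κ²)` with `q = β w² - 2 β κ w`. -/
noncomputable def resolvent (Ω : Set X) (e : X) (w : X → ℝ) (c β κ : ℝ) : L2 Ω →L[ℂ] L2 Ω :=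
  (energyEmbedding Ω e w c β κ).comp (ContinuousLinearMap.adjoint (energyEmbedding Ω e w c β κ))

theorem inner_energyHilbert {Ω : Set X} {c β : ℝ} (κ : ℝ) (hc : 0 < c) (hβ : 0 < β)
    (u v : PiLp 2 (fun _ : Fin 3 => L2 Ω)) :
    inner ℂ u v = energyInner c β κ (unscale Ω c β κ u) (unscale Ω c β κ v) := by
  have h1 : (c : ℂ) * ((√c)⁻¹ : ℝ) * ((√c)⁻¹ : ℝ) = 1 := by
    rw [← Complex.ofReal_mul, ← Complex.ofReal_mul, mul_assoc, ← mul_inv, Real.mul_self_sqrt hc.le,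
      mul_inv_cancel₀ hc.ne', Complex.ofReal_one]
  have h2 : (β : ℂ) * ((√β)⁻¹ : ℝ) * ((√β)⁻¹ : ℝ) = 1 := by
    rw [← Complex.ofReal_mul, ← Complex.ofReal_mul, mul_assoc, ← mul_inv, Real.mul_self_sqrt hβ.le,
      mul_inv_cancel₀ hβ.ne', Complex.ofReal_one]
  have h3 : ∀ v : PiLp 2 (fun _ : Fin 3 => L2 Ω),
      (unscale Ω c β κ v).2.2 - (κ : ℂ) • (unscale Ω c β κ v).1 = (((√β)⁻¹ : ℝ) : ℂ) • v 2 :=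
    fun v => add_sub_cancel_right _ _
  have h4 : ∀ v : PiLp 2 (fun _ : Fin 3 => L2 Ω),
      (unscale Ω c β κ v).2.1 = (((√c)⁻¹ : ℝ) : ℂ) • v 1 := fun v => rfl
  have h5 : ∀ v : PiLp 2 (fun _ : Fin 3 => L2 Ω), (unscale Ω c β κ v).1 = v 0 := fun v => rfl
  rw [energyInner, h3, h3, h4, h4, h5, h5, PiLp.inner_apply, Fin.sum_univ_three]
  simp only [inner_smul_left, inner_smul_right, Complex.conj_ofReal]
  linear_combination (-inner ℂ (u 1) (v 1)) * h1 - inner ℂ (u 2) (v 2) * h2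

theorem exists_unscale_eq {Ω : Set X} {c β : ℝ} (κ : ℝ) (hc : 0 < c) (hβ : 0 < β)
    (t : L2 Ω × L2 Ω × L2 Ω) : ∃ v, unscale Ω c β κ v = t := by
  refine ⟨WithLp.toLp 2 ![t.1, ((√c : ℝ) : ℂ) • t.2.1, ((√β : ℝ) : ℂ) • (t.2.2 - (κ : ℂ) • t.1)], ?_⟩
  have h1 : (((√c)⁻¹ : ℝ) : ℂ) * (√c : ℝ) = 1 := by
    rw [← Complex.ofReal_mul, inv_mul_cancel₀ (Real.sqrt_pos.2 hc).ne', Complex.ofReal_one]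
  have h2 : (((√β)⁻¹ : ℝ) : ℂ) * (√β : ℝ) = 1 := by
    rw [← Complex.ofReal_mul, inv_mul_cancel₀ (Real.sqrt_pos.2 hβ).ne', Complex.ofReal_one]
  refine Prod.ext rfl (Prod.ext ?_ ?_)
  · change (((√c)⁻¹ : ℝ) : ℂ) • ((√c : ℝ) : ℂ) • t.2.1 = _
    rw [smul_smul, h1, one_smul]
  · change (((√β)⁻¹ : ℝ) : ℂ) • ((√β : ℝ) : ℂ) • (t.2.2 - (κ : ℂ) • t.1) + (κ : ℂ) • t.1 = _
    rw [smul_smul, h2, one_smul, sub_add_cancel]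

/-- The resolvent solves the weak equation, and is characterised by this. -/
theorem resolvent_eq_iff {Ω : Set X} (e : X) (w : X → ℝ) {c β : ℝ} (κ : ℝ) (hc : 0 < c)
    (hβ : 0 < β) (g ψ : L2 Ω) :
    resolvent Ω e w c β κ g = ψ ↔ ∃ t ∈ energyTriples Ω e w, t.1 = ψ ∧
      ∀ s ∈ energyTriples Ω e w, energyInner c β κ s t = inner ℂ s.1 g := by
  constructor
  · rintro rfl
    set v := ContinuousLinearMap.adjoint (energyEmbedding Ω e w c β κ) g with hv
    refine ⟨unscale Ω c β κ v, v.2, rfl, fun s hs => ?_⟩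
    obtain ⟨u, rfl⟩ := exists_unscale_eq κ hc hβ s
    rw [← inner_energyHilbert κ hc hβ]
    have : inner ℂ (⟨u, hs⟩ : energyHilbert Ω e w c β κ) v = inner ℂ (u 0) g := by
      rw [hv, ContinuousLinearMap.adjoint_inner_right]
      rfl
    exact this
  · rintro ⟨t, ht, rfl, h⟩
    obtain ⟨u, rfl⟩ := exists_unscale_eq κ hc hβ t
    have : ContinuousLinearMap.adjoint (energyEmbedding Ω e w c β κ) g = ⟨u, ht⟩ := by
      refine ext_inner_left ℂ fun v => ?_
      rw [ContinuousLinearMap.adjoint_inner_right]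
      have h1 : energyInner c β κ (unscale Ω c β κ v) (unscale Ω c β κ u) = _ := h _ v.2
      rw [← inner_energyHilbert κ hc hβ] at h1
      exact h1.symm
    rw [resolvent, ContinuousLinearMap.comp_apply, this]
    rfl

theorem mem_graph_iff_resolvent {Ω : Set X} (hΩ : IsOpen Ω) {e : X} {w : X → ℝ} (hw : Continuous w)
    {c β κ : ℝ} (hc : 0 < c) (hβ : 0 < β) {q : C(X, ℝ)}
    (hq : ∀ x, q x = β * w x ^ 2 - 2 * β * κ * w x) (ψ f : L2 Ω) :
    (ψ, f) ∈ (diffOperator Ω e c q w).graph ↔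
      resolvent Ω e w c β κ (f + ((1 + β * κ ^ 2 : ℝ) : ℂ) • ψ) = ψ := by
  rw [graph_diffOperator hΩ, mem_operatorGraph_iff hΩ hw hq, resolvent_eq_iff e w κ hc hβ]

theorem resolvent_isSymmetric (Ω : Set X) (e : X) (w : X → ℝ) (c β κ : ℝ) :
    (resolvent Ω e w c β κ : L2 Ω →ₗ[ℂ] L2 Ω).IsSymmetric := by
  intro x y
  change inner ℂ (energyEmbedding Ω e w c β κ _) _ = inner ℂ _ (energyEmbedding Ω e w c β κ _)
  rw [← ContinuousLinearMap.adjoint_inner_right]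
  exact ContinuousLinearMap.adjoint_inner_left _ _ _

/-- An operator that has a Hilbert basis of eigenvectors is diagonal in it: the resolvent is
bounded and symmetric, so that the equation `R (f + C ψ) = ψ` may be tested on the basis. -/
theorem isDiagonal_diffOperator {Ω : Set X} (hΩ : IsOpen Ω) {e : X} {w : X → ℝ} (hw : Continuous w)
    {c β κ : ℝ} (hc : 0 < c) (hβ : 0 < β) {q : C(X, ℝ)}
    (hq : ∀ x, q x = β * w x ^ 2 - 2 * β * κ * w x) {ι : Type} {b : HilbertBasis ι ℂ (L2 Ω)}
    {d : ι → ℝ} (hb : ∀ k, (b k, (d k : ℂ) • b k) ∈ (diffOperator Ω e c q w).graph) :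
    IsDiagonal b d (diffOperator Ω e c q w) := by
  intro x f
  set C : ℝ := 1 + β * κ ^ 2 with hC
  set R := resolvent Ω e w c β κ with hR
  rw [mem_graph_iff_resolvent hΩ hw hc hβ hq]
  have h1 : ∀ k, ((d k : ℂ) + C) • R (b k) = b k := by
    intro k
    have := (mem_graph_iff_resolvent hΩ hw hc hβ hq _ _).1 (hb k)
    rwa [← add_smul, map_smul] at this
  have h2 : ∀ k, (d k : ℂ) + C ≠ 0 := by
    intro k h0
    have := h1 k
    rw [h0, zero_smul] at this
    exact b.ne_zero k this.symm
  have h3 : ∀ k g, ((d k : ℂ) + C) * b.repr (R g) k = b.repr g k := by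
    intro k g
    have hsym : inner ℂ (R (b k)) g = inner ℂ (b k) (R g) := resolvent_isSymmetric Ω e w c β κ _ _
    rw [b.repr_apply_apply, b.repr_apply_apply, ← hsym]
    conv_rhs => rw [← h1 k]
    rw [inner_smul_left]
    simp
  constructor
  · intro h k
    have := h3 k (f + (C : ℂ) • x)
    rw [h, map_add, map_smul, lp.coeFn_add, Pi.add_apply, lp.coeFn_smul, Pi.smul_apply,
      smul_eq_mul] at this
    linear_combination -this
  · intro h
    refine b.ext_repr fun k => mul_left_cancel₀ (h2 k) ?_
    rw [h3, map_add, map_smul, lp.coeFn_add, Pi.add_apply, lp.coeFn_smul, Pi.smul_apply,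
      smul_eq_mul, h k]
    ring

end Energy

/-! ### Compactness of the embedding of the energy space on the line -/

theorem sq_intervalIntegral_le {f : ℝ → ℝ} (hf : Continuous f) {a b : ℝ} (hab : a < b) :
    (∫ x in a..b, f x) ^ 2 ≤ (b - a) * ∫ x in a..b, f x ^ 2 := by
  have hpos : 0 < b - a := sub_pos.2 hab
  set m := (∫ x in a..b, f x) / (b - a) with hm
  have hm2 : ∫ x in a..b, f x = m * (b - a) := by rw [hm, div_mul_cancel₀ _ hpos.ne']
  have h0 : 0 ≤ ∫ x in a..b, (f x - m) ^ 2 :=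
    intervalIntegral.integral_nonneg hab.le fun x _ => sq_nonneg _
  have h1 : ∫ x in a..b, (f x - m) ^ 2 =
      (∫ x in a..b, f x ^ 2) - 2 * m * (∫ x in a..b, f x) + (b - a) * m ^ 2 := by
    have e : ∀ x, (f x - m) ^ 2 = f x ^ 2 - 2 * m * f x + m ^ 2 := fun x => by ring
    simp_rw [e]
    rw [intervalIntegral.integral_add, intervalIntegral.integral_sub,
      intervalIntegral.integral_const_mul, intervalIntegral.integral_const, smul_eq_mul]
    all_goals exact Continuous.intervalIntegrable (by fun_prop) _ _
  rw [h1, hm2] at h0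
  rw [hm2]
  nlinarith

/-- On an interval, a function differs from its mean by at most the `L²` norm of its derivative
times the square root of the length. -/
theorem norm_sub_average_sq_le {φ : ℝ → ℂ} (hφ : ContDiff ℝ 1 φ) {a b x : ℝ} (hab : a < b)
    (hx : x ∈ Ioc a b) :
    ‖φ x - ((b - a)⁻¹ : ℝ) * ∫ t in a..b, φ t‖ ^ 2 ≤ (b - a) * ∫ t in a..b, ‖deriv φ t‖ ^ 2 := by
  have hpos : 0 < b - a := sub_pos.2 hab
  have hd : Continuous (deriv φ) := hφ.continuous_deriv le_rfl
  set D := ∫ t in a..b, ‖deriv φ t‖ with hD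
  have h1 : ∀ t ∈ Ioc a b, ‖φ x - φ t‖ ≤ D := by
    intro t ht
    rw [← intervalIntegral.integral_deriv_eq_sub (a := t) (b := x)
      (fun y _ => hφ.differentiable (by simp) y) (hd.intervalIntegrable _ _)]
    refine intervalIntegral.norm_integral_le_integral_norm_uIoc.trans ?_
    rw [hD, intervalIntegral.integral_of_le hab.le]
    refine setIntegral_mono_set ?_ (ae_of_all _ fun _ => norm_nonneg _) ?_
    · exact (hd.norm.intervalIntegrable a b).1
    · refine (Ioc_subset_Ioc ?_ ?_).eventuallyLE
      · exact le_min ht.1.le hx.1.le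
      · exact max_le ht.2 hx.2
  have h2 : φ x - ((b - a)⁻¹ : ℝ) * ∫ t in a..b, φ t =
      ((b - a)⁻¹ : ℝ) * ∫ t in a..b, (φ x - φ t) := by
    rw [intervalIntegral.integral_sub (by simp) (hφ.continuous.intervalIntegrable _ _),
      intervalIntegral.integral_const, mul_sub, Complex.real_smul, ← mul_assoc,
      ← Complex.ofReal_mul, inv_mul_cancel₀ hpos.ne', Complex.ofReal_one, one_mul]
  have h3 : ‖∫ t in a..b, (φ x - φ t)‖ ≤ D * |b - a| := by
    refine intervalIntegral.norm_integral_le_of_norm_le_const fun t ht => h1 t ?_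
    rwa [uIoc_of_le hab.le] at ht
  have h4 : ‖φ x - ((b - a)⁻¹ : ℝ) * ∫ t in a..b, φ t‖ ≤ D := by
    rw [h2, norm_mul, Complex.norm_real, Real.norm_of_nonneg (inv_nonneg.2 hpos.le),
      inv_mul_le_iff₀ hpos]
    rwa [abs_of_pos hpos, mul_comm] at h3
  calc _ ≤ D ^ 2 := by gcongr
    _ ≤ _ := sq_intervalIntegral_le hd.norm hab

theorem volume_restrict_Ioc_ne_top (Ω : Set ℝ) (a b : ℝ) : volume.restrict Ω (Ioc a b) ≠ ⊤ :=
  ((Measure.restrict_apply_le Ω _).trans_lt measure_Ioc_lt_top).ne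

/-- The indicator function of `(a, b]` as an element of `L²(Ω)`. -/
noncomputable def cell (Ω : Set ℝ) (a b : ℝ) : L2 Ω :=
  indicatorConstLp 2 measurableSet_Ioc (volume_restrict_Ioc_ne_top Ω a b) (1 : ℂ)

/-- The projection onto the step functions on the given cells `(a i, a (i + 1)]` of length `h`,
`i < n`. -/
noncomputable def averaging (Ω : Set ℝ) (a : ℕ → ℝ) (h : ℝ) (n : ℕ) : L2 Ω →L[ℂ] L2 Ω :=
  ∑ i ∈ Finset.range n, ((h⁻¹ : ℝ) : ℂ) •
    (innerSL ℂ (cell Ω (a i) (a (i + 1)))).smulRight (cell Ω (a i) (a (i + 1)))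

theorem isCompactOperator_smulRight {E F : Type} [NormedAddCommGroup E] [InnerProductSpace ℂ E]
    [NormedAddCommGroup F] [InnerProductSpace ℂ F] (u : E →L[ℂ] ℂ) (v : F) :
    IsCompactOperator (u.smulRight v) := by
  have h1 : IsCompactOperator (id : ℂ → ℂ) := (isCompactOperator_id_iff_finiteDimensional (𝕜 := ℂ)).2 inferInstance
  exact (h1.comp_clm u).clm_comp (ContinuousLinearMap.toSpanSingleton ℂ v)

theorem isCompactOperator_averaging (Ω : Set ℝ) (a : ℕ → ℝ) (h : ℝ) (n : ℕ) :
    IsCompactOperator (averaging Ω a h n) := by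
  refine Submodule.sum_mem (compactOperator (RingHom.id ℂ) (L2 Ω) (L2 Ω)) (fun i _ => ?_)
  exact Submodule.smul_mem (compactOperator (RingHom.id ℂ) (L2 Ω) (L2 Ω)) _
    (isCompactOperator_smulRight _ _)

/-- Test functions vanish outside `Ω`, so that the averages may be taken over whole cells. -/
theorem averaging_ae_eq {Ω : Set ℝ} {φ : ℝ → ℂ} (hφ : IsTestFunction Ω φ)
    (a : ℕ → ℝ) (ha : Monotone a) (h : ℝ) (n : ℕ) {f : L2 Ω} (hf : f =ᵐ[volume.restrict Ω] φ) :
    averaging Ω a h n f =ᵐ[volume.restrict Ω] fun x => ∑ i ∈ Finset.range n,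
      (Ioc (a i) (a (i + 1))).indicator (fun _ => ((h⁻¹ : ℝ) : ℂ) * ∫ t in (a i)..(a (i + 1)), φ t) x := by
  have h1 : averaging Ω a h n f = ∑ i ∈ Finset.range n,
      (((h⁻¹ : ℝ) : ℂ) * ∫ t in (a i)..(a (i + 1)), φ t) •
      cell Ω (a i) (a (i + 1)) := by
    rw [averaging, _root_.sum_apply]
    refine Finset.sum_congr rfl fun i _ => ?_
    rw [_root_.smul_apply, ContinuousLinearMap.smulRight_apply, innerSL_apply_apply, cell,
      L2.inner_indicatorConstLp_one, smul_smul, intervalIntegral.integral_of_le (ha (Nat.le_succ i))]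
    congr 2
    rw [integral_congr_ae (ae_restrict_of_ae hf), Measure.restrict_restrict measurableSet_Ioc]
    refine (setIntegral_eq_of_subset_of_forall_sdiff_eq_zero measurableSet_Ioc inter_subset_left
      ?_).symm
    rintro x ⟨hx1, hx2⟩
    exact hφ.eq_zero fun h => hx2 ⟨hx1, h⟩
  rw [h1]
  have h2 : ∀ i, ((((h⁻¹ : ℝ) : ℂ) * ∫ t in (a i)..(a (i + 1)), φ t) •
      cell Ω (a i) (a (i + 1)) : L2 Ω)
      =ᵐ[volume.restrict Ω] (Ioc (a i) (a (i + 1))).indicator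
        (fun _ => ((h⁻¹ : ℝ) : ℂ) * ∫ t in (a i)..(a (i + 1)), φ t) := by
    intro i
    refine (Lp.coeFn_smul _ _).trans ?_
    filter_upwards [indicatorConstLp_coeFn (p := 2) (hs := measurableSet_Ioc)
      (hμs := volume_restrict_Ioc_ne_top Ω (a i) (a (i + 1))) (c := (1 : ℂ))] with x hx
    rw [Pi.smul_apply, cell, hx]
    by_cases hxi : x ∈ Ioc (a i) (a (i + 1)) <;> simp [hxi]
  have h3 : ∀ᵐ x ∂(volume.restrict Ω), ∀ i, _ := ae_all_iff.2 h2
  filter_upwards [h3, Lp.coeFn_finsetSum (Finset.range n) fun i =>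
    ((((h⁻¹ : ℝ) : ℂ) * ∫ t in (a i)..(a (i + 1)), φ t) •
      cell Ω (a i) (a (i + 1)) : L2 Ω)] with x hx hx2
  rw [hx2, Finset.sum_apply]
  exact Finset.sum_congr rfl fun i _ => hx i

theorem norm_sq_eq_integral {X : Type} [MeasurableSpace X] {μ : Measure X} (f : Lp ℂ 2 μ) :
    ‖f‖ ^ 2 = ∫ x, ‖f x‖ ^ 2 ∂μ := by
  have h1 : ((‖f‖ ^ 2 : ℝ) : ℂ) = inner ℂ f f := by
    rw [inner_self_eq_norm_sq_to_K]
    push_cast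
    rfl
  rw [L2.inner_def] at h1
  have h2 : ∀ x, inner ℂ (f x) (f x) = ((‖f x‖ ^ 2 : ℝ) : ℂ) := fun x => by
    rw [inner_self_eq_norm_sq_to_K]
    push_cast
    rfl
  simp_rw [h2] at h1
  rw [integral_complex_ofReal] at h1
  exact_mod_cast h1

theorem integrable_norm_sq {X : Type} [MeasurableSpace X] {μ : Measure X} (f : Lp ℂ 2 μ) :
    Integrable (fun x => ‖f x‖ ^ 2) μ :=
  (Lp.memLp f).integrable_norm_pow (by norm_num)

/-- The points `-N + i / N`. For `i ≤ 2 N²` they divide `(-N, N]` into cells of length `1 / N`. -/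
noncomputable def gridPoint (N : ℕ) (i : ℕ) : ℝ := -N + i / N

/-- The averages approximate functions of bounded energy uniformly: inside `(-N, N]` the error is
controlled by the derivative, and outside by `x² ≥ N²`. -/
theorem norm_sub_averaging_sq_le {Ω : Set ℝ} {N : ℕ} (hN : 0 < N)
    {t : L2 Ω × L2 Ω × L2 Ω} (ht : t ∈ energyTriples Ω 1 fun x => x ^ 2) :
    ‖t.1 - averaging Ω (gridPoint N) (1 / N) (2 * N ^ 2) t.1‖ ^ 2 ≤
      (1 / N) ^ 2 * ‖t.2.1‖ ^ 2 + (1 / N) ^ 4 * ‖t.2.2‖ ^ 2 := by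
  refine energyTriples_induction (P := fun t =>
    ‖t.1 - averaging Ω (gridPoint N) (1 / N) (2 * N ^ 2) t.1‖ ^ 2 ≤
      (1 / N) ^ 2 * ‖t.2.1‖ ^ 2 + (1 / N) ^ 4 * ‖t.2.2‖ ^ 2) ?_ ?_ ht
  · exact isClosed_le (by fun_prop) (by fun_prop)
  rintro t ⟨φ, hφ, h1, h2, h3⟩
  have hN' : (0 : ℝ) < N := by exact_mod_cast hN
  have hsmooth : ContDiff ℝ 1 φ := hφ.smooth.of_le (by simp)
  have hdc : Continuous (deriv φ) := hsmooth.continuous_deriv le_rfl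
  have hmono : Monotone (gridPoint N) := fun i j hij => by
    unfold gridPoint
    have : (i : ℝ) ≤ j := by exact_mod_cast hij
    gcongr
  have hlen : ∀ i, gridPoint N (i + 1) - gridPoint N i = 1 / N := fun i => by
    unfold gridPoint
    push_cast
    ring
  set I : ℕ → Set ℝ := fun i => Ioc (gridPoint N i) (gridPoint N (i + 1)) with hI
  set M : ℕ → ℝ := fun i => 1 / N * ∫ t in (gridPoint N i)..(gridPoint N (i + 1)), ‖deriv φ t‖ ^ 2
  have hM : ∀ i, 0 ≤ M i := fun i => mul_nonneg (by positivity)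
    (intervalIntegral.integral_nonneg (hmono (Nat.le_succ i)) fun x _ => by positivity)
  -- In the coordinate `(x + N) N` the cells are the intervals `(i, i + 1]`.
  have hcell : ∀ x i, x ∈ I i ↔ (i : ℝ) < (x + N) * N ∧ (x + N) * N ≤ i + 1 := by
    intro x i
    rw [hI]
    simp only [mem_Ioc, gridPoint]
    push_cast
    rw [← sub_nonneg, ← sub_pos, ← sub_nonneg (b := (x + N) * N), ← sub_pos (b := (i : ℝ))]
    have e1 : (x + N) * N - i = (x - (-N + i / N)) * N := by
      field_simp
      ring
    have e2 : (i : ℝ) + 1 - (x + N) * N = (-N + (i + 1) / N - x) * N := by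
      field_simp
      ring
    rw [e1, e2, mul_nonneg_iff_of_pos_right hN', mul_pos_iff_of_pos_right hN']
  have huniq : ∀ x i j, x ∈ I i → x ∈ I j → i = j := by
    intro x i j hi hj
    rw [hcell] at hi hj
    have h1 : (i : ℝ) < j + 1 := hi.1.trans_le hj.2
    have h2 : (j : ℝ) < i + 1 := hj.1.trans_le hi.2
    have h1' : i < j + 1 := by exact_mod_cast h1
    have h2' : j < i + 1 := by exact_mod_cast h2
    omega
  -- At almost every point, at most one of the two error terms is needed.
  have hpt : ∀ᵐ x ∂(volume.restrict Ω),
      ‖(t.1 - averaging Ω (gridPoint N) (1 / N) (2 * N ^ 2) t.1 : L2 Ω) x‖ ^ 2 ≤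
        (∑ i ∈ Finset.range (2 * N ^ 2), (I i).indicator (fun _ => M i) x) +
          (1 / N) ^ 4 * ‖t.2.2 x‖ ^ 2 := by
    filter_upwards [h1, h3, averaging_ae_eq hφ (gridPoint N) hmono (1 / N) (2 * N ^ 2) h1,
      Lp.coeFn_sub t.1 (averaging Ω (gridPoint N) (1 / N) (2 * N ^ 2) t.1)] with x h1 h3 h4 h5
    rw [h5, Pi.sub_apply, h4, h1, h3]
    by_cases hx : ∃ i ∈ Finset.range (2 * N ^ 2), x ∈ I i
    · obtain ⟨i, hi, hxi⟩ := hx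
      have hz : ∀ j, j ≠ i → x ∉ I j := fun j hj hxj => hj (huniq x j i hxj hxi)
      rw [Finset.sum_eq_single_of_mem i hi fun j _ hj => indicator_of_notMem (hz j hj) _,
        Finset.sum_eq_single_of_mem i hi fun j _ hj => indicator_of_notMem (hz j hj) _,
        indicator_of_mem hxi, indicator_of_mem hxi]
      have := norm_sub_average_sq_le hsmooth (hxi.1.trans_le hxi.2) hxi
      rw [hlen] at this
      refine this.trans ?_
      have : 0 ≤ (1 / N : ℝ) ^ 4 * ‖((x ^ 2 : ℝ) : ℂ) * φ x‖ ^ 2 := by positivity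
      linarith
    · push Not at hx
      rw [Finset.sum_eq_zero fun j hj => indicator_of_notMem (hx j hj) _,
        Finset.sum_eq_zero fun j hj => indicator_of_notMem (hx j hj) _, sub_zero, zero_add,
        norm_mul, Complex.norm_real, Real.norm_of_nonneg (sq_nonneg x)]
      have hxN : (N : ℝ) ^ 2 ≤ x ^ 2 := by
        by_contra hlt
        rw [not_le, sq_lt_sq, abs_of_pos hN', abs_lt] at hlt
        have hpos : 0 < (x + N) * N := mul_pos (by linarith [hlt.1]) hN'
        have hc : 0 < ⌈(x + N) * N⌉₊ := Nat.ceil_pos.2 hpos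
        have hc1 : ((⌈(x + N) * N⌉₊ - 1 : ℕ) : ℝ) = (⌈(x + N) * N⌉₊ : ℝ) - 1 := by
          rw [Nat.cast_sub hc, Nat.cast_one]
        refine hx (⌈(x + N) * N⌉₊ - 1) ?_ ?_
        · rw [Finset.mem_range]
          have : ⌈(x + N) * N⌉₊ ≤ 2 * N ^ 2 := by
            rw [Nat.ceil_le]
            push_cast
            nlinarith [hlt.2]
          omega
        · rw [hcell, hc1]
          exact ⟨by linarith [Nat.ceil_lt_add_one hpos.le], by linarith [Nat.le_ceil ((x + N) * N)]⟩
      have : 1 ≤ (1 / N : ℝ) ^ 2 * x ^ 2 := by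
        rw [one_div, inv_pow, ← div_eq_inv_mul, one_le_div (by positivity)]
        exact hxN
      calc ‖φ x‖ ^ 2 = 1 ^ 2 * ‖φ x‖ ^ 2 := by ring
        _ ≤ ((1 / N : ℝ) ^ 2 * x ^ 2) ^ 2 * ‖φ x‖ ^ 2 := by gcongr
        _ = _ := by ring
  have hint : ∀ i, Integrable ((I i).indicator fun _ => M i) (volume.restrict Ω) := fun i =>
    (integrable_indicator_iff measurableSet_Ioc).2 (integrableOn_const (volume_restrict_Ioc_ne_top Ω _ _))
  rw [norm_sq_eq_integral, norm_sq_eq_integral t.2.2]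
  refine (integral_mono_ae (integrable_norm_sq _) ?_ hpt).trans ?_
  · exact (integrable_finsetSum _ fun i _ => hint i).add ((integrable_norm_sq _).const_mul _)
  rw [integral_add (integrable_finsetSum _ fun i _ => hint i) ((integrable_norm_sq _).const_mul _),
    integral_const_mul, integral_finsetSum _ fun i _ => hint i]
  refine add_le_add ?_ le_rfl
  have hd : ‖t.2.1‖ ^ 2 = ∫ x, ‖deriv φ x‖ ^ 2 := by
    rw [norm_sq_eq_integral]
    rw [integral_congr_ae (g := fun x => ‖deriv φ x‖ ^ 2)]
    · refine setIntegral_eq_integral_of_forall_compl_eq_zero fun x hx => ?_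
      have := (hφ.derivative 1).eq_zero hx
      rw [dirDeriv, fderiv_apply_one_eq_deriv] at this
      rw [this]
      simp
    · filter_upwards [h2] with x hx
      rw [hx, dirDeriv, fderiv_apply_one_eq_deriv]
  have hdi : Integrable (fun x => ‖deriv φ x‖ ^ 2) := by
    refine Continuous.integrable_of_hasCompactSupport (by fun_prop) ?_
    exact hφ.compact.deriv.norm.comp_left (g := fun y : ℝ => y ^ 2) (by simp)
  calc ∑ i ∈ Finset.range (2 * N ^ 2), ∫ x in Ω, (I i).indicator (fun _ => M i) x
      ≤ ∑ i ∈ Finset.range (2 * N ^ 2), (1 / N) * M i := by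
        refine Finset.sum_le_sum fun i _ => ?_
        rw [integral_indicator measurableSet_Ioc, Measure.restrict_restrict measurableSet_Ioc,
          setIntegral_const, smul_eq_mul]
        refine mul_le_mul_of_nonneg_right ?_ (hM i)
        rw [← hlen i, ← Real.volume_real_Ioc_of_le (hmono (Nat.le_succ i))]
        exact measureReal_mono inter_subset_left measure_Ioc_lt_top.ne
    _ = (1 / N) ^ 2 * ∑ i ∈ Finset.range (2 * N ^ 2),
          ∫ t in (gridPoint N i)..(gridPoint N (i + 1)), ‖deriv φ t‖ ^ 2 := by
        rw [Finset.mul_sum]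
        refine Finset.sum_congr rfl fun i _ => ?_
        simp only [M]
        ring
    _ ≤ (1 / N) ^ 2 * ‖t.2.1‖ ^ 2 := by
        refine mul_le_mul_of_nonneg_left ?_ (by positivity)
        rw [intervalIntegral.sum_integral_adjacent_intervals fun i _ =>
          Continuous.intervalIntegrable (by fun_prop) _ _, hd,
          intervalIntegral.integral_of_le (hmono (Nat.zero_le _))]
        exact setIntegral_le_integral hdi (ae_of_all _ fun x => by positivity)

theorem isCompactOperator_energyEmbedding (Ω : Set ℝ) (c β κ : ℝ) :
    IsCompactOperator (energyEmbedding Ω 1 (fun x => x ^ 2) c β κ) := by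
  set J := energyEmbedding Ω 1 (fun x => x ^ 2) c β κ
  -- The embedding is the limit in norm of its compositions with operators of finite rank.
  set A : ℕ → (L2 Ω →L[ℂ] L2 Ω) := fun N =>
    averaging Ω (gridPoint (N + 1)) (1 / ((N + 1 : ℕ) : ℝ)) (2 * (N + 1) ^ 2)
  refine isCompactOperator_of_tendsto (l := atTop) (F := fun N => (A N).comp J) ?_
    (Eventually.of_forall fun N => (isCompactOperator_averaging _ _ _ _).comp_clm J)
  set K := ‖unscale Ω c β κ‖ with hK
  have hbound : ∀ N, ‖(A N).comp J - J‖ ≤ (1 / ((N + 1 : ℕ) : ℝ)) * (2 * K) := by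
    intro N
    refine ContinuousLinearMap.opNorm_le_bound _ (by positivity) fun v => ?_
    have h := norm_sub_averaging_sq_le (Nat.succ_pos N) (t := unscale Ω c β κ v) v.2
    have hv : ‖unscale Ω c β κ v‖ ≤ K * ‖v‖ := (unscale Ω c β κ).le_opNorm v
    have h1 : ‖(unscale Ω c β κ v).2.1‖ ≤ K * ‖v‖ := ((norm_fst_le _).trans (norm_snd_le _)).trans hv
    have h2 : ‖(unscale Ω c β κ v).2.2‖ ≤ K * ‖v‖ := ((norm_snd_le _).trans (norm_snd_le _)).trans hv
    have hJ : (unscale Ω c β κ v).1 = J v := rfl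
    rw [hJ, norm_sub_rev] at h
    change ‖A N (J v) - J v‖ ≤ _
    refine abs_le_of_sq_le_sq' ?_ (by positivity) |>.2
    refine h.trans ?_
    set ε : ℝ := 1 / ((N + 1 : ℕ) : ℝ) with hε
    have hε0 : 0 ≤ ε := by positivity
    have hε1 : ε ≤ 1 := by
      rw [hε, div_le_one (by positivity)]
      push_cast
      linarith [(Nat.cast_nonneg N : (0 : ℝ) ≤ N)]
    have e1 : ε ^ 4 ≤ ε ^ 2 := pow_le_pow_of_le_one hε0 hε1 (by norm_num)
    calc ε ^ 2 * ‖(unscale Ω c β κ v).2.1‖ ^ 2 + ε ^ 4 * ‖(unscale Ω c β κ v).2.2‖ ^ 2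
        ≤ ε ^ 2 * (K * ‖v‖) ^ 2 + ε ^ 2 * (K * ‖v‖) ^ 2 := by gcongr
      _ ≤ _ := by nlinarith [sq_nonneg (ε * K * ‖v‖)]
  refine (tendsto_iff_norm_sub_tendsto_zero
    (E := energyHilbert Ω 1 (fun x => x ^ 2) c β κ →L[ℂ] L2 Ω)).2 ?_
  refine squeeze_zero (fun N => ContinuousLinearMap.opNorm_nonneg ((A N).comp J - J)) hbound ?_
  have : Tendsto (fun N : ℕ => 1 / ((N + 1 : ℕ) : ℝ)) atTop (𝓝 0) :=
    (tendsto_const_div_atTop_nhds_zero_nat 1).comp (tendsto_add_atTop_nat 1)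
  simpa using this.mul_const (2 * K)

theorem isCompactOperator_resolvent (Ω : Set ℝ) (c β κ : ℝ) :
    IsCompactOperator (resolvent Ω 1 (fun x => x ^ 2) c β κ) :=
  (isCompactOperator_energyEmbedding Ω c β κ).comp_clm _

/-! ### Weak solutions of second order equations on an interval -/

theorem exists_Ioo_supset {Ω K : Set ℝ} (hΩ : IsOpen Ω) {x₀ : ℝ} (hx₀ : x₀ ∈ Ω)
    (hK : IsCompact K) (hKΩ : K ⊆ Ω) :
    ∃ a b, a ∈ Ω ∧ b ∈ Ω ∧ x₀ ∈ Ioo a b ∧ K ⊆ Ioo a b := by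
  have hK' : IsCompact (insert x₀ K) := hK.insert x₀
  have hKΩ' : insert x₀ K ⊆ Ω := insert_subset hx₀ hKΩ
  have hinf := hKΩ' (hK'.sInf_mem (insert_nonempty _ _))
  have hsup := hKΩ' (hK'.sSup_mem (insert_nonempty _ _))
  obtain ⟨l, hl, hlΩ⟩ := exists_Ioc_subset_of_mem_nhds (hΩ.mem_nhds hinf)
    ⟨_, sub_one_lt (sInf (insert x₀ K))⟩
  obtain ⟨u, hu, huΩ⟩ := exists_Ico_subset_of_mem_nhds (hΩ.mem_nhds hsup)
    ⟨_, lt_add_one (sSup (insert x₀ K))⟩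
  obtain ⟨a, ha1, ha2⟩ := exists_between hl
  obtain ⟨b, hb1, hb2⟩ := exists_between hu
  have hsub : insert x₀ K ⊆ Ioo a b := fun x hx =>
    ⟨ha2.trans_le (csInf_le hK'.bddBelow hx), (le_csSup hK'.bddAbove hx).trans_lt hb1⟩
  exact ⟨a, b, hlΩ ⟨ha1, ha2.le⟩, huΩ ⟨hb1.le, hb2⟩, hsub (mem_insert _ _),
    (subset_insert _ _).trans hsub⟩

theorem setIntegral_eq_intervalIntegral {Ω : Set ℝ} {a b : ℝ} (hab : a ≤ b) (hΩ : Icc a b ⊆ Ω)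
    {f : ℝ → ℂ} (hf : ∀ x, x ∉ Ioo a b → f x = 0) : ∫ x in Ω, f x = ∫ x in a..b, f x := by
  rw [intervalIntegral.integral_of_le hab,
    setIntegral_eq_integral_of_forall_compl_eq_zero fun x hx => hf x fun h => hx (hΩ (Ioo_subset_Icc_self h)),
    setIntegral_eq_integral_of_forall_compl_eq_zero fun x hx => hf x fun h => hx (Ioo_subset_Ioc_self h)]

theorem eq_zero_of_notMem_tsupport {X Y : Type} [TopologicalSpace X] [Zero Y] {φ : X → Y} {s : Set X}
    (h : tsupport φ ⊆ s) {x : X} (hx : x ∉ s) : φ x = 0 :=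
  image_eq_zero_of_notMem_tsupport fun h' => hx (h h')

/-- A locally integrable function on an interval with vanishing weak derivative is constant: the
test functions that are derivatives are those with vanishing integral. -/
theorem ae_const_of_integral_mul_deriv_eq_zero {Ω : Set ℝ} (hΩ : IsOpen Ω) (hc : OrdConnected Ω)
    {x₀ : ℝ} (hx₀ : x₀ ∈ Ω) {h : ℝ → ℂ} (hh : LocallyIntegrableOn h Ω)
    (hz : ∀ φ : ℝ → ℝ, ContDiff ℝ ∞ φ → HasCompactSupport φ → tsupport φ ⊆ Ω →
      ∫ x in Ω, h x * (deriv φ x : ℝ) = 0) :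
    ∃ c : ℂ, ∀ᵐ x ∂(volume.restrict Ω), h x = c := by
  obtain ⟨ε, hε, hεΩ⟩ := Metric.isOpen_iff.1 hΩ x₀ hx₀
  let B : ContDiffBump x₀ := ⟨ε / 4, ε / 2, by positivity, by linarith⟩
  set φ₀ : ℝ → ℝ := B.normed volume with hφ₀
  have hφ₀s : ContDiff ℝ ∞ φ₀ := B.contDiff_normed
  have hφ₀c : HasCompactSupport φ₀ := B.hasCompactSupport_normed
  have hφ₀Ω : tsupport φ₀ ⊆ Ω := by
    rw [hφ₀, B.tsupport_normed_eq]
    exact (Metric.closedBall_subset_ball (by change ε / 2 < ε; linarith)).trans hεΩ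
  have hφ₀i : ∫ x, φ₀ x = 1 := B.integral_normed
  have hint : ∀ φ : ℝ → ℝ, ContDiff ℝ ∞ φ → HasCompactSupport φ → tsupport φ ⊆ Ω →
      IntegrableOn (fun x => h x * (φ x : ℂ)) Ω := by
    intro φ hφ hφc hφΩ
    have h1 : IntegrableOn h (tsupport φ) := hh.integrableOn_compact_subset hφΩ hφc
    have h2 : IntegrableOn (fun x => h x * (φ x : ℂ)) (tsupport φ) :=
      h1.mul_continuousOn (Complex.continuous_ofReal.comp hφ.continuous).continuousOn hφc
    refine IntegrableOn.of_forall_sdiff_eq_zero h2 hΩ.measurableSet fun x hx => ?_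
    rw [image_eq_zero_of_notMem_tsupport hx.2]
    simp
  set c : ℂ := ∫ x in Ω, h x * (φ₀ x : ℂ) with hcdef
  have key : ∀ φ : ℝ → ℝ, ContDiff ℝ ∞ φ → HasCompactSupport φ → tsupport φ ⊆ Ω →
      ∫ x in Ω, h x * (φ x : ℂ) = (∫ x, φ x : ℝ) * c := by
    intro φ hφ hφc hφΩ
    obtain ⟨a, b, ha, hb, ⟨hax, hxb⟩, hK⟩ := exists_Ioo_supset hΩ hx₀ (hφc.isCompact.union hφ₀c)
      (union_subset hφΩ hφ₀Ω)
    have hab : a < b := hax.trans hxb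
    have habΩ : Icc a b ⊆ Ω := hc.out ha hb
    -- Subtracting a multiple of `φ₀` makes the integral vanish, and then the primitive is a test
    -- function.
    set g : ℝ → ℝ := fun x => φ x - (∫ y, φ y) * φ₀ x with hg
    have hgs : ContDiff ℝ ∞ g := hφ.sub (contDiff_const.mul hφ₀s)
    have hgz : ∀ x, x ∉ Ioo a b → g x = 0 := by
      intro x hx
      have h1 : φ x = 0 := eq_zero_of_notMem_tsupport (subset_union_left.trans hK) hx
      have h2 : φ₀ x = 0 := eq_zero_of_notMem_tsupport (subset_union_right.trans hK) hx
      simp [hg, h1, h2]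
    set χ : ℝ → ℝ := fun x => ∫ t in a..x, g t with hχ
    have hχd : ∀ x, HasDerivAt χ (g x) x := fun x => hgs.continuous.integral_hasStrictDerivAt a x |>.hasDerivAt
    have hχd' : deriv χ = g := funext fun x => (hχd x).deriv
    have hχs : ContDiff ℝ ∞ χ := contDiff_infty_iff_deriv.2
      ⟨fun x => (hχd x).differentiableAt, hχd' ▸ hgs⟩
    have hgi : ∫ x in a..b, g x = 0 := by
      rw [intervalIntegral.integral_of_le hab.le,
        setIntegral_eq_integral_of_forall_compl_eq_zero fun x hx =>
          hgz x fun h => hx (Ioo_subset_Ioc_self h), hg,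
        integral_sub (hφ.continuous.integrable_of_hasCompactSupport hφc)
          ((hφ₀s.continuous.integrable_of_hasCompactSupport hφ₀c).const_mul _),
        integral_const_mul, hφ₀i]
      ring
    have hχz : ∀ x, x ∉ Icc a b → χ x = 0 := by
      intro x hx
      rcases lt_or_ge x a with h1 | h1
      · rw [hχ]
        refine intervalIntegral.integral_zero_ae (ae_of_all _ fun t ht => hgz t fun h2 => ?_)
        rw [uIoc_of_ge h1.le] at ht
        exact absurd ht.2 (not_le.2 h2.1)
      · have h2 : b < x := not_le.1 fun h => hx ⟨h1, h⟩
        have h3 : ∫ t in b..x, g t = 0 := by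
          refine intervalIntegral.integral_zero_ae (ae_of_all _ fun t ht => hgz t fun h4 => ?_)
          rw [uIoc_of_le h2.le] at ht
          exact absurd h4.2 (not_lt.2 ht.1.le)
        rw [hχ]
        dsimp only
        rw [← intervalIntegral.integral_add_adjacent_intervals
          (hgs.continuous.intervalIntegrable a b) (hgs.continuous.intervalIntegrable b x), hgi, h3,
          add_zero]
    have hχt : tsupport χ ⊆ Icc a b :=
      closure_minimal (fun x hx => not_not.1 fun h => hx (hχz x h)) isClosed_Icc
    have h0 := hz χ hχs (isCompact_Icc.of_isClosed_subset (isClosed_tsupport _) hχt)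
      (hχt.trans habΩ)
    rw [hχd'] at h0
    have e1 : ∀ x, h x * (g x : ℂ) = h x * (φ x : ℂ) - (∫ y, φ y : ℝ) * (h x * (φ₀ x : ℂ)) := by
      intro x
      simp only [hg]
      push_cast
      ring
    simp_rw [e1] at h0
    rw [integral_sub (hint φ hφ hφc hφΩ) ((hint φ₀ hφ₀s hφ₀c hφ₀Ω).const_mul _),
      integral_const_mul] at h0
    exact sub_eq_zero.1 h0
  refine ⟨c, ?_⟩
  have hfin := hΩ.ae_eq_zero_of_integral_contDiff_smul_eq_zero
    (hh.sub ((locallyIntegrable_const c).locallyIntegrableOn Ω)) ?_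
  · have := (ae_restrict_iff' hΩ.measurableSet).2 hfin
    filter_upwards [this] with x hx
    exact sub_eq_zero.1 hx
  · intro φ hφ hφc hφΩ
    have e1 : ∀ x, φ x • (h - fun _ => c : ℝ → ℂ) x = h x * (φ x : ℂ) - c * (φ x : ℂ) := fun x => by
      simp only [Pi.sub_apply, Complex.real_smul]
      ring
    have hφi : Integrable (fun x => (φ x : ℂ)) :=
      (hφ.continuous.integrable_of_hasCompactSupport hφc).ofReal
    have e2 : ∫ x in Ω, (φ x : ℂ) = (∫ x, φ x : ℝ) := by
      rw [setIntegral_eq_integral_of_forall_compl_eq_zero, integral_complex_ofReal]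
      intro x hx
      rw [eq_zero_of_notMem_tsupport hφΩ hx, Complex.ofReal_zero]
    rw [← setIntegral_eq_integral_of_forall_compl_eq_zero (s := Ω) fun x hx => by
      rw [eq_zero_of_notMem_tsupport hφΩ hx, zero_smul]]
    simp_rw [e1]
    rw [integral_sub (hint φ hφ hφc hφΩ) (hφi.integrableOn.const_mul _), key φ hφ hφc hφΩ,
      integral_const_mul, e2, mul_comm, sub_self]

/-- Integration by parts for the primitive of an integrable function. -/
theorem integral_primitive_mul_deriv {g : ℝ → ℂ} {φ : ℝ → ℝ} {a b x₀ : ℝ}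
    (hg : IntervalIntegrable g volume a b) (hx₀ : x₀ ∈ uIcc a b) (hφ : ContDiff ℝ 1 φ)
    (ha : φ a = 0) (hb : φ b = 0) :
    ∫ x in a..b, (∫ t in x₀..x, g t) * (deriv φ x : ℝ) = -∫ x in a..b, g x * (φ x : ℝ) := by
  have hd : Continuous (deriv φ) := hφ.continuous_deriv le_rfl
  have hsub : ∀ x ∈ uIcc a b, IntervalIntegrable g volume x₀ x := fun x hx =>
    hg.mono_set (uIcc_subset_uIcc hx₀ hx)
  have hcont : ContinuousOn (fun x => ∫ t in x₀..x, g t) (uIcc a b) :=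
    intervalIntegral.continuousOn_primitive_interval' hg hx₀
  have hi1 : IntervalIntegrable (fun x => (∫ t in x₀..x, g t) * (deriv φ x : ℝ)) volume a b :=
    (hcont.mul (by fun_prop)).intervalIntegrable
  have hi2 : IntervalIntegrable (fun x => g x * (φ x : ℝ)) volume a b :=
    hg.mul_continuousOn (Complex.continuous_ofReal.comp hφ.continuous).continuousOn
  -- Integration by parts for absolutely continuous functions is applied to the real and the
  -- imaginary part.
  have key : ∀ L : ℂ →L[ℝ] ℝ, L (∫ x in a..b, (∫ t in x₀..x, g t) * (deriv φ x : ℝ)) =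
      L (-∫ x in a..b, g x * (φ x : ℝ)) := by
    intro L
    have hL : IntervalIntegrable (fun x => L (g x)) volume a b :=
      ⟨L.integrable_comp hg.1, L.integrable_comp hg.2⟩
    have hmul : ∀ (z : ℂ) (r : ℝ), L (z * r) = L z * r := fun z r => by
      rw [mul_comm, ← Complex.real_smul, map_smul, smul_eq_mul, mul_comm]
    have ac1 := hL.absolutelyContinuousOnInterval_intervalIntegral hx₀
    have ac2 : AbsolutelyContinuousOnInterval φ a b := by
      have h1 := (hd.intervalIntegrable a b).absolutelyContinuousOnInterval_intervalIntegral
        (left_mem_uIcc (a := a) (b := b))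
      have h2 : (fun x => ∫ t in a..x, deriv φ t) = φ := by
        ext x
        rw [intervalIntegral.integral_deriv_eq_sub (fun y _ => hφ.differentiable (by simp) y)
          (hd.intervalIntegrable _ _), ha, sub_zero]
      rwa [h2] at h1
    have hibp := ac1.integral_mul_deriv_eq_deriv_mul ac2
    rw [ha, hb, mul_zero, mul_zero, sub_zero, zero_sub] at hibp
    rw [map_neg, ← L.intervalIntegral_comp_comm hi1, ← L.intervalIntegral_comp_comm hi2]
    calc ∫ x in a..b, L ((∫ t in x₀..x, g t) * (deriv φ x : ℝ))
        = ∫ x in a..b, (∫ t in x₀..x, L (g t)) * deriv φ x := by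
          refine intervalIntegral.integral_congr fun x hx => ?_
          rw [hmul, L.intervalIntegral_comp_comm (hsub x hx)]
      _ = -∫ x in a..b, deriv (fun x => ∫ t in x₀..x, L (g t)) x * φ x := hibp
      _ = _ := by
          congr 1
          refine intervalIntegral.integral_congr_ae ?_
          filter_upwards [hL.ae_hasDerivAt_integral] with x hx hxI
          rw [(hx (uIoc_subset_uIcc hxI) x₀ hx₀).deriv, hmul]
  exact Complex.ext (key Complex.reCLM) (key Complex.imCLM)

/-- A function with a locally integrable weak derivative is a primitive of it. -/
theorem ae_eq_const_add_primitive {Ω : Set ℝ} (hΩ : IsOpen Ω) (hc : OrdConnected Ω)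
    {x₀ : ℝ} (hx₀ : x₀ ∈ Ω) {f g : ℝ → ℂ} (hf : LocallyIntegrableOn f Ω)
    (hg : LocallyIntegrableOn g Ω)
    (hfg : ∀ φ : ℝ → ℝ, ContDiff ℝ ∞ φ → HasCompactSupport φ → tsupport φ ⊆ Ω →
      ∫ x in Ω, f x * (deriv φ x : ℝ) = -∫ x in Ω, g x * (φ x : ℝ)) :
    ∃ c : ℂ, ∀ᵐ x ∂(volume.restrict Ω), f x = c + ∫ t in x₀..x, g t := by
  have hgi : ∀ a ∈ Ω, ∀ b ∈ Ω, IntervalIntegrable g volume a b := fun a ha b hb =>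
    (hg.integrableOn_compact_subset (hc.uIcc_subset ha hb) isCompact_uIcc).intervalIntegrable
  have hcont : ContinuousOn (fun x => ∫ t in x₀..x, g t) Ω := by
    intro x hx
    obtain ⟨a, b, ha, hb, hx₀', hx'⟩ := exists_Ioo_supset hΩ hx₀ (isCompact_singleton (x := x))
      (singleton_subset_iff.2 hx)
    have h1 := intervalIntegral.continuousOn_primitive_interval' (hgi a ha b hb)
      (Icc_subset_uIcc (Ioo_subset_Icc_self hx₀'))
    exact (h1.continuousAt (mem_of_superset (Ioo_mem_nhds (hx' rfl).1 (hx' rfl).2)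
      (Ioo_subset_Icc_self.trans Icc_subset_uIcc))).continuousWithinAt
  have hz : ∀ φ : ℝ → ℝ, ContDiff ℝ ∞ φ → HasCompactSupport φ → tsupport φ ⊆ Ω →
      ∫ x in Ω, (f x - ∫ t in x₀..x, g t) * (deriv φ x : ℝ) = 0 := by
    intro φ hφ hφc hφΩ
    have hd : Continuous (deriv φ) := hφ.continuous_deriv (by simp)
    obtain ⟨a, b, ha, hb, hx₀', hK⟩ := exists_Ioo_supset hΩ hx₀ hφc hφΩ
    have hab : a ≤ b := (hx₀'.1.trans hx₀'.2).le
    have habΩ : Icc a b ⊆ Ω := hc.out ha hb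
    have hz : ∀ x, x ∉ Ioo a b → φ x = 0 := fun x hx => eq_zero_of_notMem_tsupport hK hx
    have hz' : ∀ x, x ∉ Ioo a b → deriv φ x = 0 := fun x hx => by
      refine eq_zero_of_notMem_tsupport (s := Ioo a b) ?_ hx
      exact (closure_minimal (support_deriv_subset) (isClosed_tsupport _)).trans hK
    have h1 := hfg φ hφ hφc hφΩ
    rw [setIntegral_eq_intervalIntegral hab habΩ (fun x hx => by simp [hz' x hx]),
      setIntegral_eq_intervalIntegral hab habΩ (fun x hx => by simp [hz x hx]),
      ← integral_primitive_mul_deriv (hgi a ha b hb) (Icc_subset_uIcc (Ioo_subset_Icc_self hx₀'))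
        (hφ.of_le (by simp)) (hz a (by simp)) (hz b (by simp))] at h1
    rw [setIntegral_eq_intervalIntegral hab habΩ (fun x hx => by simp [hz' x hx])]
    simp_rw [sub_mul]
    rw [intervalIntegral.integral_sub, h1, sub_self]
    · refine IntervalIntegrable.mul_continuousOn ?_ (by fun_prop)
      exact (hf.integrableOn_compact_subset (hc.uIcc_subset ha hb)
        isCompact_uIcc).intervalIntegrable
    · refine ContinuousOn.intervalIntegrable ?_
      exact (hcont.mono (hc.uIcc_subset ha hb)).mul (by fun_prop)
  obtain ⟨c, hcst⟩ := ae_const_of_integral_mul_deriv_eq_zero hΩ hc hx₀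
    (hf.sub (hcont.locallyIntegrableOn hΩ.measurableSet)) hz
  refine ⟨c, ?_⟩
  filter_upwards [hcst] with x hx
  rw [← hx]
  exact (sub_add_cancel _ _).symm

/-- `u` solves `u'' = Q u` in `Ω`, and `v` is the derivative of `u`. -/
def SolvesODE (Ω : Set ℝ) (Q u v : ℝ → ℂ) : Prop :=
  ∀ x ∈ Ω, HasDerivAt u (v x) x ∧ HasDerivAt v (Q x * u x) x

theorem L2.locallyIntegrableOn {Ω : Set ℝ} (f : L2 Ω) : LocallyIntegrableOn (f : ℝ → ℂ) Ω :=
  locallyIntegrableOn_of_locallyIntegrable_restrict ((Lp.memLp f).locallyIntegrable (by norm_num))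

theorem isTestFunction_ofReal {Ω : Set ℝ} {φ : ℝ → ℝ} (hφ : ContDiff ℝ ∞ φ)
    (hφc : HasCompactSupport φ) (hφΩ : tsupport φ ⊆ Ω) : IsTestFunction Ω fun x => (φ x : ℂ) := by
  have hsup : Function.support (fun x => (φ x : ℂ)) = Function.support φ := by
    ext x
    simp
  refine ⟨Complex.ofRealCLM.contDiff.comp hφ, hφc.comp_left (g := Complex.ofReal) rfl, ?_⟩
  rw [tsupport, hsup]
  exact hφΩ

theorem dirDeriv_ofReal {φ : ℝ → ℝ} (hφ : Differentiable ℝ φ) :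
    dirDeriv 1 (fun x => (φ x : ℂ)) = fun x => ((deriv φ x : ℝ) : ℂ) := by
  ext x
  rw [dirDeriv, fderiv_apply_one_eq_deriv]
  exact (hφ x).hasDerivAt.ofReal_comp.deriv

theorem dirDeriv_dirDeriv_ofReal {φ : ℝ → ℝ} (hφ : ContDiff ℝ ∞ φ) :
    dirDeriv 1 (dirDeriv 1 fun x => (φ x : ℂ)) = fun x => ((deriv (deriv φ) x : ℝ) : ℂ) := by
  rw [dirDeriv_ofReal (hφ.differentiable (by simp)), dirDeriv_ofReal]
  exact (contDiff_infty_iff_deriv.1 hφ).2.differentiable (by simp)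

theorem hasDerivAt_primitive {Ω : Set ℝ} (hΩ : IsOpen Ω) (hc : OrdConnected Ω) {x₀ : ℝ}
    (hx₀ : x₀ ∈ Ω) {g : ℝ → ℂ} (hg : ContinuousOn g Ω) {x : ℝ} (hx : x ∈ Ω) :
    HasDerivAt (fun y => ∫ t in x₀..y, g t) (g x) x :=
  intervalIntegral.integral_hasDerivAt_right
    ((hg.mono (hc.uIcc_subset hx₀ hx)).intervalIntegrable)
    (hg.stronglyMeasurableAtFilter hΩ x hx) (hg.continuousAt (hΩ.mem_nhds hx))

/-- The weak derivative may be modified on a null set. -/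
theorem ae_eq_const_add_primitive_of_ae_eq {Ω : Set ℝ} (hΩ : IsOpen Ω) (hc : OrdConnected Ω)
    {x₀ : ℝ} (hx₀ : x₀ ∈ Ω) {f g h : ℝ → ℂ} (hf : LocallyIntegrableOn f Ω)
    (hg : LocallyIntegrableOn g Ω)
    (hfg : ∀ φ : ℝ → ℝ, ContDiff ℝ ∞ φ → HasCompactSupport φ → tsupport φ ⊆ Ω →
      ∫ x in Ω, f x * (deriv φ x : ℝ) = -∫ x in Ω, g x * (φ x : ℝ))
    (hgh : ∀ᵐ x ∂(volume.restrict Ω), g x = h x) :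
    ∃ c : ℂ, ∀ᵐ x ∂(volume.restrict Ω), f x = c + ∫ t in x₀..x, h t := by
  obtain ⟨c, hcst⟩ := ae_eq_const_add_primitive hΩ hc hx₀ hf hg hfg
  refine ⟨c, ?_⟩
  filter_upwards [hcst, ae_restrict_mem hΩ.measurableSet] with x hx hxΩ
  rw [hx]
  congr 1
  refine intervalIntegral.integral_congr_ae ?_
  filter_upwards [(ae_restrict_iff' hΩ.measurableSet).1 hgh] with y hy hyI
  exact hy (hc.uIcc_subset hx₀ hxΩ (uIoc_subset_uIcc hyI))

/-- Elliptic regularity on an interval: a weak eigenfunction is almost everywhere equal to a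
classical solution. -/
theorem exists_solvesODE {Ω : Set ℝ} (hΩ : IsOpen Ω) (hoc : OrdConnected Ω) (hne : Ω.Nonempty)
    {c : ℝ} (hc : 0 < c) {q : C(ℝ, ℝ)} {w : ℝ → ℝ} {z : ℂ} {ψ : L2 Ω}
    (hψ : (ψ, z • ψ) ∈ operatorGraph Ω 1 c q w) :
    ∃ u v : ℝ → ℂ, ψ =ᵐ[volume.restrict Ω] u ∧ MemLp u 2 (volume.restrict Ω) ∧
      MemLp v 2 (volume.restrict Ω) ∧ SolvesODE Ω (fun x => (q x - z) / c) u v := by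
  obtain ⟨x₀, hx₀⟩ := hne
  obtain ⟨⟨t, ht, htψ⟩, heq⟩ := hψ
  replace htψ : t.1 = ψ := htψ
  have hc' : (c : ℂ) ≠ 0 := by exact_mod_cast hc.ne'
  obtain ⟨c₀, h₀⟩ := ae_eq_const_add_primitive hΩ hoc hx₀ (L2.locallyIntegrableOn t.1)
    (L2.locallyIntegrableOn t.2.1) fun φ hφ hφc hφΩ => by
      have h := integral_fst_mul_dirDeriv ht (isTestFunction_ofReal hφ hφc hφΩ)
      rwa [dirDeriv_ofReal (hφ.differentiable (by simp))] at h
  set Q : ℝ → ℂ := fun x => (q x - z) / c with hQ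
  have hQc : Continuous Q := by fun_prop
  -- The weak derivative of `t.2.1` is `Q ψ`.
  have hint : ∀ φ : ℝ → ℝ, ContDiff ℝ ∞ φ → HasCompactSupport φ → tsupport φ ⊆ Ω →
      ∫ x in Ω, t.2.1 x * (deriv φ x : ℝ) = -∫ x in Ω, (Q x * t.1 x) * (φ x : ℝ) := by
    intro φ hφ hφc hφΩ
    have hT := isTestFunction_ofReal hφ hφc hφΩ
    have h1 := integral_fst_mul_dirDeriv ht (hT.derivative 1)
    rw [dirDeriv_dirDeriv_ofReal hφ, dirDeriv_ofReal (hφ.differentiable (by simp))] at h1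
    have h2 : ∫ x in Ω, t.1 x * diffExpr 1 c q (fun x => (φ x : ℂ)) x =
        ∫ x in Ω, (z • t.1) x * (φ x : ℂ) := by
      rw [htψ]
      exact heq _ hT
    have i1 : Integrable (fun x => t.1 x * ((deriv (deriv φ) x : ℝ) : ℂ)) (volume.restrict Ω) := by
      have := (Lp.memLp t.1).integrable_mul ((hT.derivative 1).derivative 1).memLp
      rw [dirDeriv_dirDeriv_ofReal hφ] at this
      exact this
    have i2 : Integrable (fun x => (q x : ℂ) * t.1 x * (φ x : ℂ)) (volume.restrict Ω) := by
      have : Integrable (fun x => t.1 x * ((q x : ℂ) * (φ x : ℂ))) (volume.restrict Ω) :=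
        (Lp.memLp t.1).integrable_mul (hT.memLp_mul q.continuous)
      refine this.congr (ae_of_all _ fun x => ?_)
      ring
    have i3 : Integrable (fun x => z * t.1 x * (φ x : ℂ)) (volume.restrict Ω) := by
      refine (((Lp.memLp t.1).integrable_mul hT.memLp).const_mul z).congr (ae_of_all _ fun x => ?_)
      simp only [Pi.mul_apply]
      ring
    have e1 : ∀ x, t.1 x * diffExpr 1 c q (fun x => (φ x : ℂ)) x =
        -(c : ℂ) * (t.1 x * ((deriv (deriv φ) x : ℝ) : ℂ)) + (q x : ℂ) * t.1 x * (φ x : ℂ) := by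
      intro x
      rw [diffExpr, dirDeriv_dirDeriv_ofReal hφ]
      ring
    have e2 : ∫ x in Ω, (z • t.1) x * (φ x : ℂ) = ∫ x in Ω, z * t.1 x * (φ x : ℂ) := by
      refine integral_congr_ae ?_
      filter_upwards [Lp.coeFn_smul z t.1] with x hx
      rw [hx, Pi.smul_apply, smul_eq_mul]
    have e3 : ∀ x, (Q x * t.1 x) * (φ x : ℝ) =
        (c : ℂ)⁻¹ * ((q x : ℂ) * t.1 x * (φ x : ℂ) - z * t.1 x * (φ x : ℂ)) := by
      intro x
      simp only [hQ]
      field_simp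
    simp_rw [e1] at h2
    rw [e2, integral_add (i1.const_mul _) i2, integral_const_mul, h1] at h2
    simp_rw [e3]
    rw [integral_const_mul, integral_sub i2 i3, ← h2]
    field_simp
    ring
  have hQt : LocallyIntegrableOn (fun x => Q x * t.1 x) Ω :=
    (L2.locallyIntegrableOn t.1).continuousOn_mul hQc.continuousOn hΩ.isLocallyClosed
  -- `u₀` is the continuous representative; `u`, the primitive of the continuous representative `v`
  -- of the derivative, coincides with it in `Ω` and is differentiable everywhere in `Ω`.
  set u₀ : ℝ → ℂ := fun x => c₀ + ∫ s in x₀..x, t.2.1 s with hu₀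
  obtain ⟨c₁, h₁⟩ := ae_eq_const_add_primitive_of_ae_eq hΩ hoc hx₀ (L2.locallyIntegrableOn t.2.1) hQt hint
    (h := fun x => Q x * u₀ x) (by
      filter_upwards [h₀] with x hx
      rw [hx])
  have hu₀c : ContinuousOn u₀ Ω := by
    have hgi : ∀ a ∈ Ω, ∀ b ∈ Ω, IntervalIntegrable t.2.1 volume a b := fun a ha b hb =>
      ((L2.locallyIntegrableOn t.2.1).integrableOn_compact_subset (hoc.uIcc_subset ha hb)
        isCompact_uIcc).intervalIntegrable
    intro x hx
    obtain ⟨a, b, ha, hb, hx₀', hx'⟩ := exists_Ioo_supset hΩ hx₀ (isCompact_singleton (x := x))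
      (singleton_subset_iff.2 hx)
    have h1 := intervalIntegral.continuousOn_primitive_interval' (hgi a ha b hb)
      (Icc_subset_uIcc (Ioo_subset_Icc_self hx₀'))
    exact ((continuousOn_const.add h1).continuousAt (mem_of_superset (Ioo_mem_nhds (hx' rfl).1
      (hx' rfl).2) (Ioo_subset_Icc_self.trans Icc_subset_uIcc))).continuousWithinAt
  set v : ℝ → ℂ := fun x => c₁ + ∫ s in x₀..x, Q s * u₀ s with hv
  have hvd : ∀ x ∈ Ω, HasDerivAt v (Q x * u₀ x) x := fun x hx =>
    (hasDerivAt_primitive hΩ hoc hx₀ (hQc.continuousOn.mul hu₀c) hx).const_add c₁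
  have hvc : ContinuousOn v Ω := HasDerivAt.continuousOn hvd
  set u : ℝ → ℂ := fun x => c₀ + ∫ s in x₀..x, v s with hu
  have huu₀ : EqOn u u₀ Ω := by
    intro x hx
    simp only [hu, hu₀]
    congr 1
    refine intervalIntegral.integral_congr_ae ?_
    filter_upwards [(ae_restrict_iff' hΩ.measurableSet).1 h₁] with y hy hyI
    exact (hy (hoc.uIcc_subset hx₀ hx (uIoc_subset_uIcc hyI))).symm
  have hψu : ψ =ᵐ[volume.restrict Ω] u := by
    filter_upwards [h₀, ae_restrict_mem hΩ.measurableSet] with x hx hxΩ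
    rw [← htψ, hx, huu₀ hxΩ]
  refine ⟨u, v, hψu, (memLp_congr_ae hψu).1 (Lp.memLp ψ), (memLp_congr_ae h₁).1 (Lp.memLp t.2.1),
    fun x hx => ⟨(hasDerivAt_primitive hΩ hoc hx₀ hvc hx).const_add c₀, ?_⟩⟩
  have := hvd x hx
  rwa [← huu₀ hx] at this

/-- A linear second order equation has only the trivial solution with vanishing Cauchy data. -/
theorem SolvesODE.eq_zero {Ω : Set ℝ} (hΩ : IsOpen Ω) (hoc : OrdConnected Ω) {Q u v : ℝ → ℂ}
    (hQ : Continuous Q) (h : SolvesODE Ω Q u v) {x₀ : ℝ} (hx₀ : x₀ ∈ Ω) (hu : u x₀ = 0)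
    (hv : v x₀ = 0) : ∀ x ∈ Ω, u x = 0 := by
  intro x hx
  obtain ⟨a, b, ha, hb, hx₀', hx'⟩ := exists_Ioo_supset hΩ hx₀ (isCompact_singleton (x := x))
    (singleton_subset_iff.2 hx)
  have habΩ : Icc a b ⊆ Ω := hoc.out ha hb
  obtain ⟨M, hM⟩ := (isCompact_Icc (a := a) (b := b)).exists_bound_of_continuousOn hQ.continuousOn
  have hM0 : 0 ≤ M := (norm_nonneg _).trans (hM x₀ (Ioo_subset_Icc_self hx₀'))
  have key := ODE_solution_unique_of_mem_Ioo (E := ℂ × ℂ) (a := a) (b := b) (t₀ := x₀)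
    (v := fun t p => (p.2, Q t * p.1)) (s := fun _ => univ) (K := 1 + M.toNNReal)
    (f := fun t => (u t, v t)) (g := fun _ => 0) ?_ hx₀' ?_ ?_ ?_
  · exact (Prod.ext_iff.1 (key (hx' rfl))).1
  · intro t ht
    refine LipschitzWith.lipschitzOnWith (LipschitzWith.of_dist_le_mul fun p p' => ?_)
    rw [dist_eq_norm, dist_eq_norm, NNReal.coe_add, NNReal.coe_one, Real.coe_toNNReal _ hM0,
      Prod.norm_def (Prod.mk _ _ - _)]
    have h1 := norm_fst_le (p - p')
    have h2 := norm_snd_le (p - p')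
    have h3 := norm_nonneg (p - p')
    refine max_le ?_ ?_
    · change ‖p.2 - p'.2‖ ≤ _
      rw [← Prod.snd_sub]
      nlinarith
    · change ‖Q t * p.1 - Q t * p'.1‖ ≤ _
      rw [← mul_sub, ← Prod.fst_sub, norm_mul]
      have h4 := mul_le_mul (hM t (Ioo_subset_Icc_self ht)) h1 (norm_nonneg _) hM0
      linarith
  · intro t ht
    have := h t (habΩ (Ioo_subset_Icc_self ht))
    exact ⟨this.1.prodMk this.2, mem_univ _⟩
  · intro t _
    refine ⟨?_, mem_univ _⟩
    simpa [← Prod.zero_eq_mk] using hasDerivAt_const t (0 : ℂ × ℂ)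
  · simp [hu, hv]

/-- Square integrable solutions with square integrable derivative on an interval of infinite length
are unique up to a factor, because the Wronskian is constant and integrable. -/
theorem SolvesODE.exists_smul {Ω : Set ℝ} (hΩ : IsOpen Ω) (hoc : OrdConnected Ω)
    (hvol : volume Ω = ⊤) {Q u₁ v₁ u₂ v₂ : ℝ → ℂ} (hQ : Continuous Q)
    (h₁ : SolvesODE Ω Q u₁ v₁) (h₂ : SolvesODE Ω Q u₂ v₂)
    (hu₁ : MemLp u₁ 2 (volume.restrict Ω)) (hv₁ : MemLp v₁ 2 (volume.restrict Ω))
    (hu₂ : MemLp u₂ 2 (volume.restrict Ω)) (hv₂ : MemLp v₂ 2 (volume.restrict Ω))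
    {x₀ : ℝ} (hx₀ : x₀ ∈ Ω) (hne : u₁ x₀ ≠ 0) : ∃ k : ℂ, ∀ x ∈ Ω, u₂ x = k * u₁ x := by
  set W : ℝ → ℂ := fun x => u₁ x * v₂ x - v₁ x * u₂ x with hW
  have hWd : ∀ x ∈ Ω, HasDerivAt W 0 x := by
    intro x hx
    refine (((h₁ x hx).1.mul (h₂ x hx).2).sub ((h₁ x hx).2.mul (h₂ x hx).1)).congr_deriv ?_
    ring
  have hWc : ∀ x ∈ Ω, W x = W x₀ := fun x hx => by
    by_contra hne'
    obtain ⟨a, b, ha, hb, hx₀', hx'⟩ := exists_Ioo_supset hΩ hx₀ (isCompact_singleton (x := x))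
      (singleton_subset_iff.2 hx)
    have hd : ∀ y ∈ Icc a b, HasDerivWithinAt W 0 (Icc a b) y := fun y hy =>
      (hWd y (hoc.out ha hb hy)).hasDerivWithinAt
    have := (convex_Icc a b).norm_image_sub_le_of_norm_hasDerivWithin_le hd (C := 0)
      (fun y _ => by simp) (Ioo_subset_Icc_self hx₀') (Ioo_subset_Icc_self (hx' rfl))
    rw [zero_mul, norm_le_zero_iff, sub_eq_zero] at this
    exact hne' this
  have hWi : IntegrableOn W Ω := (hu₁.integrable_mul hv₂).sub (hv₁.integrable_mul hu₂)
  have hW0 : W x₀ = 0 := by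
    have h := hWi.congr_fun hWc hΩ.measurableSet
    rw [integrableOn_const_iff] at h
    rcases h with h | h
    · exact enorm_eq_zero.1 h
    · exact absurd hvol h.ne
  set k := u₂ x₀ / u₁ x₀ with hk
  have hu0 : u₂ x₀ - k * u₁ x₀ = 0 := by rw [hk, div_mul_cancel₀ _ hne, sub_self]
  have hv0 : v₂ x₀ - k * v₁ x₀ = 0 := by
    refine mul_left_cancel₀ hne ?_
    rw [mul_zero, ← hW0, hW, hk]
    field_simp
  refine ⟨k, fun x hx => sub_eq_zero.1 ?_⟩
  refine SolvesODE.eq_zero hΩ hoc hQ (u := fun x => u₂ x - k * u₁ x)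
    (v := fun x => v₂ x - k * v₁ x) (fun y hy => ⟨?_, ?_⟩) hx₀ hu0 hv0 x hx
  · exact (h₂ y hy).1.sub ((h₁ y hy).1.const_mul k)
  · refine ((h₂ y hy).2.sub ((h₁ y hy).2.const_mul k)).congr_deriv ?_
    ring

/-- The eigenvalues of the operator on an interval of infinite length are simple. -/
theorem eigenvector_unique {Ω : Set ℝ} (hΩ : IsOpen Ω) (hoc : OrdConnected Ω)
    (hvol : volume Ω = ⊤) {c : ℝ} (hc : 0 < c) {q : C(ℝ, ℝ)} {w : ℝ → ℝ} {z : ℂ} {ψ χ : L2 Ω}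
    (hψ : (ψ, z • ψ) ∈ operatorGraph Ω 1 c q w) (hχ : (χ, z • χ) ∈ operatorGraph Ω 1 c q w)
    (hψ0 : ψ ≠ 0) : ∃ k : ℂ, χ = k • ψ := by
  have hne : Ω.Nonempty := by
    rw [nonempty_iff_ne_empty]
    rintro rfl
    simp at hvol
  obtain ⟨u₁, v₁, e₁, hu₁, hv₁, h₁⟩ := exists_solvesODE hΩ hoc hne hc hψ
  obtain ⟨u₂, v₂, e₂, hu₂, hv₂, h₂⟩ := exists_solvesODE hΩ hoc hne hc hχ
  have hex : ∃ x₀ ∈ Ω, u₁ x₀ ≠ 0 := by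
    by_contra! hall
    refine hψ0 (Lp.ext ?_)
    filter_upwards [e₁, ae_restrict_mem hΩ.measurableSet,
      Lp.coeFn_zero ℂ 2 (volume.restrict Ω)] with x hx hxΩ h0
    rw [hx, hall x hxΩ, h0, Pi.zero_apply]
  obtain ⟨x₀, hx₀, hne'⟩ := hex
  obtain ⟨k, hk⟩ := h₁.exists_smul hΩ hoc hvol (by fun_prop) h₂ hu₁ hv₁ hu₂ hv₂ hx₀ hne'
  refine ⟨k, Lp.ext ?_⟩
  filter_upwards [e₁, e₂, ae_restrict_mem hΩ.measurableSet, Lp.coeFn_smul k ψ] with x h1 h2 hxΩ h3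
  rw [h2, hk x hxΩ, h3, Pi.smul_apply, h1, smul_eq_mul]

/-! ### Eigenvalue sequences -/

/-- An infinite set of real numbers that is finite below every bound is the range of an increasing
sequence. -/
theorem exists_strictMono_range_eq {S : Set ℝ} (hinf : S.Infinite)
    (hfin : ∀ M : ℝ, {s ∈ S | s ≤ M}.Finite) :
    ∃ f : ℕ → ℝ, StrictMono f ∧ range f = S ∧ Tendsto f atTop atTop := by
  classical
  let : LocallyFiniteOrder S := LocallyFiniteOrder.ofFiniteIcc fun a b => by
    refine Set.Finite.of_finite_image ?_ Subtype.val_injective.injOn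
    refine (hfin b).subset ?_
    rintro _ ⟨x, hx, rfl⟩
    exact ⟨x.2, hx.2⟩
  obtain ⟨s₀, hs₀⟩ := hinf.nonempty
  obtain ⟨m, hm, hmin⟩ := Set.exists_min_image {s ∈ S | s ≤ s₀} id (hfin s₀) ⟨s₀, hs₀, le_rfl⟩
  let : OrderBot S :=
    { bot := ⟨m, hm.1⟩
      bot_le := fun x => by
        rcases le_total (x : ℝ) s₀ with h | h
        · exact hmin x ⟨x.2, h⟩
        · exact hm.2.trans h }
  have : NoMaxOrder S := ⟨fun x => by
    by_contra! h
    exact hinf ((hfin x).subset fun y hy => ⟨hy, h ⟨y, hy⟩⟩)⟩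
  let := LinearLocallyFiniteOrder.succOrder S
  let := LinearLocallyFiniteOrder.predOrder S
  let e : S ≃o ℕ := orderIsoNatOfLinearSuccPredArch
  have hmono : StrictMono fun n => (e.symm n : ℝ) := fun m n h => e.symm.strictMono h
  have hrange : range (fun n => (e.symm n : ℝ)) = S := by
    ext x
    constructor
    · rintro ⟨n, rfl⟩
      exact (e.symm n).2
    · intro hx
      exact ⟨e ⟨x, hx⟩, by simp⟩
  refine ⟨fun n => e.symm n, hmono, hrange, ?_⟩
  refine tendsto_atTop_atTop_of_monotone hmono.monotone fun M => ?_
  by_contra! h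
  refine hinf ((hfin M).subset fun x hx => ⟨hx, ?_⟩)
  rw [← hrange] at hx
  obtain ⟨n, rfl⟩ := hx
  exact (h n).le

section Compact

variable {E : Type} [NormedAddCommGroup E] [InnerProductSpace ℂ E] [CompleteSpace E]

theorem inner_eq_zero_of_eigenvectors {R : E →L[ℂ] E} (hsym : (R : E →ₗ[ℂ] E).IsSymmetric)
    {s t : ℝ} (hst : s ≠ t) {x y : E} (hx : R x = (s : ℂ) • x) (hy : R y = (t : ℂ) • y) :
    inner ℂ x y = 0 := by
  have h : inner ℂ (R x) y = inner ℂ x (R y) := hsym x y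
  rw [hx, hy, inner_smul_left, inner_smul_right, Complex.conj_ofReal] at h
  have h2 : ((s : ℂ) - t) * inner ℂ x y = 0 := by rw [sub_mul, h, sub_self]
  refine (mul_eq_zero.1 h2).resolve_left ?_
  intro h0
  exact hst (Complex.ofReal_injective (sub_eq_zero.1 h0))

/-- The inverse eigenvalues of a compact operator do not accumulate: the images of unit
eigenvectors would be a separated sequence in a compact set. -/
theorem finite_inv_eigenvalues {R : E →L[ℂ] E} (hR : IsCompactOperator R)
    (hsym : (R : E →ₗ[ℂ] E).IsSymmetric) (M : ℝ) :
    {s : ℝ | 0 < s ∧ s ≤ M ∧ ∃ x : E, x ≠ 0 ∧ R x = ((s⁻¹ : ℝ) : ℂ) • x}.Finite := by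
  by_contra hinf
  have hinf' : Set.Infinite _ := hinf
  set s : ℕ → ℝ := fun n => hinf'.natEmbedding _ n with hs
  have hsinj : Function.Injective s := Subtype.val_injective.comp (hinf'.natEmbedding _).injective
  have hsmem : ∀ n, 0 < s n ∧ s n ≤ M ∧ ∃ x : E, x ≠ 0 ∧ R x = (((s n)⁻¹ : ℝ) : ℂ) • x :=
    fun n => (hinf'.natEmbedding _ n).2
  choose hs0 hsM x hx0 hx using hsmem
  have hM : 0 < M := (hs0 0).trans_le (hsM 0)
  set e : ℕ → E := fun n => ((‖x n‖⁻¹ : ℝ) : ℂ) • x n with he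
  have he1 : ∀ n, ‖e n‖ = 1 := fun n => by
    rw [he, norm_smul, Complex.norm_real, norm_inv, norm_norm,
      inv_mul_cancel₀ (norm_ne_zero_iff.2 (hx0 n))]
  have heR : ∀ n, R (e n) = (((s n)⁻¹ : ℝ) : ℂ) • e n := fun n => by
    rw [he, map_smul, hx n, smul_comm]
  -- The images are orthogonal and of norm at least `M⁻¹`.
  have hsep : ∀ m n, m ≠ n → M⁻¹ ≤ dist (R (e m)) (R (e n)) := by
    intro m n hmn
    have horth : inner ℂ (R (e m)) (R (e n)) = 0 := by
      have h1 : (s m)⁻¹ ≠ (s n)⁻¹ := fun h => hmn (hsinj (inv_injective h))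
      rw [heR, heR, inner_smul_left, inner_smul_right,
        inner_eq_zero_of_eigenvectors hsym h1 (heR m) (heR n), mul_zero, mul_zero]
    have h2 := norm_sub_sq (𝕜 := ℂ) (R (e m)) (R (e n))
    rw [horth] at h2
    have h3 : M⁻¹ ≤ ‖R (e m)‖ := by
      rw [heR, norm_smul, he1, mul_one, Complex.norm_real, Real.norm_of_nonneg (inv_nonneg.2 (hs0 m).le)]
      exact inv_anti₀ (hs0 m) (hsM m)
    rw [dist_eq_norm]
    refine h3.trans (abs_le_of_sq_le_sq' ?_ (norm_nonneg _)).2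
    rw [h2]
    simp only [map_zero, mul_zero, sub_zero]
    nlinarith [sq_nonneg ‖R (e n)‖]
  obtain ⟨K, hK, hKsub⟩ := IsCompactOperator.image_closedBall_subset_compact
    (f := (R : E →ₗ[ℂ] E)) hR 1
  have hmem : ∀ n, R (e n) ∈ K := fun n => hKsub ⟨e n, by simp [he1 n], rfl⟩
  obtain ⟨a, -, φ, hφ, hlim⟩ := hK.tendsto_subseq hmem
  have hcau := hlim.cauchySeq
  obtain ⟨N, hN⟩ := Metric.cauchySeq_iff.1 hcau M⁻¹ (inv_pos.2 hM)
  have h1 := hN N le_rfl (N + 1) (Nat.le_succ N)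
  exact absurd h1 (not_lt.2 (hsep _ _ (hφ (Nat.lt_succ_self N)).ne))

/-- A compact positive injective operator with simple eigenvalues on a Hilbert space of infinite
dimension has a Hilbert basis of eigenvectors that is ordered by the inverse eigenvalues. -/
theorem exists_hilbertBasis_of_compact {R : E →L[ℂ] E} (hR : IsCompactOperator R)
    (hsym : (R : E →ₗ[ℂ] E).IsSymmetric) (hinj : ∀ x, R x = 0 → x = 0)
    (hpos : ∀ x, 0 ≤ (inner ℂ (R x) x).re)
    (hsimple : ∀ (s : ℝ) (x y : E), 0 < s → R x = ((s⁻¹ : ℝ) : ℂ) • x →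
      R y = ((s⁻¹ : ℝ) : ℂ) • y → x ≠ 0 → ∃ k : ℂ, y = k • x)
    (hdim : ¬FiniteDimensional ℂ E) :
    ∃ (f : ℕ → ℝ) (b : HilbertBasis ℕ ℂ E), StrictMono f ∧ Tendsto f atTop atTop ∧ 0 < f 0 ∧
      ∀ n, R (b n) = (((f n)⁻¹ : ℝ) : ℂ) • b n := by
  set S : Set ℝ := {s | 0 < s ∧ ∃ x : E, x ≠ 0 ∧ R x = ((s⁻¹ : ℝ) : ℂ) • x} with hS
  have hfin : ∀ M : ℝ, {s ∈ S | s ≤ M}.Finite := fun M =>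
    (finite_inv_eigenvalues hR hsym M).subset fun s hs => ⟨hs.1.1, hs.2, hs.1.2⟩
  have heig : ∀ (ν : ℂ) (x : E), x ≠ 0 → R x = ν • x → ∃ s ∈ S, ν = ((s⁻¹ : ℝ) : ℂ) := by
    intro ν x hx hνx
    have hmem : Module.End.HasEigenvalue (R : Module.End ℂ E) ν :=
      Module.End.hasEigenvalue_of_hasEigenvector ⟨Module.End.mem_eigenspace_iff.2 hνx, hx⟩
    obtain ⟨r, hr⟩ := Complex.conj_eq_iff_real.1 (hsym.conj_eigenvalue_eq_self hmem)
    have hr0 : r ≠ 0 := by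
      rintro rfl
      rw [hr, Complex.ofReal_zero, zero_smul] at hνx
      exact hx (hinj x hνx)
    have h1 := hpos x
    rw [hνx, hr, inner_smul_left, Complex.conj_ofReal, inner_self_eq_norm_sq_to_K,
      Complex.re_ofReal_mul] at h1
    have h2 : ((‖x‖ : ℂ) ^ 2).re = ‖x‖ ^ 2 := by
      rw [← Complex.ofReal_pow, Complex.ofReal_re]
    have h3 : 0 ≤ r * ‖x‖ ^ 2 := by rw [← h2]; exact h1
    have hrpos : 0 < r := lt_of_le_of_ne
      (nonneg_of_mul_nonneg_left h3 (by positivity)) hr0.symm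
    refine ⟨r⁻¹, ⟨inv_pos.2 hrpos, x, hx, ?_⟩, ?_⟩
    · rw [inv_inv, hνx, hr]
    · rw [inv_inv, hr]
  -- Orthogonality to one eigenvector for every element of `S` implies vanishing.
  have horth : ∀ (e : S → E), (∀ s, e s ≠ 0 ∧ R (e s) = (((s : ℝ)⁻¹ : ℝ) : ℂ) • e s) →
      (Submodule.span ℂ (range e))ᗮ = ⊥ := by
    intro e he
    rw [eq_bot_iff, ← R.orthogonalComplement_iSup_eigenspaces_eq_bot hR hsym]
    refine Submodule.orthogonal_le (iSup_le fun ν x hx => ?_)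
    rw [Module.End.mem_eigenspace_iff] at hx
    by_cases hx0 : x = 0
    · rw [hx0]
      exact zero_mem _
    · obtain ⟨s, hs, rfl⟩ := heig ν x hx0 hx
      obtain ⟨k, rfl⟩ := hsimple s _ x hs.1 (he ⟨s, hs⟩).2 hx (he ⟨s, hs⟩).1
      exact Submodule.smul_mem _ _ (Submodule.subset_span ⟨⟨s, hs⟩, rfl⟩)
  have hinf : S.Infinite := by
    intro hSfin
    have hex : ∀ s : S, ∃ x : E, x ≠ 0 ∧ R x = (((s : ℝ)⁻¹ : ℝ) : ℂ) • x := fun s => s.2.2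
    choose e he using hex
    have h1 := horth e he
    have := hSfin.to_subtype
    have : FiniteDimensional ℂ (Submodule.span ℂ (range e)) :=
      FiniteDimensional.span_of_finite ℂ (finite_range e)
    rw [Submodule.orthogonal_eq_bot_iff] at h1
    apply hdim
    rw [h1] at this
    exact Module.finite_def.2 (Module.Finite.iff_fg.1 this)
  obtain ⟨f, hf, hfS, hftop⟩ := exists_strictMono_range_eq hinf hfin
  have hmem : ∀ n, f n ∈ S := fun n => hfS ▸ mem_range_self n
  choose hf0 x hx0 hx using hmem
  set e : ℕ → E := fun n => ((‖x n‖⁻¹ : ℝ) : ℂ) • x n with he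
  have he1 : ∀ n, ‖e n‖ = 1 := fun n => by
    rw [he, norm_smul, Complex.norm_real, norm_inv, norm_norm,
      inv_mul_cancel₀ (norm_ne_zero_iff.2 (hx0 n))]
  have heR : ∀ n, R (e n) = (((f n)⁻¹ : ℝ) : ℂ) • e n := fun n => by
    rw [he, map_smul, hx n, smul_comm]
  have hortho : Orthonormal ℂ e := ⟨he1, fun m n hmn => inner_eq_zero_of_eigenvectors hsym
    (fun h => hmn (hf.injective (inv_injective h))) (heR m) (heR n)⟩
  have hbot : (Submodule.span ℂ (range e))ᗮ = ⊥ := by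
    have hn : ∀ s : S, ∃ n, f n = s := fun s => (Set.ext_iff.1 hfS s).2 s.2
    choose g hg using hn
    refine eq_bot_iff.2 ((Submodule.orthogonal_le (Submodule.span_mono ?_)).trans
      (horth (fun s => e (g s)) fun s => ⟨?_, ?_⟩).le)
    · rintro _ ⟨s, rfl⟩
      exact mem_range_self _
    · exact hortho.ne_zero _
    · rw [heR, hg]
  refine ⟨f, HilbertBasis.mkOfOrthogonalEqBot hortho hbot, hf, hftop, hf0 0, fun n => ?_⟩
  rw [HilbertBasis.coe_mkOfOrthogonalEqBot]
  exact heR n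

end Compact

/-! ### The spectrum of the operators on the line -/

theorem not_finiteDimensional_L2 {Ω : Set ℝ} (hΩ : IsOpen Ω) (hoc : OrdConnected Ω)
    (hne : Ω.Nonempty) : ¬FiniteDimensional ℂ (L2 Ω) := by
  intro hfin
  obtain ⟨x₀, hx₀⟩ := hne
  obtain ⟨a, b, ha, hb, hx₀', -⟩ := exists_Ioo_supset hΩ hx₀ (K := ∅) isCompact_empty (empty_subset _)
  have hab : 0 < b - a := sub_pos.2 (hx₀'.1.trans hx₀'.2)
  -- The indicator functions of disjoint intervals are linearly independent.
  set p : ℕ → ℝ := fun n => a + (b - a) / (n + 1) with hp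
  have hanti : StrictAnti p := strictAnti_nat_of_succ_lt fun n => by
    simp only [hp]
    push_cast
    gcongr
    linarith
  have hsub : ∀ n, Ioc (p (n + 1)) (p n) ⊆ Ω := by
    intro n x hx
    refine hoc.out ha hb ⟨?_, ?_⟩
    · refine le_trans ?_ hx.1.le
      simp only [hp]
      have : 0 ≤ (b - a) / ((n + 1 : ℕ) + 1) := by positivity
      linarith
    · refine hx.2.trans ((hanti.antitone (Nat.zero_le n)).trans ?_)
      simp [hp]
  set e : ℕ → L2 Ω := fun n => cell Ω (p (n + 1)) (p n) with he
  have hinner : ∀ m n, inner ℂ (e m) (e n) =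
      (((volume.restrict Ω).real (Ioc (p (m + 1)) (p m) ∩ Ioc (p (n + 1)) (p n)) : ℝ) : ℂ) := by
    intro m n
    exact L2.inner_indicatorConstLp_one_indicatorConstLp_one (𝕜 := ℂ) measurableSet_Ioc
      measurableSet_Ioc (volume_restrict_Ioc_ne_top Ω _ _) (volume_restrict_Ioc_ne_top Ω _ _)
  have hli : LinearIndependent ℂ e := by
    refine linearIndependent_of_ne_zero_of_inner_eq_zero (fun n h0 => ?_) fun m n hmn => ?_
    · have h1 := hinner n n
      rw [h0, inner_zero_left, inter_self, measureReal_restrict_apply measurableSet_Ioc,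
        inter_eq_left.2 (hsub n), Real.volume_real_Ioc_of_le (hanti n.lt_succ_self).le] at h1
      have h2 : p n - p (n + 1) = 0 := by exact_mod_cast h1.symm
      linarith [hanti n.lt_succ_self]
    · have hd := hanti.antitone.pairwise_disjoint_on_Ioc_succ hmn
      have hd' : Ioc (p (m + 1)) (p m) ∩ Ioc (p (n + 1)) (p n) = ∅ := hd.inter_eq
      change inner ℂ (e m) (e n) = 0
      rw [hinner, hd']
      simp
  exact not_finite_iff_infinite.2 (inferInstance : Infinite ℕ) hli.finite

theorem resolvent_inner_self (Ω : Set ℝ) (w : ℝ → ℝ) (c β κ : ℝ) (g : L2 Ω) :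
    0 ≤ (inner ℂ (resolvent Ω 1 w c β κ g) g).re := by
  rw [resolvent, ContinuousLinearMap.comp_apply, ← ContinuousLinearMap.adjoint_inner_right]
  exact inner_self_nonneg (𝕜 := ℂ)
    (x := ContinuousLinearMap.adjoint (energyEmbedding Ω 1 w c β κ) g)

/-- The eigenvalue `s⁻¹` of the resolvent corresponds to the eigenvalue `s - (1 + β κ²)`. -/
theorem mem_graph_iff_resolvent_smul {Ω : Set ℝ} (hΩ : IsOpen Ω) {c β κ : ℝ} (hc : 0 < c)
    (hβ : 0 < β) {q : C(ℝ, ℝ)} (hq : ∀ x, q x = β * (x ^ 2) ^ 2 - 2 * β * κ * x ^ 2) (ψ : L2 Ω)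
    {s : ℝ} (hs : 0 < s) :
    (ψ, ((s - (1 + β * κ ^ 2) : ℝ) : ℂ) • ψ) ∈ (diffOperator Ω 1 c q fun x => x ^ 2).graph ↔
      resolvent Ω 1 (fun x => x ^ 2) c β κ ψ = ((s⁻¹ : ℝ) : ℂ) • ψ := by
  have hs' : (s : ℂ) ≠ 0 := by exact_mod_cast hs.ne'
  rw [mem_graph_iff_resolvent hΩ (by fun_prop) hc hβ hq, ← add_smul, map_smul, Complex.ofReal_inv,
    eq_inv_smul_iff₀ hs']
  push_cast
  rw [sub_add_cancel]

/-- On an interval of infinite length, `- c ∂² + q` with `q` a quartic potential has a Hilbert basis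
of eigenvectors, and the eigenvalues are simple and tend to infinity. -/
theorem exists_eigenbasis {Ω : Set ℝ} (hΩ : IsOpen Ω) (hoc : OrdConnected Ω)
    (hvol : volume Ω = ⊤) {c β κ : ℝ} (hc : 0 < c) (hβ : 0 < β) {q : C(ℝ, ℝ)}
    (hq : ∀ x, q x = β * (x ^ 2) ^ 2 - 2 * β * κ * x ^ 2) :
    ∃ (mu : ℕ → ℝ) (b : HilbertBasis ℕ ℂ (L2 Ω)), StrictMono mu ∧ Tendsto mu atTop atTop ∧
      0 < mu 0 + (1 + β * κ ^ 2) ∧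
      ∀ n, (b n, (mu n : ℂ) • b n) ∈ (diffOperator Ω 1 c q fun x => x ^ 2).graph := by
  have hne : Ω.Nonempty := by
    rw [nonempty_iff_ne_empty]
    rintro rfl
    simp at hvol
  have hinj : ∀ x, resolvent Ω 1 (fun x => x ^ 2) c β κ x = 0 → x = 0 := by
    intro x hx
    have h : ((0 : L2 Ω), x) ∈ (diffOperator Ω 1 c q fun x => x ^ 2).graph := by
      rw [mem_graph_iff_resolvent hΩ (by fun_prop) hc hβ hq, smul_zero, add_zero, hx]
    exact LinearPMap.graph_fst_eq_zero_snd _ h rfl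
  have hsimple : ∀ (s : ℝ) (x y : L2 Ω), 0 < s →
      resolvent Ω 1 (fun x => x ^ 2) c β κ x = ((s⁻¹ : ℝ) : ℂ) • x →
      resolvent Ω 1 (fun x => x ^ 2) c β κ y = ((s⁻¹ : ℝ) : ℂ) • y → x ≠ 0 → ∃ k : ℂ, y = k • x := by
    intro s x y hs hx hy hx0
    have h1 := (mem_graph_iff_resolvent_smul hΩ hc hβ hq _ hs).2 hx
    have h2 := (mem_graph_iff_resolvent_smul hΩ hc hβ hq _ hs).2 hy
    rw [graph_diffOperator hΩ] at h1 h2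
    exact eigenvector_unique hΩ hoc hvol hc h1 h2 hx0
  obtain ⟨f, b, hf, hftop, hf0, hb⟩ := exists_hilbertBasis_of_compact
    (isCompactOperator_resolvent Ω c β κ) (resolvent_isSymmetric Ω 1 (fun x => x ^ 2) c β κ) hinj
    (resolvent_inner_self Ω _ c β κ) hsimple (not_finiteDimensional_L2 hΩ hoc hne)
  refine ⟨fun n => f n - (1 + β * κ ^ 2), b, fun m n h => sub_lt_sub_right (hf h) _,
    tendsto_atTop_add_const_right _ _ hftop, by simpa using hf0, fun n => ?_⟩
  exact (mem_graph_iff_resolvent_smul hΩ hc hβ hq _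
    (hf0.trans_le (hf.monotone (Nat.zero_le n)))).2 (hb n)

/-- The lowest eigenvalue bounds the energy form from below. -/
theorem lowest_eigenvalue_le {Ω : Set ℝ} (hΩ : IsOpen Ω) {c β κ : ℝ} (hc : 0 < c) (hβ : 0 < β)
    {q : C(ℝ, ℝ)} (hq : ∀ x, q x = β * (x ^ 2) ^ 2 - 2 * β * κ * x ^ 2) {mu : ℕ → ℝ}
    {b : HilbertBasis ℕ ℂ (L2 Ω)} (hmu : StrictMono mu) (hmu0 : 0 < mu 0 + (1 + β * κ ^ 2))
    (hb : ∀ n, (b n, (mu n : ℂ) • b n) ∈ (diffOperator Ω 1 c q fun x => x ^ 2).graph)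
    {t : L2 Ω × L2 Ω × L2 Ω} (ht : t ∈ energyTriples Ω 1 fun x => x ^ 2) :
    (mu 0 + (1 + β * κ ^ 2)) * ‖t.1‖ ^ 2 ≤
      ‖t.1‖ ^ 2 + c * ‖t.2.1‖ ^ 2 + β * ‖t.2.2 - (κ : ℂ) • t.1‖ ^ 2 := by
  set C : ℝ := 1 + β * κ ^ 2 with hC
  set R := resolvent Ω 1 (fun x => x ^ 2) c β κ with hR
  set J := energyEmbedding Ω 1 (fun x => x ^ 2) c β κ with hJ
  have hdiag := isDiagonal_diffOperator hΩ (by fun_prop) hc hβ hq hb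
  have hmuC : ∀ n, mu 0 + C ≤ mu n + C := fun n => by
    linarith [hmu.monotone (Nat.zero_le n)]
  have hcoef : ∀ g n, ((mu n + C : ℝ) : ℂ) * b.repr (R g) n = b.repr g n := by
    intro g n
    have h1 : (R g, g - (C : ℂ) • R g) ∈ (diffOperator Ω 1 c q fun x => x ^ 2).graph := by
      rw [mem_graph_iff_resolvent hΩ (by fun_prop) hc hβ hq, sub_add_cancel]
    have h2 := (hdiag _ _).1 h1 n
    rw [map_sub, map_smul, lp.coeFn_sub, Pi.sub_apply, lp.coeFn_smul, Pi.smul_apply,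
      smul_eq_mul] at h2
    push_cast
    linear_combination -h2
  have hRnorm : ‖R‖ ≤ (mu 0 + C)⁻¹ := by
    refine ContinuousLinearMap.opNorm_le_bound _ (inv_nonneg.2 hmu0.le) fun g => ?_
    have h1 : ‖b.repr (R g)‖ ≤ ‖(((mu 0 + C)⁻¹ : ℝ) : ℂ) • b.repr g‖ := by
      refine lp.norm_mono (by norm_num) fun n => ?_
      rw [lp.coeFn_smul, Pi.smul_apply, norm_smul, Complex.norm_real,
        Real.norm_of_nonneg (inv_nonneg.2 hmu0.le), ← hcoef g n, norm_mul, Complex.norm_real,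
        Real.norm_of_nonneg (hmu0.le.trans (hmuC n)), ← mul_assoc]
      refine le_mul_of_one_le_left (norm_nonneg _) ?_
      rw [inv_mul_eq_div, one_le_div hmu0]
      exact hmuC n
    rw [norm_smul, Complex.norm_real, Real.norm_of_nonneg (inv_nonneg.2 hmu0.le),
      LinearIsometryEquiv.norm_map, LinearIsometryEquiv.norm_map] at h1
    exact h1
  obtain ⟨v, rfl⟩ := exists_unscale_eq κ hc hβ t
  -- The best constant in the embedding is read off from `R = J J*`.
  have hJnorm : ‖J‖ * ‖J‖ = ‖R‖ := by
    have h1 := ContinuousLinearMap.norm_adjoint_comp_self (ContinuousLinearMap.adjoint J)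
    rw [ContinuousLinearMap.adjoint_adjoint, LinearIsometryEquiv.norm_map] at h1
    exact h1.symm
  have h1 : ‖(unscale Ω c β κ v).1‖ ≤ ‖J‖ * ‖v‖ := J.le_opNorm ⟨v, ht⟩
  have h2 : ‖v‖ ^ 2 = ‖(unscale Ω c β κ v).1‖ ^ 2 + c * ‖(unscale Ω c β κ v).2.1‖ ^ 2 +
      β * ‖(unscale Ω c β κ v).2.2 - (κ : ℂ) • (unscale Ω c β κ v).1‖ ^ 2 := by
    have h3 := inner_energyHilbert κ hc hβ v v
    have h4 : inner ℂ v v = ((‖v‖ ^ 2 : ℝ) : ℂ) := by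
      rw [inner_self_eq_norm_sq_to_K]
      push_cast
      rfl
    rw [energyInner_self, h4] at h3
    exact Complex.ofReal_injective h3
  rw [← h2]
  calc (mu 0 + C) * ‖(unscale Ω c β κ v).1‖ ^ 2
      ≤ (mu 0 + C) * (‖J‖ * ‖v‖) ^ 2 := by gcongr
    _ = (mu 0 + C) * (‖R‖ * ‖v‖ ^ 2) := by rw [← hJnorm]; ring
    _ ≤ (mu 0 + C) * ((mu 0 + C)⁻¹ * ‖v‖ ^ 2) := by gcongr
    _ = ‖v‖ ^ 2 := by rw [mul_inv_cancel_left₀ hmu0.ne']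

/-! ### The lowest eigenvalue and the critical mass parameter -/

/-- The kinetic energy plus the quartic part of the potential energy. -/
noncomputable def formEnergy {Ω : Set ℝ} (c β : ℝ) (t : L2 Ω × L2 Ω × L2 Ω) : ℝ :=
  c * ‖t.2.1‖ ^ 2 + β * ‖t.2.2‖ ^ 2

/-- The quadratic moment `∫ w |ψ|²` of the triple `(ψ, ∂ψ, w ψ)`. -/
noncomputable def formMoment {Ω : Set ℝ} (t : L2 Ω × L2 Ω × L2 Ω) : ℝ :=
  (inner ℂ t.2.2 t.1).re

theorem formEnergy_sub {Ω : Set ℝ} (c β κ : ℝ) (t : L2 Ω × L2 Ω × L2 Ω) :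
    ‖t.1‖ ^ 2 + c * ‖t.2.1‖ ^ 2 + β * ‖t.2.2 - (κ : ℂ) • t.1‖ ^ 2 =
      formEnergy c β t - 2 * β * κ * formMoment t + (1 + β * κ ^ 2) * ‖t.1‖ ^ 2 := by
  have h1 := norm_sub_sq (𝕜 := ℂ) t.2.2 ((κ : ℂ) • t.1)
  have h2 : RCLike.re (inner ℂ t.2.2 ((κ : ℂ) • t.1)) = κ * formMoment t := by
    rw [inner_smul_right]
    exact Complex.re_ofReal_mul _ _
  rw [h1, h2, norm_smul, mul_pow, Complex.norm_real, Real.norm_eq_abs, sq_abs, formEnergy]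
  ring

theorem formMoment_pos {Ω : Set ℝ} (hΩ : IsOpen Ω) {t : L2 Ω × L2 Ω × L2 Ω}
    (ht : t ∈ energyTriples Ω 1 fun x => x ^ 2) (h0 : t.1 ≠ 0) : 0 < formMoment t := by
  have hae := snd_snd_ae_eq hΩ (by fun_prop) ht
  have e1 : (fun x => inner ℂ (t.2.2 x) (t.1 x)) =ᵐ[volume.restrict Ω]
      fun x => ((x ^ 2 * ‖t.1 x‖ ^ 2 : ℝ) : ℂ) := by
    filter_upwards [hae] with x hx
    rw [hx, RCLike.inner_apply, map_mul, Complex.conj_ofReal, mul_left_comm, Complex.mul_conj,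
      Complex.normSq_eq_norm_sq, ← Complex.ofReal_mul]
  have e2 : formMoment t = ∫ x in Ω, x ^ 2 * ‖t.1 x‖ ^ 2 := by
    rw [formMoment, L2.inner_def, integral_congr_ae e1, integral_complex_ofReal, Complex.ofReal_re]
  have hint : Integrable (fun x => x ^ 2 * ‖t.1 x‖ ^ 2) (volume.restrict Ω) := by
    have h1 := ((L2.integrable_inner (𝕜 := ℂ) t.2.2 t.1).congr e1).re
    simpa only [RCLike.re_eq_complex_re, Complex.ofReal_re] using h1
  have hnn : 0 ≤ᵐ[volume.restrict Ω] fun x => x ^ 2 * ‖t.1 x‖ ^ 2 :=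
    Eventually.of_forall fun x => by positivity
  rw [e2]
  refine lt_of_le_of_ne (integral_nonneg_of_ae hnn) fun h => h0 ?_
  have h2 := (integral_eq_zero_iff_of_nonneg_ae hnn hint).1 h.symm
  refine Lp.ext ?_
  have hne : ∀ᵐ x ∂(volume.restrict Ω), x ≠ (0 : ℝ) :=
    ae_restrict_of_ae (Measure.ae_ne volume 0)
  filter_upwards [h2, hne, Lp.coeFn_zero ℂ 2 ((volume : Measure ℝ).restrict Ω)] with x hx hx0 hz
  rw [hz]
  simpa [hx0] using hx

/-- The Hilbert basis of eigenvectors together with the variational characterisation of the lowest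
eigenvalue. -/
theorem exists_eigenbasis_variational {Ω : Set ℝ} (hΩ : IsOpen Ω) (hoc : OrdConnected Ω)
    (hvol : volume Ω = ⊤) {c β κ : ℝ} (hc : 0 < c) (hβ : 0 < β) {q : C(ℝ, ℝ)}
    (hq : ∀ x, q x = β * (x ^ 2) ^ 2 - 2 * β * κ * x ^ 2) :
    ∃ (mu : ℕ → ℝ) (b : HilbertBasis ℕ ℂ (L2 Ω)), StrictMono mu ∧ Tendsto mu atTop atTop ∧
      (∀ n, (b n, (mu n : ℂ) • b n) ∈ (diffOperator Ω 1 c q fun x => x ^ 2).graph) ∧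
      (∀ t ∈ energyTriples Ω 1 fun x => x ^ 2,
        mu 0 * ‖t.1‖ ^ 2 ≤ formEnergy c β t - 2 * β * κ * formMoment t) ∧
      ∃ t ∈ energyTriples Ω 1 fun x => x ^ 2, ‖t.1‖ = 1 ∧
        mu 0 = formEnergy c β t - 2 * β * κ * formMoment t := by
  obtain ⟨mu, b, hmu, htop, hpos, hb⟩ := exists_eigenbasis hΩ hoc hvol hc hβ hq
  refine ⟨mu, b, hmu, htop, hb, fun t ht => ?_, ?_⟩
  · have h := lowest_eigenvalue_le hΩ hc hβ hq hmu hpos hb ht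
    rw [formEnergy_sub] at h
    linarith
  · have h := hb 0
    rw [graph_diffOperator hΩ, mem_operatorGraph_iff hΩ (by fun_prop) hq] at h
    obtain ⟨t, ht, htb, heq⟩ := h
    have h1 : ‖t.1‖ = 1 := by rw [htb]; exact b.orthonormal.1 0
    have h2 := heq t ht
    rw [energyInner_self, formEnergy_sub, ← htb, ← add_smul, inner_smul_right,
      inner_self_eq_norm_sq_to_K, h1] at h2
    refine ⟨t, ht, h1, ?_⟩
    have h3 := congrArg Complex.re h2
    rw [← Complex.ofReal_add, Complex.ofReal_re, Complex.re_ofReal_mul] at h3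
    simp at h3
    linarith

theorem exists_eigenbasis_tildeLine :
    ∃ (mu : ℕ → ℝ) (b : HilbertBasis ℕ ℂ (L2 halfLine)), StrictMono mu ∧
      Tendsto mu atTop atTop ∧ 0 < mu 0 ∧
      ∀ n, (b n, (mu n : ℂ) • b n) ∈ tildeLine.graph := by
  obtain ⟨mu, b, hmu, htop, hb, -, t, ht, h1, h2⟩ := exists_eigenbasis_variational
    (Ω := halfLine) (c := 1) (β := 1) (κ := 0) (q := ⟨fun r => -(-1) * r ^ 4, by fun_prop⟩)
    isOpen_Ioi ordConnected_Ioi Real.volume_Ioi one_pos one_pos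
    fun x => by simp only [ContinuousMap.coe_mk]; ring
  refine ⟨mu, b, hmu, htop, ?_, hb⟩
  have h3 : t.2.2 ≠ 0 := by
    intro h3
    have h4 := formMoment_pos isOpen_Ioi ht (norm_ne_zero_iff.1 (h1 ▸ one_ne_zero))
    rw [formMoment, h3, inner_zero_left] at h4
    exact lt_irrefl _ h4
  have h4 : 0 < ‖t.2.2‖ := norm_pos_iff.2 h3
  rw [h2, formEnergy]
  simp only [mul_zero, zero_mul, sub_zero, one_mul]
  positivity

/-- The lowest eigenvalue of `- c₁ ∂² + 2 α_M y⁴ - m y²` is a concave, strictly decreasing function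
of `m`, which is positive at `0` and eventually negative. Its zero is the critical parameter. -/
theorem exists_critical_mass {c₁ αM : ℝ} (hc₁ : 0 < c₁) (hαM : 0 < αM) :
    ∃ μ₀ : ℝ, 0 < μ₀ ∧
      (∀ m : ℝ, IsLeast {s : ℝ | (s : ℂ) ∈ eigenvalueSet (yangMillsLine c₁ αM m)} 0 ↔ m = μ₀) ∧
      ∀ m < μ₀, ∃ (mu : ℕ → ℝ) (b : HilbertBasis ℕ ℂ (L2 (univ : Set ℝ))), StrictMono mu ∧
        Tendsto mu atTop atTop ∧ 0 < mu 0 ∧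
        ∀ n, (b n, (mu n : ℂ) • b n) ∈ (yangMillsLine c₁ αM m).graph := by
  have hβ : 0 < 2 * αM := by positivity
  have hq : ∀ m x : ℝ, (⟨fun y => 2 * αM * y ^ 4 - m * y ^ 2, by fun_prop⟩ : C(ℝ, ℝ)) x =
      2 * αM * (x ^ 2) ^ 2 - 2 * (2 * αM) * (m / (4 * αM)) * x ^ 2 := by
    intro m x
    simp only [ContinuousMap.coe_mk]
    field_simp
    ring
  have hκ : ∀ m : ℝ, 2 * (2 * αM) * (m / (4 * αM)) = m := by
    intro m
    field_simp
    ring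
  have hex := fun m : ℝ => exists_eigenbasis_variational isOpen_univ ordConnected_univ
    Real.volume_univ hc₁ hβ (hq m)
  choose mu b hmu htop hb hle t ht h1 hmin using hex
  simp only [hκ] at hle hmin
  have hn : ∀ m, 0 < formMoment (t m) := fun m =>
    formMoment_pos isOpen_univ (ht m) (norm_ne_zero_iff.1 (h1 m ▸ one_ne_zero))
  -- The energy of the ground state for `m` bounds the lowest eigenvalue for `m'`.
  have hcomp : ∀ m m', mu m' 0 ≤ formEnergy c₁ (2 * αM) (t m) - m' * formMoment (t m) := by
    intro m m'
    have h := hle m' (t m) (ht m)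
    rwa [h1, one_pow, mul_one] at h
  set E : ℝ → ℝ := fun m => mu m 0 with hE
  have hanti : StrictAnti E := by
    intro m m' hm
    have h2 := hcomp m m'
    have h3 := hmin m
    have h4 := mul_lt_mul_of_pos_right hm (hn m)
    simp only [hE]
    linarith
  have hconc : ConcaveOn ℝ univ E := by
    refine ⟨convex_univ, fun m _ m' _ p r hp hr hpr => ?_⟩
    have h2 := mul_le_mul_of_nonneg_left (hcomp (p • m + r • m') m) hp
    have h3 := mul_le_mul_of_nonneg_left (hcomp (p • m + r • m') m') hr
    have h4 := hmin (p • m + r • m')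
    obtain rfl : r = 1 - p := by linarith
    simp only [hE, smul_eq_mul] at *
    linarith
  have hcont : Continuous E :=
    continuousOn_univ.1 (hconc.continuousOn isOpen_univ)
  have hE0 : 0 < E 0 := by
    have h2 := hmin 0
    have h3 : (t 0).2.2 ≠ 0 := by
      intro h3
      have h4 := hn 0
      rw [formMoment, h3, inner_zero_left] at h4
      exact lt_irrefl _ h4
    have h4 : 0 < ‖(t 0).2.2‖ := norm_pos_iff.2 h3
    simp only [hE]
    rw [h2, formEnergy, zero_mul, sub_zero]
    positivity
  set M : ℝ := formEnergy c₁ (2 * αM) (t 0) / formMoment (t 0) with hM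
  have hEM : E M ≤ 0 := by
    have h2 := hcomp 0 M
    rwa [hM, div_mul_cancel₀ _ (hn 0).ne', sub_self] at h2
  have hM0 : 0 ≤ M := by
    by_contra! h
    exact absurd (hanti h) (not_lt.2 (hEM.trans hE0.le))
  obtain ⟨μ₀, hμ₀, hEμ₀⟩ := intermediate_value_Icc' hM0 hcont.continuousOn ⟨hEM, hE0.le⟩
  refine ⟨μ₀, lt_of_le_of_ne hμ₀.1 ?_, fun m => ?_, fun m hm => ?_⟩
  · rintro rfl
    exact hE0.ne' hEμ₀
  · have hdiag : IsDiagonal (b m) (mu m) (yangMillsLine c₁ αM m) :=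
      isDiagonal_diffOperator isOpen_univ (by fun_prop) hc₁ hβ (hq m) (hb m)
    have hset : {s : ℝ | (s : ℂ) ∈ eigenvalueSet (yangMillsLine c₁ αM m)} = range (mu m) := by
      ext s
      rw [mem_ofPred_eq, hdiag.eigenvalueSet_eq]
      simp
    have hleast : IsLeast (range (mu m)) (E m) :=
      ⟨mem_range_self 0, by rintro _ ⟨n, rfl⟩; exact (hmu m).monotone (Nat.zero_le n)⟩
    rw [hset]
    constructor
    · intro h
      exact hanti.injective ((hleast.unique h).trans hEμ₀.symm)
    · rintro rfl
      exact hEμ₀ ▸ hleast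
  · exact ⟨mu m, b m, hmu m, htop m, hEμ₀ ▸ hanti hm, hb m⟩

/-! ### Products of square integrable functions -/

section Product

variable {α β : Type} [MeasurableSpace α] [MeasurableSpace β] {μ : Measure α} {ν : Measure β}

theorem memLp_mul_prod {f : α → ℂ} {g : β → ℂ} (hf : MemLp f 2 μ) (hg : MemLp g 2 ν) :
    MemLp (fun p : α × β => f p.1 * g p.2) 2 (μ.prod ν) := by
  have hm : AEStronglyMeasurable (fun p : α × β => f p.1 * g p.2) (μ.prod ν) :=
    hf.1.comp_fst.mul hg.1.comp_snd
  rw [memLp_two_iff_integrable_sq_norm hm]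
  have h := ((memLp_two_iff_integrable_sq_norm hf.1).1 hf).mul_prod
    ((memLp_two_iff_integrable_sq_norm hg.1).1 hg)
  simpa only [norm_mul, mul_pow] using h

/-- Fubini's theorem: a square integrable function that is orthogonal to all products of elements
of two Hilbert bases vanishes, because almost all of its slices do. -/
theorem ae_eq_zero_of_orthogonal_products [SFinite μ] [SFinite ν] (b₁ : HilbertBasis ℕ ℂ (Lp ℂ 2 μ))
    (b₂ : HilbertBasis ℕ ℂ (Lp ℂ 2 ν)) {f : α × β → ℂ} (hf : MemLp f 2 (μ.prod ν))
    (h : ∀ i j, ∫ p, star (b₁ i p.1) * (star (b₂ j p.2) * f p) ∂(μ.prod ν) = 0) :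
    f =ᵐ[μ.prod ν] 0 := by
  have hfint := (memLp_two_iff_integrable_sq_norm hf.1).1 hf
  have hslice : ∀ᵐ x ∂μ, MemLp (fun y => f (x, y)) 2 ν := by
    filter_upwards [hf.1.prodMk_left, hfint.prod_right_ae] with x h1 h2
    exact (memLp_two_iff_integrable_sq_norm h1).2 h2
  have hinner : ∀ (j : ℕ) (x : α) (hx : MemLp (fun y => f (x, y)) 2 ν),
      ∫ y, star (b₂ j y) * f (x, y) ∂ν = inner ℂ (b₂ j) hx.toLp := by
    intro j x hx
    rw [L2.inner_def]
    refine integral_congr_ae ?_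
    filter_upwards [hx.coeFn_toLp] with y hy
    rw [hy, RCLike.inner_apply, mul_comm]
    rfl
  have hG : ∀ j, MemLp (fun x => ∫ y, star (b₂ j y) * f (x, y) ∂ν) 2 μ := by
    intro j
    have hm : AEStronglyMeasurable (fun x => ∫ y, star (b₂ j y) * f (x, y) ∂ν) μ :=
      AEStronglyMeasurable.integral_prod_right'
        (f := fun p : α × β => star (b₂ j p.2) * f p)
        ((Lp.memLp (b₂ j)).star.1.comp_snd.mul hf.1)
    rw [memLp_two_iff_integrable_sq_norm hm]
    refine hfint.integral_prod_left.mono' (hm.norm.pow 2) ?_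
    filter_upwards [hslice] with x hx
    rw [hinner j x hx, Real.norm_of_nonneg (by positivity)]
    have h1 : ‖inner ℂ (b₂ j) hx.toLp‖ ≤ ‖hx.toLp‖ := by
      refine (norm_inner_le_norm _ _).trans ?_
      rw [b₂.orthonormal.1 j, one_mul]
    have h2 : ‖hx.toLp‖ ^ 2 = ∫ y, ‖f (x, y)‖ ^ 2 ∂ν := by
      rw [norm_sq_eq_integral]
      refine integral_congr_ae ?_
      filter_upwards [hx.coeFn_toLp] with y hy
      rw [hy]
    rw [← h2]
    gcongr
  have hG0 : ∀ j, (hG j).toLp = 0 := by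
    intro j
    refine b₁.ext_repr fun i => ?_
    rw [map_zero, lp.coeFn_zero, Pi.zero_apply, b₁.repr_apply_apply, ← h i j, L2.inner_def,
      integral_prod]
    · refine integral_congr_ae ?_
      filter_upwards [(hG j).coeFn_toLp] with x hx
      rw [hx, integral_const_mul, RCLike.inner_apply, mul_comm]
      rfl
    · have h1 := (memLp_mul_prod (Lp.memLp (b₁ i)).star (Lp.memLp (b₂ j)).star).integrable_mul hf
      refine h1.congr (Eventually.of_forall fun p => ?_)
      simp [mul_assoc]
  have hzero : ∀ᵐ x ∂μ, ∀ j, ∫ y, star (b₂ j y) * f (x, y) ∂ν = 0 := by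
    rw [ae_all_iff]
    intro j
    have h1 := (hG j).coeFn_toLp
    rw [hG0 j] at h1
    filter_upwards [h1, Lp.coeFn_zero ℂ 2 μ] with x hx hx0
    rw [← hx, hx0, Pi.zero_apply]
  have hint : ∀ᵐ x ∂μ, ∫ y, ‖f (x, y)‖ ^ 2 ∂ν = 0 := by
    filter_upwards [hslice, hzero] with x hx h0
    have h1 : hx.toLp = 0 := b₂.ext_repr fun j => by
      rw [map_zero, lp.coeFn_zero, Pi.zero_apply, b₂.repr_apply_apply, ← hinner j x hx, h0 j]
    have h2 := hx.coeFn_toLp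
    rw [h1] at h2
    refine integral_eq_zero_of_ae ?_
    filter_upwards [h2, Lp.coeFn_zero ℂ 2 ν] with y hy hy0
    rw [← hy, hy0]
    simp
  have htot : ∫ p, ‖f p‖ ^ 2 ∂(μ.prod ν) = 0 := by
    rw [integral_prod _ hfint]
    exact integral_eq_zero_of_ae hint
  rw [integral_eq_zero_iff_of_nonneg (fun p => by positivity) hfint] at htot
  filter_upwards [htot] with p hp
  simpa using hp

end Product

section Tensor

variable {Ω₁ Ω₂ : Set ℝ}

theorem volume_restrict_prod (Ω₁ Ω₂ : Set ℝ) : (volume : Measure (ℝ × ℝ)).restrict (Ω₁ ×ˢ Ω₂) =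
    (volume.restrict Ω₁).prod (volume.restrict Ω₂) := by
  rw [Measure.prod_restrict, Measure.volume_eq_prod]

theorem memLp_tensor {f g : ℝ → ℂ} (hf : MemLp f 2 (volume.restrict Ω₁))
    (hg : MemLp g 2 (volume.restrict Ω₂)) :
    MemLp (fun p : ℝ × ℝ => f p.1 * g p.2) 2 (volume.restrict (Ω₁ ×ˢ Ω₂)) := by
  rw [volume_restrict_prod]
  exact memLp_mul_prod hf hg

theorem ae_eq_tensor {f f' g g' : ℝ → ℂ} (hf : f =ᵐ[volume.restrict Ω₁] f')
    (hg : g =ᵐ[volume.restrict Ω₂] g') :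
    (fun p : ℝ × ℝ => f p.1 * g p.2) =ᵐ[volume.restrict (Ω₁ ×ˢ Ω₂)]
      fun p => f' p.1 * g' p.2 := by
  rw [volume_restrict_prod]
  filter_upwards [Measure.quasiMeasurePreserving_fst.ae hf,
    Measure.quasiMeasurePreserving_snd.ae hg] with p h1 h2
  rw [h1, h2]

theorem coeFn_toLp_tensor (a : L2 Ω₁) (b : L2 Ω₂) :
    ((memLp_tensor (Lp.memLp a) (Lp.memLp b)).toLp : ℝ × ℝ → ℂ)
      =ᵐ[volume.restrict (Ω₁ ×ˢ Ω₂)] fun p => a p.1 * b p.2 :=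
  (memLp_tensor (Lp.memLp a) (Lp.memLp b)).coeFn_toLp

theorem inner_toLp_tensor (a a' : L2 Ω₁) (b b' : L2 Ω₂) :
    inner ℂ (memLp_tensor (Lp.memLp a) (Lp.memLp b)).toLp
      (memLp_tensor (Lp.memLp a') (Lp.memLp b')).toLp = inner ℂ a a' * inner ℂ b b' := by
  rw [L2.inner_def, L2.inner_def, L2.inner_def, ← integral_prod_mul, ← volume_restrict_prod]
  refine integral_congr_ae ?_
  filter_upwards [coeFn_toLp_tensor a b, coeFn_toLp_tensor a' b'] with p h1 h2
  rw [h1, h2]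
  simp only [RCLike.inner_apply, map_mul]
  ring

/-- The product `(a, b) ↦ a(r) b(y)` as a bounded bilinear map. -/
noncomputable def tensor (Ω₁ Ω₂ : Set ℝ) : L2 Ω₁ →L[ℂ] L2 Ω₂ →L[ℂ] L2 (Ω₁ ×ˢ Ω₂) :=
  LinearMap.mkContinuous₂
    (LinearMap.mk₂ ℂ (fun a b => (memLp_tensor (Lp.memLp a) (Lp.memLp b)).toLp)
      (fun a a' b => by
        refine Lp.ext ((coeFn_toLp_tensor _ _).trans ((ae_eq_tensor (Lp.coeFn_add a a')
          (ae_eq_refl b)).trans ?_))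
        filter_upwards [Lp.coeFn_add (memLp_tensor (Lp.memLp a) (Lp.memLp b)).toLp
          (memLp_tensor (Lp.memLp a') (Lp.memLp b)).toLp, coeFn_toLp_tensor a b,
          coeFn_toLp_tensor a' b] with p h1 h2 h3
        rw [h1, Pi.add_apply, Pi.add_apply, h2, h3, add_mul])
      (fun z a b => by
        refine Lp.ext ((coeFn_toLp_tensor _ _).trans ((ae_eq_tensor (Lp.coeFn_smul z a)
          (ae_eq_refl b)).trans ?_))
        filter_upwards [Lp.coeFn_smul z (memLp_tensor (Lp.memLp a) (Lp.memLp b)).toLp,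
          coeFn_toLp_tensor a b] with p h1 h2
        rw [h1, Pi.smul_apply, Pi.smul_apply, h2, smul_mul_assoc])
      (fun a b b' => by
        refine Lp.ext ((coeFn_toLp_tensor _ _).trans ((ae_eq_tensor (ae_eq_refl a)
          (Lp.coeFn_add b b')).trans ?_))
        filter_upwards [Lp.coeFn_add (memLp_tensor (Lp.memLp a) (Lp.memLp b)).toLp
          (memLp_tensor (Lp.memLp a) (Lp.memLp b')).toLp, coeFn_toLp_tensor a b,
          coeFn_toLp_tensor a b'] with p h1 h2 h3
        rw [h1, Pi.add_apply, Pi.add_apply, h2, h3, mul_add])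
      (fun z a b => by
        refine Lp.ext ((coeFn_toLp_tensor _ _).trans ((ae_eq_tensor (ae_eq_refl a)
          (Lp.coeFn_smul z b)).trans ?_))
        filter_upwards [Lp.coeFn_smul z (memLp_tensor (Lp.memLp a) (Lp.memLp b)).toLp,
          coeFn_toLp_tensor a b] with p h1 h2
        rw [h1, Pi.smul_apply, Pi.smul_apply, h2, mul_smul_comm]))
    1 fun a b => by
      rw [one_mul]
      refine le_of_sq_le_sq ?_ (by positivity)
      have h := inner_toLp_tensor a a b b
      simp only [inner_self_eq_norm_sq_to_K] at h
      rw [mul_pow]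
      refine le_of_eq ?_
      exact_mod_cast h

theorem coeFn_tensor (a : L2 Ω₁) (b : L2 Ω₂) :
    tensor Ω₁ Ω₂ a b =ᵐ[volume.restrict (Ω₁ ×ˢ Ω₂)] fun p => a p.1 * b p.2 :=
  coeFn_toLp_tensor a b

theorem inner_tensor (a a' : L2 Ω₁) (b b' : L2 Ω₂) :
    inner ℂ (tensor Ω₁ Ω₂ a b) (tensor Ω₁ Ω₂ a' b') = inner ℂ a a' * inner ℂ b b' :=
  inner_toLp_tensor a a' b b'

/-- The products of the elements of two Hilbert bases form a Hilbert basis. -/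
theorem exists_hilbertBasis_tensor (b₁ : HilbertBasis ℕ ℂ (L2 Ω₁))
    (b₂ : HilbertBasis ℕ ℂ (L2 Ω₂)) :
    ∃ b : HilbertBasis (ℕ × ℕ) ℂ (L2 (Ω₁ ×ˢ Ω₂)), ∀ p, b p = tensor Ω₁ Ω₂ (b₁ p.1) (b₂ p.2) := by
  have hortho : Orthonormal ℂ fun p : ℕ × ℕ => tensor Ω₁ Ω₂ (b₁ p.1) (b₂ p.2) := by
    rw [orthonormal_iff_ite]
    intro p p'
    rw [inner_tensor, orthonormal_iff_ite.1 b₁.orthonormal, orthonormal_iff_ite.1 b₂.orthonormal]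
    by_cases h1 : p.1 = p'.1 <;> by_cases h2 : p.2 = p'.2 <;> simp [h1, h2, Prod.ext_iff]
  have hbot : (Submodule.span ℂ (range fun p : ℕ × ℕ => tensor Ω₁ Ω₂ (b₁ p.1) (b₂ p.2)))ᗮ = ⊥ := by
    rw [eq_bot_iff]
    intro F hF
    rw [Submodule.mem_orthogonal] at hF
    have hF2 : MemLp F 2 ((volume.restrict Ω₁).prod (volume.restrict Ω₂)) := by
      rw [← volume_restrict_prod]
      exact Lp.memLp F
    have h0 := ae_eq_zero_of_orthogonal_products b₁ b₂ hF2 fun i j => by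
      have h1 := hF _ (Submodule.subset_span ⟨(i, j), rfl⟩)
      rw [L2.inner_def] at h1
      rw [← h1, ← volume_restrict_prod]
      refine integral_congr_ae ?_
      filter_upwards [coeFn_tensor (b₁ i) (b₂ j)] with p hp
      rw [hp]
      simp only [RCLike.inner_apply, map_mul, RCLike.star_def]
      ring
    rw [← volume_restrict_prod] at h0
    exact Lp.ext (h0.trans (Lp.coeFn_zero _ _ _).symm)
  exact ⟨HilbertBasis.mkOfOrthogonalEqBot hortho hbot, fun p => by
    rw [HilbertBasis.coe_mkOfOrthogonalEqBot]⟩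

end Tensor

/-! ### Separation of variables for the operators in the plane -/

theorem dirDeriv_slice_fst {Φ : ℝ × ℝ → ℂ} (hΦ : ContDiff ℝ ∞ Φ) (x y : ℝ) :
    dirDeriv (1, 0) Φ (x, y) = dirDeriv 1 (fun x => Φ (x, y)) x := by
  have h := HasFDerivAt.comp (f := fun x => (x, y)) x
    (hΦ.differentiable (by simp) (x, y)).hasFDerivAt
    ((hasFDerivAt_id x).prodMk (hasFDerivAt_const y x))
  have h2 : fderiv ℝ (fun x => Φ (x, y)) x = _ := h.fderiv
  rw [dirDeriv, dirDeriv, h2]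
  simp

theorem dirDeriv_slice_snd {Φ : ℝ × ℝ → ℂ} (hΦ : ContDiff ℝ ∞ Φ) (x y : ℝ) :
    dirDeriv (0, 1) Φ (x, y) = dirDeriv 1 (fun y => Φ (x, y)) y := by
  have h := HasFDerivAt.comp (f := fun y => (x, y)) y
    (hΦ.differentiable (by simp) (x, y)).hasFDerivAt
    ((hasFDerivAt_const x y).prodMk (hasFDerivAt_id y))
  have h2 : fderiv ℝ (fun y => Φ (x, y)) y = _ := h.fderiv
  rw [dirDeriv, dirDeriv, h2]
  simp

theorem diffExpr_slice_fst {Φ : ℝ × ℝ → ℂ} (hΦ : ContDiff ℝ ∞ Φ) {c : ℝ} {q : C(ℝ, ℝ)}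
    {Q : C(ℝ × ℝ, ℝ)} (hQ : ∀ p, Q p = q p.1) (x y : ℝ) :
    diffExpr (1, 0) c Q Φ (x, y) = diffExpr 1 c q (fun x => Φ (x, y)) x := by
  rw [diffExpr, diffExpr, dirDeriv_slice_fst (contDiff_dirDeriv hΦ _), hQ,
    funext fun x => dirDeriv_slice_fst hΦ x y]

theorem diffExpr_slice_snd {Φ : ℝ × ℝ → ℂ} (hΦ : ContDiff ℝ ∞ Φ) {c : ℝ} {q : C(ℝ, ℝ)}
    {Q : C(ℝ × ℝ, ℝ)} (hQ : ∀ p, Q p = q p.2) (x y : ℝ) :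
    diffExpr (0, 1) c Q Φ (x, y) = diffExpr 1 c q (fun y => Φ (x, y)) y := by
  rw [diffExpr, diffExpr, dirDeriv_slice_snd (contDiff_dirDeriv hΦ _), hQ,
    funext fun y => dirDeriv_slice_snd hΦ x y]

variable {Ω₁ Ω₂ : Set ℝ}

theorem IsTestFunction.slice_fst {Φ : ℝ × ℝ → ℂ} (hΦ : IsTestFunction (Ω₁ ×ˢ Ω₂) Φ) (y : ℝ) :
    IsTestFunction Ω₁ fun x => Φ (x, y) := by
  have hcl : IsClosed {x : ℝ | (x, y) ∈ tsupport Φ} :=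
    (isClosed_tsupport Φ).preimage (by fun_prop)
  have hsub : tsupport (fun x => Φ (x, y)) ⊆ {x : ℝ | (x, y) ∈ tsupport Φ} :=
    closure_minimal (fun x hx => subset_tsupport Φ hx) hcl
  refine ⟨hΦ.smooth.comp (by fun_prop), ?_, fun x hx => (hΦ.support (hsub hx)).1⟩
  exact (hΦ.compact.isCompact.image continuous_fst).of_isClosed_subset (isClosed_tsupport _)
    fun x hx => ⟨(x, y), hsub hx, rfl⟩

theorem IsTestFunction.slice_snd {Φ : ℝ × ℝ → ℂ} (hΦ : IsTestFunction (Ω₁ ×ˢ Ω₂) Φ) (x : ℝ) :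
    IsTestFunction Ω₂ fun y => Φ (x, y) := by
  have hcl : IsClosed {y : ℝ | (x, y) ∈ tsupport Φ} :=
    (isClosed_tsupport Φ).preimage (by fun_prop)
  have hsub : tsupport (fun y => Φ (x, y)) ⊆ {y : ℝ | (x, y) ∈ tsupport Φ} :=
    closure_minimal (fun y hy => subset_tsupport Φ hy) hcl
  refine ⟨hΦ.smooth.comp (by fun_prop), ?_, fun y hy => (hΦ.support (hsub hy)).2⟩
  exact (hΦ.compact.isCompact.image continuous_snd).of_isClosed_subset (isClosed_tsupport _)
    fun y hy => ⟨(x, y), hsub hy, rfl⟩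

theorem IsTestFunction.prod {φ χ : ℝ → ℂ} (hφ : IsTestFunction Ω₁ φ) (hχ : IsTestFunction Ω₂ χ) :
    IsTestFunction (Ω₁ ×ˢ Ω₂) fun p : ℝ × ℝ => φ p.1 * χ p.2 := by
  have hsub : tsupport (fun p : ℝ × ℝ => φ p.1 * χ p.2) ⊆ tsupport φ ×ˢ tsupport χ := by
    refine closure_minimal (fun p hp => ?_) ((isClosed_tsupport φ).prod (isClosed_tsupport χ))
    exact ⟨subset_tsupport φ (left_ne_zero_of_mul hp), subset_tsupport χ (right_ne_zero_of_mul hp)⟩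
  refine ⟨(hφ.smooth.comp contDiff_fst).mul (hχ.smooth.comp contDiff_snd), ?_,
    hsub.trans (prod_mono hφ.support hχ.support)⟩
  exact (hφ.compact.isCompact.prod hχ.compact.isCompact).of_isClosed_subset (isClosed_tsupport _)
    hsub

theorem dirDeriv_prod_fst {φ χ : ℝ → ℂ} (hφ : ContDiff ℝ ∞ φ) (hχ : ContDiff ℝ ∞ χ) :
    dirDeriv (1, 0) (fun p : ℝ × ℝ => φ p.1 * χ p.2) = fun p => dirDeriv 1 φ p.1 * χ p.2 := by
  ext ⟨x, y⟩
  have hs : ContDiff ℝ ∞ fun p : ℝ × ℝ => φ p.1 * χ p.2 :=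
    (hφ.comp contDiff_fst).mul (hχ.comp contDiff_snd)
  rw [dirDeriv_slice_fst hs]
  have h : (fun x => φ x * χ y) = χ y • φ := funext fun x => mul_comm _ _
  rw [h, dirDeriv_smul hφ, Pi.smul_apply, smul_eq_mul, mul_comm]

theorem dirDeriv_prod_snd {φ χ : ℝ → ℂ} (hφ : ContDiff ℝ ∞ φ) (hχ : ContDiff ℝ ∞ χ) :
    dirDeriv (0, 1) (fun p : ℝ × ℝ => φ p.1 * χ p.2) = fun p => φ p.1 * dirDeriv 1 χ p.2 := by
  ext ⟨x, y⟩
  have hs : ContDiff ℝ ∞ fun p : ℝ × ℝ => φ p.1 * χ p.2 :=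
    (hφ.comp contDiff_fst).mul (hχ.comp contDiff_snd)
  rw [dirDeriv_slice_snd hs]
  have h : (fun y => φ x * χ y) = φ x • χ := rfl
  rw [h, dirDeriv_smul hχ, Pi.smul_apply, smul_eq_mul]

theorem integrable_tensor_mul (a : L2 Ω₁) (b : L2 Ω₂) {D : ℝ × ℝ → ℂ}
    (hD : MemLp D 2 (volume.restrict (Ω₁ ×ˢ Ω₂))) :
    Integrable (fun p : ℝ × ℝ => a p.1 * b p.2 * D p)
      ((volume.restrict Ω₁).prod (volume.restrict Ω₂)) := by
  rw [volume_restrict_prod] at hD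
  exact (memLp_mul_prod (Lp.memLp a) (Lp.memLp b)).integrable_mul hD

theorem integral_tensor_mul (a : L2 Ω₁) (b : L2 Ω₂) (D : ℝ × ℝ → ℂ) :
    ∫ p in Ω₁ ×ˢ Ω₂, tensor Ω₁ Ω₂ a b p * D p =
      ∫ p, a p.1 * b p.2 * D p ∂((volume.restrict Ω₁).prod (volume.restrict Ω₂)) := by
  rw [← volume_restrict_prod]
  refine integral_congr_ae ?_
  filter_upwards [coeFn_tensor a b] with p hp
  rw [hp]

theorem integral_tensor_mul_fst (a : L2 Ω₁) (b : L2 Ω₂) {D : ℝ × ℝ → ℂ}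
    (hD : MemLp D 2 (volume.restrict (Ω₁ ×ˢ Ω₂))) :
    ∫ p in Ω₁ ×ˢ Ω₂, tensor Ω₁ Ω₂ a b p * D p =
      ∫ y in Ω₂, b y * ∫ x in Ω₁, a x * D (x, y) := by
  rw [integral_tensor_mul, integral_prod_symm _ (integrable_tensor_mul a b hD)]
  refine integral_congr_ae (Eventually.of_forall fun y => ?_)
  simp only
  rw [← integral_const_mul]
  refine integral_congr_ae (Eventually.of_forall fun x => ?_)
  simp only
  ring

theorem integral_tensor_mul_snd (a : L2 Ω₁) (b : L2 Ω₂) {D : ℝ × ℝ → ℂ}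
    (hD : MemLp D 2 (volume.restrict (Ω₁ ×ˢ Ω₂))) :
    ∫ p in Ω₁ ×ˢ Ω₂, tensor Ω₁ Ω₂ a b p * D p =
      ∫ x in Ω₁, a x * ∫ y in Ω₂, b y * D (x, y) := by
  rw [integral_tensor_mul, integral_prod _ (integrable_tensor_mul a b hD)]
  refine integral_congr_ae (Eventually.of_forall fun x => ?_)
  simp only
  rw [← integral_const_mul]
  refine integral_congr_ae (Eventually.of_forall fun y => ?_)
  simp only
  ring

/-- Elements of the energy space are limits of test functions in `L²`. -/
theorem mem_closure_of_mem_energySpace {Ω : Set ℝ} {w : ℝ → ℝ} {b : L2 Ω}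
    (hb : b ∈ energySpace Ω 1 w) :
    b ∈ closure {b : L2 Ω | ∃ χ, IsTestFunction Ω χ ∧ b =ᵐ[volume.restrict Ω] χ} := by
  obtain ⟨t, ht, rfl⟩ := hb
  refine map_mem_closure continuous_fst ht ?_
  rintro t ⟨φ, hφ, h1, -⟩
  exact ⟨φ, hφ, h1⟩

/-- If `-c a'' + q a = f` on the line, then the product `a ⊗ b` solves the corresponding equation
in the first variable in the plane, for every `b` that is a limit of test functions. -/
theorem tensor_mem_operatorGraph_fst {c : ℝ} {q : C(ℝ, ℝ)} {w w₂ : ℝ → ℝ} {Q : C(ℝ × ℝ, ℝ)}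
    {W : ℝ × ℝ → ℝ} (hQ : ∀ p, Q p = q p.1) (hW : ∀ p, W p = w p.1) {a f : L2 Ω₁}
    (haf : (a, f) ∈ operatorGraph Ω₁ 1 c q w) {b : L2 Ω₂} (hb : b ∈ energySpace Ω₂ 1 w₂) :
    (tensor Ω₁ Ω₂ a b, tensor Ω₁ Ω₂ f b) ∈ operatorGraph (Ω₁ ×ˢ Ω₂) (1, 0) c Q W := by
  obtain ⟨⟨t, ht, hta⟩, heq⟩ := haf
  replace hta : t.1 = a := hta
  refine ⟨⟨(tensor Ω₁ Ω₂ t.1 b, tensor Ω₁ Ω₂ t.2.1 b, tensor Ω₁ Ω₂ t.2.2 b), ?_,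
    congrArg (fun a => tensor Ω₁ Ω₂ a b) hta⟩, fun Φ hΦ => ?_⟩
  · refine map_mem_closure₂ (f := fun (t : L2 Ω₁ × L2 Ω₁ × L2 Ω₁) b =>
      (tensor Ω₁ Ω₂ t.1 b, tensor Ω₁ Ω₂ t.2.1 b, tensor Ω₁ Ω₂ t.2.2 b)) ?_ ht
      (mem_closure_of_mem_energySpace hb) ?_
    · simp only [Function.uncurry_def]
      fun_prop
    · rintro t ⟨φ, hφ, h1, h2, h3⟩ b ⟨χ, hχ, h4⟩
      refine ⟨_, hφ.prod hχ, (coeFn_tensor _ _).trans (ae_eq_tensor h1 h4), ?_, ?_⟩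
      · rw [dirDeriv_prod_fst hφ.smooth hχ.smooth]
        exact (coeFn_tensor _ _).trans (ae_eq_tensor h2 h4)
      · refine ((coeFn_tensor _ _).trans (ae_eq_tensor h3 h4)).trans
          (Eventually.of_forall fun p => ?_)
        simp only [hW, mul_assoc]
  · rw [integral_tensor_mul_fst a b (hΦ.memLp_diffExpr _ _ _), integral_tensor_mul_fst f b hΦ.memLp]
    refine integral_congr_ae (Eventually.of_forall fun y => congrArg (b y * ·) ?_)
    simp only [diffExpr_slice_fst hΦ.smooth hQ]
    exact heq _ (hΦ.slice_fst y)

/-- The analogue of `tensor_mem_operatorGraph_fst` for the second variable. -/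
theorem tensor_mem_operatorGraph_snd {c : ℝ} {q : C(ℝ, ℝ)} {w w₁ : ℝ → ℝ} {Q : C(ℝ × ℝ, ℝ)}
    {W : ℝ × ℝ → ℝ} (hQ : ∀ p, Q p = q p.2) (hW : ∀ p, W p = w p.2) {b f : L2 Ω₂}
    (hbf : (b, f) ∈ operatorGraph Ω₂ 1 c q w) {a : L2 Ω₁} (ha : a ∈ energySpace Ω₁ 1 w₁) :
    (tensor Ω₁ Ω₂ a b, tensor Ω₁ Ω₂ a f) ∈ operatorGraph (Ω₁ ×ˢ Ω₂) (0, 1) c Q W := by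
  obtain ⟨⟨t, ht, htb⟩, heq⟩ := hbf
  replace htb : t.1 = b := htb
  refine ⟨⟨(tensor Ω₁ Ω₂ a t.1, tensor Ω₁ Ω₂ a t.2.1, tensor Ω₁ Ω₂ a t.2.2), ?_,
    congrArg (fun b => tensor Ω₁ Ω₂ a b) htb⟩, fun Φ hΦ => ?_⟩
  · refine map_mem_closure₂ (f := fun a (t : L2 Ω₂ × L2 Ω₂ × L2 Ω₂) =>
      (tensor Ω₁ Ω₂ a t.1, tensor Ω₁ Ω₂ a t.2.1, tensor Ω₁ Ω₂ a t.2.2)) ?_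
      (mem_closure_of_mem_energySpace ha) ht ?_
    · simp only [Function.uncurry_def]
      fun_prop
    · rintro a ⟨φ, hφ, h4⟩ t ⟨χ, hχ, h1, h2, h3⟩
      refine ⟨_, hφ.prod hχ, (coeFn_tensor _ _).trans (ae_eq_tensor h4 h1), ?_, ?_⟩
      · rw [dirDeriv_prod_snd hφ.smooth hχ.smooth]
        exact (coeFn_tensor _ _).trans (ae_eq_tensor h4 h2)
      · refine ((coeFn_tensor _ _).trans (ae_eq_tensor h4 h3)).trans
          (Eventually.of_forall fun p => ?_)
        simp only [hW, mul_left_comm]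
  · rw [integral_tensor_mul_snd a b (hΦ.memLp_diffExpr _ _ _), integral_tensor_mul_snd a f hΦ.memLp]
    refine integral_congr_ae (Eventually.of_forall fun x => congrArg (a x * ·) ?_)
    simp only [diffExpr_slice_snd hΦ.smooth hQ]
    exact heq _ (hΦ.slice_snd x)

/-! ### Dilations of the half-line -/

theorem map_mul_left_restrict_Ioi {s : ℝ} (hs : 0 < s) :
    (volume.restrict halfLine).map (s * ·) = ENNReal.ofReal s⁻¹ • volume.restrict halfLine := by
  have h1 : halfLine = (s * ·) ⁻¹' halfLine := by
    ext r
    simp [hs]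
  rw [h1, ← Measure.restrict_map (by fun_prop) measurableSet_Ioi, Real.map_volume_mul_left hs.ne',
    abs_of_pos (inv_pos.2 hs), Measure.restrict_smul, ← h1]

theorem memLp_comp_mul_left {s : ℝ} (hs : 0 < s) {f : ℝ → ℂ}
    (hf : MemLp f 2 (volume.restrict halfLine)) :
    MemLp (fun r => f (s * r)) 2 (volume.restrict halfLine) := by
  refine MemLp.comp_of_map (f := (s * ·)) ?_ (by fun_prop)
  rw [map_mul_left_restrict_Ioi hs]
  exact hf.smul_measure ENNReal.ofReal_ne_top

theorem ae_eq_comp_mul_left {s : ℝ} (hs : 0 < s) {f g : ℝ → ℂ}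
    (hfg : f =ᵐ[volume.restrict halfLine] g) :
    (fun r => f (s * r)) =ᵐ[volume.restrict halfLine] fun r => g (s * r) := by
  have h : Measure.QuasiMeasurePreserving (s * ·) (volume.restrict halfLine)
      (volume.restrict halfLine) := by
    refine ⟨by fun_prop, ?_⟩
    rw [map_mul_left_restrict_Ioi hs]
    exact Measure.smul_absolutelyContinuous
  exact h.ae_eq hfg

/-- The dilation `u ↦ u(s ·)` in `L²(ℝ₊)`. -/
noncomputable def dilation {s : ℝ} (hs : 0 < s) : L2 halfLine →L[ℂ] L2 halfLine :=
  LinearMap.mkContinuous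
    { toFun := fun u => (memLp_comp_mul_left hs (Lp.memLp u)).toLp
      map_add' := fun u v => by
        rw [← MemLp.toLp_add]
        exact MemLp.toLp_congr _ _ (ae_eq_comp_mul_left hs (Lp.coeFn_add u v))
      map_smul' := fun z u => by
        rw [RingHom.id_apply, ← MemLp.toLp_const_smul]
        exact MemLp.toLp_congr _ _ (ae_eq_comp_mul_left hs (Lp.coeFn_smul z u)) }
    √(s⁻¹) fun u => by
      refine le_of_sq_le_sq ?_ (by positivity)
      rw [mul_pow, Real.sq_sqrt (inv_nonneg.2 hs.le), norm_sq_eq_integral, norm_sq_eq_integral]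
      refine le_of_eq ?_
      have h := integral_comp_mul_left_Ioi (fun r => ‖u r‖ ^ 2) 0 hs
      rw [mul_zero, smul_eq_mul] at h
      rw [← h]
      refine integral_congr_ae ?_
      filter_upwards [(memLp_comp_mul_left hs (Lp.memLp u)).coeFn_toLp] with r hr
      exact congrArg (‖·‖ ^ 2) hr

theorem coeFn_dilation {s : ℝ} (hs : 0 < s) (u : L2 halfLine) :
    dilation hs u =ᵐ[volume.restrict halfLine] fun r => u (s * r) :=
  (memLp_comp_mul_left hs (Lp.memLp u)).coeFn_toLp

theorem IsTestFunction.comp_mul_left {s : ℝ} (hs : 0 < s) {φ : ℝ → ℂ}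
    (hφ : IsTestFunction halfLine φ) : IsTestFunction halfLine fun r => φ (s * r) := by
  have hsup : tsupport (fun r => φ (s * r)) = (s * ·) ⁻¹' tsupport φ :=
    tsupport_comp_eq_preimage φ (Homeomorph.mulLeft₀ s hs.ne')
  refine ⟨hφ.smooth.comp (by fun_prop), ?_, ?_⟩
  · exact hφ.compact.comp_homeomorph (Homeomorph.mulLeft₀ s hs.ne')
  · rw [hsup]
    intro r hr
    exact pos_of_mul_pos_right (hφ.support hr) hs.le

theorem dirDeriv_comp_mul_left (s : ℝ) {φ : ℝ → ℂ} (hφ : ContDiff ℝ ∞ φ) :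
    dirDeriv 1 (fun r => φ (s * r)) = fun r => (s : ℂ) * dirDeriv 1 φ (s * r) := by
  ext r
  have h := (hφ.differentiable (by simp) (s * r)).hasFDerivAt.comp r
    ((hasFDerivAt_id r).const_mul s)
  have h2 : fderiv ℝ (fun r => φ (s * r)) r = _ := h.fderiv
  rw [dirDeriv, h2]
  simp [dirDeriv]

theorem dilation_mem_energySpace {s : ℝ} (hs : 0 < s) {u : L2 halfLine}
    (hu : u ∈ energySpace halfLine 1 fun r => r ^ 2) :
    dilation hs u ∈ energySpace halfLine 1 fun r => r ^ 2 := by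
  obtain ⟨t, ht, rfl⟩ := hu
  refine ⟨(dilation hs t.1, (s : ℂ) • dilation hs t.2.1, ((s⁻¹ ^ 2 : ℝ) : ℂ) • dilation hs t.2.2),
    ?_, rfl⟩
  refine map_mem_closure (f := fun t : L2 halfLine × L2 halfLine × L2 halfLine =>
    (dilation hs t.1, (s : ℂ) • dilation hs t.2.1, ((s⁻¹ ^ 2 : ℝ) : ℂ) • dilation hs t.2.2))
    (by fun_prop) ht ?_
  rintro t ⟨φ, hφ, h1, h2, h3⟩
  refine ⟨_, hφ.comp_mul_left hs, (coeFn_dilation hs _).trans (ae_eq_comp_mul_left hs h1), ?_, ?_⟩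
  · rw [dirDeriv_comp_mul_left s hφ.smooth]
    filter_upwards [Lp.coeFn_smul (s : ℂ) (dilation hs t.2.1), coeFn_dilation hs t.2.1,
      ae_eq_comp_mul_left hs h2] with r k1 k2 k3
    rw [k1, Pi.smul_apply, k2, k3, smul_eq_mul]
  · filter_upwards [Lp.coeFn_smul ((s⁻¹ ^ 2 : ℝ) : ℂ) (dilation hs t.2.2),
      coeFn_dilation hs t.2.2, ae_eq_comp_mul_left hs h3] with r k1 k2 k3
    rw [k1, Pi.smul_apply, k2, k3, smul_eq_mul, ← mul_assoc, ← Complex.ofReal_mul]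
    congr 2
    field_simp

/-- Scaling of the eigenvalue equation: if `-u'' + r⁴ u = l u`, then `v = u(s ·)` solves
`-v'' + s⁶ r⁴ v = s² l v`. -/
theorem dilation_mem_graph {s : ℝ} (hs : 0 < s) {l : ℝ} {u : L2 halfLine}
    (hu : (u, (l : ℂ) • u) ∈ tildeLine.graph) :
    (dilation hs u, ((s ^ 2 * l : ℝ) : ℂ) • dilation hs u) ∈ (gravityLine (-s ^ 6)).graph := by
  rw [tildeLine, gravityLine, graph_diffOperator isOpen_Ioi] at hu
  rw [gravityLine, graph_diffOperator isOpen_Ioi]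
  obtain ⟨hE, heq⟩ := hu
  refine ⟨dilation_mem_energySpace hs hE, fun φ hφ => ?_⟩
  have hs' : (s : ℂ) ≠ 0 := by exact_mod_cast hs.ne'
  -- The test function is transported by the inverse dilation.
  set χ : ℝ → ℂ := fun r => φ (s⁻¹ * r) with hχ
  have h := heq χ (hφ.comp_mul_left (inv_pos.2 hs))
  have hφχ : ∀ r, φ r = χ (s * r) := fun r => by
    rw [hχ]
    simp only
    rw [inv_mul_cancel_left₀ hs.ne']
  have hexp : ∀ r, diffExpr 1 1 (⟨fun r => -(-s ^ 6) * r ^ 4, by fun_prop⟩ : C(ℝ, ℝ)) φ r =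
      (s : ℂ) ^ 2 * diffExpr 1 1 (⟨fun r => -(-1) * r ^ 4, by fun_prop⟩ : C(ℝ, ℝ)) χ (s * r) := by
    intro r
    have h1 : dirDeriv 1 χ = fun r => ((s⁻¹ : ℝ) : ℂ) * dirDeriv 1 φ (s⁻¹ * r) :=
      dirDeriv_comp_mul_left s⁻¹ hφ.smooth
    have h2 : dirDeriv 1 χ = ((s⁻¹ : ℝ) : ℂ) • fun r => dirDeriv 1 φ (s⁻¹ * r) := h1
    have h3 : dirDeriv 1 (dirDeriv 1 χ) (s * r) =
        ((s⁻¹ : ℝ) : ℂ) * (((s⁻¹ : ℝ) : ℂ) * dirDeriv 1 (dirDeriv 1 φ) r) := by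
      have hd : ContDiff ℝ ∞ fun r => dirDeriv 1 φ (s⁻¹ * r) :=
        (contDiff_dirDeriv hφ.smooth 1).comp (by fun_prop)
      rw [h2, dirDeriv_smul hd,
        dirDeriv_comp_mul_left s⁻¹ (contDiff_dirDeriv hφ.smooth 1), Pi.smul_apply, smul_eq_mul,
        inv_mul_cancel_left₀ hs.ne']
    rw [diffExpr, diffExpr, h3, ← hφχ r]
    simp only [ContinuousMap.coe_mk]
    push_cast
    field_simp
  have hsub : ∀ g : ℝ → ℂ, ∫ r in halfLine, g (s * r) = ((s⁻¹ : ℝ) : ℂ) * ∫ r in halfLine, g r := by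
    intro g
    have := integral_comp_mul_left_Ioi g 0 hs
    rw [mul_zero, Complex.real_smul] at this
    exact this
  have e1 : ∫ r in halfLine, dilation hs u r *
      diffExpr 1 1 (⟨fun r => -(-s ^ 6) * r ^ 4, by fun_prop⟩ : C(ℝ, ℝ)) φ r =
      (s : ℂ) ^ 2 * (((s⁻¹ : ℝ) : ℂ) * ∫ r in halfLine, u r *
        diffExpr 1 1 (⟨fun r => -(-1) * r ^ 4, by fun_prop⟩ : C(ℝ, ℝ)) χ r) := by
    rw [← hsub, ← integral_const_mul]
    refine integral_congr_ae ?_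
    filter_upwards [coeFn_dilation hs u] with r hr
    rw [hr, hexp]
    ring
  have e2 : ∫ r in halfLine, (((s ^ 2 * l : ℝ) : ℂ) • dilation hs u) r * φ r =
      (s : ℂ) ^ 2 * (((s⁻¹ : ℝ) : ℂ) * ∫ r in halfLine, ((l : ℂ) • u) r * χ r) := by
    rw [← hsub, ← integral_const_mul]
    refine integral_congr_ae ?_
    filter_upwards [Lp.coeFn_smul ((s ^ 2 * l : ℝ) : ℂ) (dilation hs u), coeFn_dilation hs u,
      ae_eq_comp_mul_left hs (Lp.coeFn_smul (l : ℂ) u)] with r k1 k2 k3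
    rw [k1, k3, Pi.smul_apply, Pi.smul_apply, k2, ← hφχ]
    simp only [smul_eq_mul]
    push_cast
    ring
  change ∫ r in halfLine, dilation hs u r * _ = ∫ r in halfLine, _ * φ r
  rw [e1, e2]
  exact congrArg (fun z => (s : ℂ) ^ 2 * (((s⁻¹ : ℝ) : ℂ) * z)) h

/-! ### Separated solutions of the Wheeler-DeWitt equation -/

theorem SolvesODE.iteratedDeriv_two {Ω : Set ℝ} (hΩ : IsOpen Ω) {Q u v : ℝ → ℂ}
    (h : SolvesODE Ω Q u v) {x : ℝ} (hx : x ∈ Ω) : iteratedDeriv 2 u x = Q x * u x := by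
  have h1 : deriv u =ᶠ[𝓝 x] v := by
    filter_upwards [hΩ.mem_nhds hx] with y hy
    exact (h y hy).1.deriv
  rw [iteratedDeriv_succ, iteratedDeriv_one, h1.deriv_eq, (h x hx).2.deriv]

theorem SolvesODE.contDiffOn {Ω : Set ℝ} (hΩ : IsOpen Ω) {Q u v : ℝ → ℂ} (hQ : Continuous Q)
    (h : SolvesODE Ω Q u v) : ContDiffOn ℝ 2 u Ω := by
  have hu : ContinuousOn u Ω := fun x hx => (h x hx).1.continuousAt.continuousWithinAt
  have hv : ContDiffOn ℝ 1 v Ω := by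
    rw [show (1 : WithTop ℕ∞) = 0 + 1 by norm_num, contDiffOn_succ_iff_deriv_of_isOpen hΩ]
    refine ⟨fun x hx => (h x hx).2.differentiableAt.differentiableWithinAt, by simp, ?_⟩
    rw [contDiffOn_zero]
    exact (hQ.continuousOn.mul hu).congr fun x hx => (h x hx).2.deriv
  rw [show (2 : WithTop ℕ∞) = 1 + 1 by norm_num, contDiffOn_succ_iff_deriv_of_isOpen hΩ]
  exact ⟨fun x hx => (h x hx).1.differentiableAt.differentiableWithinAt, by simp,
    hv.congr fun x hx => (h x hx).1.deriv⟩

theorem SolvesODE.const_mul {Ω : Set ℝ} {Q u v : ℝ → ℂ} (h : SolvesODE Ω Q u v) (z : ℂ) :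
    SolvesODE Ω Q (fun x => z * u x) fun x => z * v x := fun x hx =>
  ⟨(h x hx).1.const_mul z, ((h x hx).2.const_mul z).congr_deriv (mul_left_comm _ _ _)⟩

theorem SolvesODE.comp_mul_left {Q u v : ℝ → ℂ} (h : SolvesODE halfLine Q u v) {s : ℝ}
    (hs : 0 < s) : SolvesODE halfLine (fun r => (s : ℂ) ^ 2 * Q (s * r)) (fun r => u (s * r))
      fun r => (s : ℂ) * v (s * r) := by
  have hcomp : ∀ {f : ℝ → ℂ} {z : ℂ} {r : ℝ}, HasDerivAt f z (s * r) →
      HasDerivAt (fun r => f (s * r)) ((s : ℂ) * z) r := by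
    intro f z r hf
    have h1 := hf.scomp r ((hasDerivAt_id r).const_mul s)
    rw [mul_one, Complex.real_smul] at h1
    exact h1
  intro r hr
  obtain ⟨h1, h2⟩ := h (s * r) (mul_pos hs hr)
  refine ⟨hcomp h1, ((hcomp h2).const_mul (s : ℂ)).congr_deriv ?_⟩
  ring

theorem SolvesWheelerDeWitt.const_mul {c₁ αM μ Λ : ℝ} {ψ : ℝ × ℝ → ℂ}
    (h : SolvesWheelerDeWitt c₁ αM μ Λ ψ) (z : ℂ) :
    SolvesWheelerDeWitt c₁ αM μ Λ fun p => z * ψ p := by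
  refine ⟨contDiffOn_const.mul h.contDiffOn, fun r y hr => ?_, ?_⟩
  · have h1 := h.equation r y hr
    rw [iteratedDeriv_const_mul_field, iteratedDeriv_const_mul_field]
    linear_combination z * h1
  · obtain ⟨Ψ, f, hΨ, h1, h2⟩ := h.operators
    refine ⟨z • Ψ, z • f, ?_, Submodule.smul_mem _ z h1, Submodule.smul_mem _ z h2⟩
    exact (Lp.coeFn_smul z Ψ).trans (hΨ.const_smul z)

theorem isOpen_halfPlane : IsOpen halfPlane := isOpen_Ioi.prod isOpen_univ

theorem tensor_mem_gravityPlane {Λ l : ℝ} {x : L2 halfLine}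
    (hx : (x, (l : ℂ) • x) ∈ (gravityLine Λ).graph) {y : L2 (univ : Set ℝ)} {w : ℝ → ℝ}
    (hy : y ∈ energySpace univ 1 w) :
    (tensor halfLine univ x y, (l : ℂ) • tensor halfLine univ x y) ∈ (gravityPlane Λ).graph := by
  rw [gravityLine, graph_diffOperator isOpen_Ioi] at hx
  rw [gravityPlane, graph_diffOperator isOpen_halfPlane]
  have h := tensor_mem_operatorGraph_fst
    (Q := (⟨fun p => -Λ * p.1 ^ 4, by fun_prop⟩ : C(ℝ × ℝ, ℝ))) (W := fun p => p.1 ^ 2)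
    (fun p => rfl) (fun p => rfl) hx hy
  rwa [map_smul, smul_apply] at h

theorem tensor_mem_yangMillsPlane {c₁ αM μ m : ℝ} {y : L2 (univ : Set ℝ)}
    (hy : (y, (m : ℂ) • y) ∈ (yangMillsLine c₁ αM μ).graph) {x : L2 halfLine} {w : ℝ → ℝ}
    (hx : x ∈ energySpace halfLine 1 w) :
    (tensor halfLine univ x y, (m : ℂ) • tensor halfLine univ x y) ∈
      (yangMillsPlane c₁ αM μ).graph := by
  rw [yangMillsLine, graph_diffOperator isOpen_univ] at hy
  rw [yangMillsPlane, graph_diffOperator isOpen_halfPlane]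
  have h := tensor_mem_operatorGraph_snd
    (Q := (⟨fun p => 2 * αM * p.2 ^ 4 - μ * p.2 ^ 2, by fun_prop⟩ : C(ℝ × ℝ, ℝ)))
    (W := fun p => p.2 ^ 2) (fun p => rfl) (fun p => rfl) hy hx
  rwa [map_smul] at h

theorem mem_energySpace_of_gravityLine {Λ : ℝ} {x f : L2 halfLine}
    (hx : (x, f) ∈ (gravityLine Λ).graph) : x ∈ energySpace halfLine 1 fun r => r ^ 2 := by
  rw [gravityLine, graph_diffOperator isOpen_Ioi] at hx
  exact hx.1

theorem mem_energySpace_of_yangMillsLine {c₁ αM μ : ℝ} {y f : L2 (univ : Set ℝ)}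
    (hy : (y, f) ∈ (yangMillsLine c₁ αM μ).graph) : y ∈ energySpace univ 1 fun y => y ^ 2 := by
  rw [yangMillsLine, graph_diffOperator isOpen_univ] at hy
  exact hy.1

/-- The key computation: with `λ = l / m` and `s = λ^(-1/2)`, the function `u(s ·)` is an
eigenfunction of `-∂² + s⁶ r⁴` with eigenvalue `s² l = m`, which is the eigenvalue of `η`. -/
theorem solvesWheelerDeWitt_of_eigenvectors {c₁ αM μ l m : ℝ} (hc₁ : 0 < c₁) (hl : 0 < l)
    (hm : 0 < m) {x : L2 halfLine} (hx : (x, (l : ℂ) • x) ∈ tildeLine.graph)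
    {y : L2 (univ : Set ℝ)} (hy : (y, (m : ℂ) • y) ∈ (yangMillsLine c₁ αM μ).graph)
    {u u' η η' : ℝ → ℂ} (hxu : x =ᵐ[volume.restrict halfLine] u)
    (hyη : y =ᵐ[volume.restrict univ] η)
    (hu : SolvesODE halfLine (fun r => ((r ^ 4 : ℝ) - l : ℂ)) u u')
    (hη : SolvesODE univ (fun y => ((2 * αM * y ^ 4 - μ * y ^ 2 : ℝ) - m : ℂ) / c₁) η η') :
    SolvesWheelerDeWitt c₁ αM μ (-((l * m⁻¹) ^ 3)⁻¹)
      fun p => u ((l * m⁻¹) ^ (-(1 / 2) : ℝ) * p.1) * η p.2 := by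
  have hlam : 0 < l * m⁻¹ := mul_pos hl (inv_pos.2 hm)
  set s : ℝ := (l * m⁻¹) ^ (-(1 / 2) : ℝ) with hs_def
  have hs : 0 < s := Real.rpow_pos_of_pos hlam _
  have hs2 : s ^ 2 = (l * m⁻¹)⁻¹ := by
    rw [hs_def, ← Real.rpow_natCast, ← Real.rpow_mul hlam.le]
    rw [show (-(1 / 2) : ℝ) * (2 : ℕ) = -1 by norm_num, Real.rpow_neg_one]
  have hs2l : s ^ 2 * l = m := by
    rw [hs2]
    field_simp
  have hs6 : ((l * m⁻¹) ^ 3)⁻¹ = s ^ 6 := by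
    rw [← inv_pow, ← hs2]
    ring
  rw [hs6]
  have hus := hu.comp_mul_left hs
  have hc' : (c₁ : ℂ) ≠ 0 := by exact_mod_cast hc₁.ne'
  refine ⟨?_, fun r y hr => ?_, ?_⟩
  · have h1 := hus.contDiffOn isOpen_Ioi (by fun_prop)
    have h2 := hη.contDiffOn isOpen_univ (by fun_prop)
    exact (h1.comp contDiffOn_fst fun p hp => hp.1).mul
      (h2.comp contDiffOn_snd fun p hp => hp.2)
  · have h1 : iteratedDeriv 2 (fun z => u (s * r) * η z) y = _ :=
      (hη.const_mul (u (s * r))).iteratedDeriv_two isOpen_univ (mem_univ y)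
    have h2 : iteratedDeriv 2 (fun r => η y * u (s * r)) r = _ :=
      (hus.const_mul (η y)).iteratedDeriv_two isOpen_Ioi hr
    simp only [mul_comm (η y)] at h2
    have h3 : (s : ℂ) ^ 2 * l = m := by exact_mod_cast hs2l
    simp only [h1, h2]
    push_cast
    field_simp
    linear_combination (-(u (s * r) * η y)) * h3
  · have hd := dilation_mem_graph hs hx
    rw [hs2l] at hd
    refine ⟨tensor halfLine univ (dilation hs x) y, _, ?_,
      tensor_mem_gravityPlane hd (mem_energySpace_of_yangMillsLine hy),
      tensor_mem_yangMillsPlane hy (mem_energySpace_of_gravityLine hd)⟩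
    exact (coeFn_tensor _ _).trans
      (ae_eq_tensor ((coeFn_dilation hs x).trans (ae_eq_comp_mul_left hs hxu)) hyη)

theorem isEigenfunction_of_mem_graph {X : Type} [MeasureSpace X] {Ω : Set X}
    {T : L2 Ω →ₗ.[ℂ] L2 Ω} {z : ℂ} {x : L2 Ω} {f : X → ℂ} (hx : (x, z • x) ∈ T.graph)
    (hx0 : x ≠ 0) (hf : x =ᵐ[volume.restrict Ω] f) : IsEigenfunction T z f := by
  obtain ⟨y, rfl, hy⟩ := (LinearPMap.mem_graph_iff T).1 hx
  exact ⟨y, hx0, hf, hy⟩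

end WheelerDeWitt

theorem theorem1p1 (c₁ αM : ℝ) (hc₁ : 0 < c₁) (hαM : 0 < αM) :
    ∃ μ₀ : ℝ, 0 < μ₀ ∧
      -- `μ₀` is the mass parameter for which the smallest eigenvalue of `H₂` is zero
      (∀ m : ℝ, IsLeast {s : ℝ | (s : ℂ) ∈ eigenvalueSet (yangMillsLine c₁ αM m)} 0 ↔ m = μ₀) ∧
      ∀ μbar : ℝ, μbar < μ₀ →
        ∃ (H : L2 halfPlane →ₗ.[ℂ] L2 halfPlane)
          (lamT mu : ℕ → ℝ) (lam : ℕ → ℕ → ℝ)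
          (u η : ℕ → ℝ → ℂ) (ψT ψ : ℕ → ℕ → ℝ × ℝ → ℂ)
          (b : HilbertBasis (ℕ × ℕ) ℂ (L2 halfPlane)),
          -- the operator `H = H₂⁻¹ H̃₁ = H̃₁ H₂⁻¹`
          IsSelfAdjoint H ∧
          (yangMillsPlane c₁ αM μbar).toFun.ker = ⊥ ∧
          (yangMillsPlane c₁ αM μbar).toFun.range = ⊤ ∧
          H = natComp tildePlane (yangMillsPlane c₁ αM μbar).inverse ∧
          (natComp (yangMillsPlane c₁ αM μbar).inverse tildePlane).IsClosable ∧
          H = (natComp (yangMillsPlane c₁ αM μbar).inverse tildePlane).closure ∧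
          -- the eigenvalues of `H̃₁` and of `H₂`
          StrictMono lamT ∧ 0 < lamT 0 ∧
          eigenvalueSet tildeLine = Set.range (fun i => (lamT i : ℂ)) ∧
          StrictMono mu ∧ 0 < mu 0 ∧
          eigenvalueSet (yangMillsLine c₁ αM μbar) = Set.range (fun j => (mu j : ℂ)) ∧
          -- their eigenfunctions, the products of these, and the rescaled products
          (∀ i, IsEigenfunction tildeLine (lamT i) (u i)) ∧
          (∀ j, IsEigenfunction (yangMillsLine c₁ αM μbar) (mu j) (η j)) ∧
          (∀ i j r y, ψT i j (r, y) = u i r * η j y) ∧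
          (∀ i j r y, ψ i j (r, y) = ψT i j (lam i j ^ (-(1 / 2) : ℝ) * r, y)) ∧
          -- `H` has pure point spectrum, with eigenvalues `lam i j`
          (∀ i j, lam i j = lamT i * (mu j)⁻¹ ∧ 0 < lam i j) ∧
          eigenvalueSet H = Set.range (fun p : ℕ × ℕ => (lam p.1 p.2 : ℂ)) ∧
          (∀ i j, IsEigenfunction H (lam i j) (ψT i j)) ∧
          (∀ i j, IsEigenfunction (natComp (yangMillsPlane c₁ αM μbar).inverse tildePlane)
            (lam i j) (ψT i j)) ∧
          (∀ i j, b (i, j) =ᵐ[volume.restrict halfPlane] ψT i j) ∧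
          H.HasCore (Submodule.span ℂ (Set.range b)) ∧
          -- monotonicity and limits
          (∀ j, StrictMono (fun i => lam i j)) ∧
          (∀ i, StrictAnti (fun j => lam i j)) ∧
          (∀ j, Tendsto (fun i => lam i j) atTop atTop) ∧
          (∀ i, Tendsto (fun j => lam i j) atTop (𝓝 0)) ∧
          -- the rescaled eigenfunctions solve the Wheeler-DeWitt equation
          (∀ i j, SolvesWheelerDeWitt c₁ αM μbar (-(lam i j ^ 3)⁻¹) (ψ i j)) ∧
          -- the Schroedinger equation with initial values in the span of the eigenfunctions
          (∀ (a : ℕ × ℕ →₀ ℂ) (Ψ : ℝ → L2 halfPlane),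
            (Ψ 0 = ∑ p ∈ a.support, a p • b p ∧ IsSchroedingerSolution H Ψ) ↔
              ∀ t : ℝ, Ψ t = ∑ p ∈ a.support,
                (a p * Complex.exp (-Complex.I * (lam p.1 p.2 : ℂ) * (t : ℂ))) • b p) ∧
          (∀ (a : ℕ × ℕ →₀ ℂ) (t : ℝ) (i j : ℕ),
            SolvesWheelerDeWitt c₁ αM μbar (-(lam i j ^ 3)⁻¹) (fun x =>
              (a (i, j) * Complex.exp (-Complex.I * (lam i j : ℂ) * (t : ℂ))) * ψ i j x)) := by

  obtain ⟨μ₀, hμ₀, hiff, hex⟩ := exists_critical_mass hc₁ hαM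
  refine ⟨μ₀, hμ₀, hiff, fun μbar hμbar => ?_⟩
  obtain ⟨lamT, b₁, hlamT, hlamTtop, hlamT0, hb₁⟩ := exists_eigenbasis_tildeLine
  obtain ⟨mu, b₂, hmu, hmutop, hmu0, hb₂⟩ := hex μbar hμbar
  have hlamTpos : ∀ i, 0 < lamT i := fun i => hlamT0.trans_le (hlamT.monotone (Nat.zero_le i))
  have hmupos : ∀ j, 0 < mu j := fun j => hmu0.trans_le (hmu.monotone (Nat.zero_le j))
  have hβ : 0 < 2 * αM := by positivity
  -- Classical representatives of the eigenvectors on the line.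
  have hclass₁ : ∀ i, ∃ u u' : ℝ → ℂ, b₁ i =ᵐ[volume.restrict halfLine] u ∧
      SolvesODE halfLine (fun r => ((r ^ 4 : ℝ) - lamT i : ℂ)) u u' := by
    intro i
    have h := hb₁ i
    rw [tildeLine, gravityLine, graph_diffOperator isOpen_Ioi] at h
    obtain ⟨u, v, h1, -, -, h4⟩ := exists_solvesODE isOpen_Ioi ordConnected_Ioi nonempty_Ioi
      one_pos h
    refine ⟨u, v, h1, fun r hr => ⟨(h4 r hr).1, (h4 r hr).2.congr_deriv ?_⟩⟩
    simp
  have hclass₂ : ∀ j, ∃ η η' : ℝ → ℂ, b₂ j =ᵐ[volume.restrict univ] η ∧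
      SolvesODE univ (fun y => ((2 * αM * y ^ 4 - μbar * y ^ 2 : ℝ) - mu j : ℂ) / c₁) η η' := by
    intro j
    have h := hb₂ j
    rw [yangMillsLine, graph_diffOperator isOpen_univ] at h
    obtain ⟨u, v, h1, -, -, h4⟩ := exists_solvesODE isOpen_univ ordConnected_univ univ_nonempty
      hc₁ h
    exact ⟨u, v, h1, h4⟩
  choose u u' hbu hu using hclass₁
  choose η η' hbη hη using hclass₂
  obtain ⟨b, hb⟩ := exists_hilbertBasis_tensor b₁ b₂
  have hbT : ∀ p, (b p, (lamT p.1 : ℂ) • b p) ∈ tildePlane.graph := fun p => by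
    rw [hb]
    exact tensor_mem_gravityPlane (hb₁ p.1) (mem_energySpace_of_yangMillsLine (hb₂ p.2))
  have hbY : ∀ p, (b p, (mu p.2 : ℂ) • b p) ∈ (yangMillsPlane c₁ αM μbar).graph := fun p => by
    rw [hb]
    exact tensor_mem_yangMillsPlane (hb₂ p.2) (mem_energySpace_of_gravityLine (hb₁ p.1))
  -- All four operators are diagonal; `κ = μbar / (4 α_M)` completes the square in `H₂`.
  have hT₁ : IsDiagonal b₁ lamT tildeLine :=
    isDiagonal_diffOperator isOpen_Ioi (by fun_prop) (β := 1) (κ := 0) one_pos one_pos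
      (fun r => by simp only [ContinuousMap.coe_mk]; ring) hb₁
  have hY₂ : IsDiagonal b₂ mu (yangMillsLine c₁ αM μbar) :=
    isDiagonal_diffOperator isOpen_univ (by fun_prop) (β := 2 * αM) (κ := μbar / (4 * αM)) hc₁ hβ
      (fun y => by simp only [ContinuousMap.coe_mk]; field_simp; ring) hb₂
  have hT : IsDiagonal b (fun p => lamT p.1) tildePlane :=
    isDiagonal_diffOperator isOpen_halfPlane (by fun_prop) (β := 1) (κ := 0) one_pos one_pos
      (fun p => by simp only [ContinuousMap.coe_mk]; ring) hbT
  have hY : IsDiagonal b (fun p => mu p.2) (yangMillsPlane c₁ αM μbar) :=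
    isDiagonal_diffOperator isOpen_halfPlane (by fun_prop) (β := 2 * αM) (κ := μbar / (4 * αM))
      hc₁ hβ (fun p => by simp only [ContinuousMap.coe_mk]; field_simp; ring) hbY
  have hYbound : ∀ p : ℕ × ℕ, mu 0 ≤ mu p.2 := fun p => hmu.monotone (Nat.zero_le _)
  have hH := hT.natComp_inverse hY hmu0 hYbound
  obtain ⟨hle, hmem⟩ := hT.inverse_natComp hY hmu0 hYbound
  obtain ⟨hclosable, hclosure⟩ :=
    hH.closure_eq hle fun p => LinearPMap.mem_domain_of_mem_graph (hmem p)
  have hrep : ∀ i j, b (i, j) =ᵐ[volume.restrict halfPlane] fun p => u i p.1 * η j p.2 :=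
    fun i j => by
      rw [hb]
      exact (coeFn_tensor _ _).trans (ae_eq_tensor (hbu i) (hbη j))
  have hWDW : ∀ i j, SolvesWheelerDeWitt c₁ αM μbar (-((lamT i * (mu j)⁻¹) ^ 3)⁻¹)
      fun p => u i ((lamT i * (mu j)⁻¹) ^ (-(1 / 2) : ℝ) * p.1) * η j p.2 := fun i j =>
    solvesWheelerDeWitt_of_eigenvectors hc₁ (hlamTpos i) (hmupos j) (hb₁ i) (hb₂ j) (hbu i)
      (hbη j) (hu i) (hη j)
  refine ⟨natComp tildePlane (yangMillsPlane c₁ αM μbar).inverse, lamT, mu,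
    fun i j => lamT i * (mu j)⁻¹, u, η, fun i j p => u i p.1 * η j p.2,
    fun i j p => u i ((lamT i * (mu j)⁻¹) ^ (-(1 / 2) : ℝ) * p.1) * η j p.2, b,
    hH.isSelfAdjoint, hY.ker_eq_bot fun p => (hmupos p.2).ne', hY.range_eq_top hmu0 hYbound, rfl,
    hclosable, hclosure.symm, hlamT, hlamT0, hT₁.eigenvalueSet_eq, hmu, hmu0, hY₂.eigenvalueSet_eq,
    fun i => isEigenfunction_of_mem_graph (hb₁ i) (b₁.ne_zero i) (hbu i),
    fun j => isEigenfunction_of_mem_graph (hb₂ j) (b₂.ne_zero j) (hbη j),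
    fun i j r y => rfl, fun i j r y => rfl,
    fun i j => ⟨rfl, mul_pos (hlamTpos i) (inv_pos.2 (hmupos j))⟩, hH.eigenvalueSet_eq,
    fun i j => isEigenfunction_of_mem_graph (hH.basis_mem (i, j)) (b.ne_zero _) (hrep i j),
    fun i j => isEigenfunction_of_mem_graph (hmem (i, j)) (b.ne_zero _) (hrep i j), hrep,
    hH.hasCore_span, fun j i i' h => mul_lt_mul_of_pos_right (hlamT h) (inv_pos.2 (hmupos j)),
    fun i j j' h => mul_lt_mul_of_pos_left (inv_strictAnti₀ (hmupos j) (hmu h)) (hlamTpos i),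
    fun j => hlamTtop.atTop_mul_const (inv_pos.2 (hmupos j)), fun i => ?_, hWDW,
    fun a Ψ => hH.isSchroedingerSolution_iff a Ψ, fun a t i j => (hWDW i j).const_mul _⟩
  simpa using (tendsto_inv_atTop_zero.comp hmutop).const_mul (lamT i)
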